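/- Let $n\ge 2$, let $T^{2n}=\mathbb{R}^{2n}/\mathbb{Z}^{2n}$ and let $\omega$ be a translation-invariant symplectic form on $T^{2n}$, given by a non-degenerate skew form $\Omega$ on $\mathbb{R}^{2n}$. Let $\nabla^0$ be the standard flat connection ($\nabla^0_{\partial_a}\partial_b=0$). A formal curve of symplectic connections starting at $\nabla^0$ is a series $\nabla^t=\nabla^0+\sum_{k\ge1}t^kA^{(k)}$ with smooth $(2,1)$-tensors $A^{(k)}$ such that $\omega(A^{(k)}(X)Y,Z)$ is totally symmetric; equivalently, it is a torsion-free connection on formal curves of vector fields ($\mathbb{R}[[t]]$-linear derivations of $C^\infty(T^{2n})[[t]]$) for which $\omega$ is parallel and which reduces to $\nabla^0$ at $t=0$. With $R^t(X,Y)=[\nabla^t_X,\nabla^t_Y]-\nabla^t_{[X,Y]}$ and $r^t(X,Y)=\operatorname{Trace}[Z\mapsto R^t(X,Z)Y]$, it is of Ricci type if $$\omega(R^t(X,Y)Z,T)=\frac{-1}{2(n+1)}\bigl[2\omega(X,Y)r^t(Z,T)+\omega(X,Z)r^t(Y,T)+\omega(X,T)r^t(Y,Z)-\omega(Y,Z)r^t(X,T)-\omega(Y,T)r^t(X,Z)\bigr]$$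 for all vector fields $X,Y,Z,T$. A formal curve of symplectomorphisms is a homomorphism of Poisson algebras $\psi_t=\sum_{k\ge0}t^k\psi^{(k)}:C^\infty(T^{2n})\to C^\infty(T^{2n})[[t]]$ with $\psi^{(0)}$ an isomorphism. Extended $\mathbb{R}[[t]]$-linearly, it acts on formal vector fields by $\psi_t\cdot X=\psi_t\circ X\circ\psi_t^{-1}$ and on formal curves of connections by $(\psi_t\cdot\nabla^t)_XY=\psi_t\cdot(\nabla^t_{\psi_t^{-1}\cdot X}\,\psi_t^{-1}\cdot Y)$. Two formal curves of connections are equivalent if some $\psi_t$ carries one to the other. Let $\mathcal{A}$ be the set of formal curves $A^t=\sum_{k\ge1}t^kA^{(k)}$ of linear maps $A^{(k)}:\mathbb{R}^{2n}\to\mathfrak{sp}(\mathbb{R}^{2n},\Omega)$ with $A^t(X)A^t(Y)=0$ and $A^t(X)Y=A^t(Y)X$ for all $X,Y\in\mathbb{R}^{2n}$. The group $Sp(2n,\mathbb{Z})=\{C\in GL(2n,\mathbb{Z}): C^{T}\Omega C=\Omega\}$ acts on $\mathcal{A}$ by $(C\cdot A^t)(X)=C\,A^t(C^{-1}X)\,C^{-1}$.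 Theorem. For every $A^t\in\mathcal{A}$, $\nabla^0+A^t$ (the connection with $\nabla^t_XY=A^t(X)Y$ for invariant $X,Y$) is a formal curve of Ricci-type symplectic connections starting at $\nabla^0$, and $A^t\mapsto[\nabla^0+A^t]$ induces a bijection from $\mathcal{A}/Sp(2n,\mathbb{Z})$ onto the set of equivalence classes of formal curves of Ricci-type symplectic connections on $(T^{2n},\omega)$ starting at $\nabla^0$. -/

import Mathlib

open scoped PowerSeries ContDiff

noncomputable section

namespace RicciTorus

/-! ### Functions and vector fields on the torus -/

/-- The algebra `C^∞(T^m)` of smooth functions on `T^m = ℝ^m / ℤ^m`, realised as the algebra of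
smooth `ℤ^m`-periodic functions on `ℝ^m`. -/
def smoothFunctions (m : ℕ) : Subalgebra ℝ ((Fin m → ℝ) → ℝ) where
  carrier := {f | ContDiff ℝ ∞ f ∧ ∀ (k : Fin m → ℤ) (x : Fin m → ℝ), f (fun i => x i + k i) = f x}
  mul_mem' := fun hf hg => ⟨hf.1.mul hg.1, fun k x => by simp [hf.2 k x, hg.2 k x]⟩
  add_mem' := fun hf hg => ⟨hf.1.add hg.1, fun k x => by simp [hf.2 k x, hg.2 k x]⟩
  algebraMap_mem' := fun r => ⟨contDiff_const, fun _ _ => rfl⟩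

/-- `C^∞(T^m)`. -/
abbrev Fn (m : ℕ) : Type := smoothFunctions m

/-- `C^∞(T^m)⟦t⟧`: formal curves of functions. -/
abbrev FormalFn (m : ℕ) : Type := (Fn m)⟦X⟧

/-- Formal curves of vector fields on `T^m`, viewed as `ℝ⟦t⟧`-linear derivations of
`C^∞(T^m)⟦t⟧`. -/
abbrev FormalVF (m : ℕ) : Type := Derivation ℝ⟦X⟧ (FormalFn m) (FormalFn m)

variable {m : ℕ}

theorem partialFn_mem (a : Fin m) (f : Fn m) :
    (fun x => fderiv ℝ f.1 x (Pi.single a 1)) ∈ smoothFunctions m := by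
  refine ⟨(f.2.1.fderiv_right (m := ∞) (by simp)).clm_apply contDiff_const, fun k x => ?_⟩
  have h : (fun y : Fin m → ℝ => f.1 (y + fun i => (k i : ℝ))) = f.1 :=
    funext fun y => f.2.2 k y
  have h2 := fderiv_comp_add_right (𝕜 := ℝ) (f := f.1) (x := x) (fun i => (k i : ℝ))
  rw [h] at h2
  exact congrArg (fun L => L (Pi.single a 1)) h2.symm

/-- The invariant vector field `∂_a` as a derivation of `C^∞(T^m)`. -/
def partialFn (a : Fin m) : Derivation ℝ (Fn m) (Fn m) :=
  Derivation.mk'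
    { toFun := fun f => ⟨fun x => fderiv ℝ f.1 x (Pi.single a 1), partialFn_mem a f⟩
      map_add' := fun f g => Subtype.ext <| funext fun x => by
        have hf := (f.2.1.differentiable (by simp)) x
        have hg := (g.2.1.differentiable (by simp)) x
        change fderiv ℝ (f.1 + g.1) x _ = fderiv ℝ f.1 x _ + fderiv ℝ g.1 x _
        rw [fderiv_add hf hg]; rfl
      map_smul' := fun c f => Subtype.ext <| funext fun x => by
        have hf := (f.2.1.differentiable (by simp)) x
        change fderiv ℝ (c • f.1) x _ = c • fderiv ℝ f.1 x _
        rw [fderiv_const_smul hf]; rfl }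
    (fun f g => Subtype.ext <| funext fun x => by
      have hf := (f.2.1.differentiable (by simp)) x
      have hg := (g.2.1.differentiable (by simp)) x
      change fderiv ℝ (f.1 * g.1) x _ = f.1 x * fderiv ℝ g.1 x _ + g.1 x * fderiv ℝ f.1 x _
      rw [fderiv_mul hf hg]; rfl)

/-- The invariant vector field `∂_a`, acting coefficientwise on `C^∞(T^m)⟦t⟧`. -/
def frame (a : Fin m) : FormalVF m :=
  Derivation.mk'
    { toFun := fun F => PowerSeries.mk fun k => partialFn a (PowerSeries.coeff k F)
      map_add' := fun F G => by ext1 k; simp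
      map_smul' := fun r F => by
        ext1 k
        simp [Algebra.smul_def, PowerSeries.algebraMap_apply'', PowerSeries.coeff_mul] }
    (fun F G => by
      ext1 k
      simp only [LinearMap.coe_mk, AddHom.coe_mk, PowerSeries.coeff_mk, PowerSeries.coeff_mul,
        map_sum, map_add, Derivation.leibniz, smul_eq_mul, Finset.sum_add_distrib]
      congr 1
      rw [← Finset.Nat.sum_antidiagonal_swap]
      rfl)

theorem cos_mem (a : Fin m) :
    (fun x : Fin m → ℝ => Real.cos (2 * Real.pi * x a)) ∈ smoothFunctions m := by
  refine ⟨Real.contDiff_cos.comp (contDiff_const.mul (contDiff_apply ℝ ℝ a)), fun k x => ?_⟩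
  change Real.cos (2 * Real.pi * (x a + k a)) = Real.cos (2 * Real.pi * x a)
  rw [← Real.cos_add_int_mul_two_pi (2 * Real.pi * x a) (k a)]
  ring_nf

theorem sin_mem (a : Fin m) :
    (fun x : Fin m → ℝ => Real.sin (2 * Real.pi * x a)) ∈ smoothFunctions m := by
  refine ⟨Real.contDiff_sin.comp (contDiff_const.mul (contDiff_apply ℝ ℝ a)), fun k x => ?_⟩
  change Real.sin (2 * Real.pi * (x a + k a)) = Real.sin (2 * Real.pi * x a)
  rw [← Real.sin_add_int_mul_two_pi (2 * Real.pi * x a) (k a)]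
  ring_nf

/-- `cos (2π x^a)` -/
def cosFn (a : Fin m) : Fn m := ⟨fun x => Real.cos (2 * Real.pi * x a), cos_mem a⟩

/-- `sin (2π x^a)` -/
def sinFn (a : Fin m) : Fn m := ⟨fun x => Real.sin (2 * Real.pi * x a), sin_mem a⟩

/-- The invariant `1`-form `dx^a`, evaluated on a formal vector field.  The angle `x^a` is not a
function on the torus, but
`dx^a = (2π)⁻¹ (cos (2π x^a) d(sin (2π x^a)) - sin (2π x^a) d(cos (2π x^a)))`. -/
def dx (a : Fin m) (X : FormalVF m) : FormalFn m :=
  (2 * Real.pi)⁻¹ • (PowerSeries.C (cosFn a) * X (PowerSeries.C (sinFn a)) -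
    PowerSeries.C (sinFn a) * X (PowerSeries.C (cosFn a)))

/-- The invariant `2`-form `ω = ω_{ab} dx^a ⊗ dx^b` with constant coefficient matrix `Ω`. -/
def omega (Ω : Matrix (Fin m) (Fin m) ℝ) (X Y : FormalVF m) : FormalFn m :=
  ∑ a, ∑ b, Ω a b • (dx a X * dx b Y)

/-! ### Formal curves of connections -/

/-- `D X Y = ∇^t_X Y` is a formal curve of linear connections: an `ℝ⟦t⟧`-linear connection on
formal vector fields.  (The difference of two of these is `C^∞(T^m)⟦t⟧`-bilinear,
hence a series `∑ t^k A^{(k)}` of `(2,1)`-tensors.) -/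
structure IsConnection (D : FormalVF m → FormalVF m → FormalVF m) : Prop where
  add_left : ∀ X X' Y, D (X + X') Y = D X Y + D X' Y
  smul_left : ∀ (F : FormalFn m) X Y, D (F • X) Y = F • D X Y
  add_right : ∀ X Y Y', D X (Y + Y') = D X Y + D X Y'
  leibniz : ∀ (F : FormalFn m) X Y, D X (F • Y) = X F • Y + F • D X Y

/-- Formal curves of symplectic connections: torsion-free, and `ω` is parallel. -/
structure IsSymplecticConnection (Ω : Matrix (Fin m) (Fin m) ℝ)
    (D : FormalVF m → FormalVF m → FormalVF m) : Prop extends IsConnection D where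
  torsion_free : ∀ X Y, D X Y - D Y X = ⁅X, Y⁆
  parallel : ∀ X Y Z, X (omega Ω Y Z) = omega Ω (D X Y) Z + omega Ω Y (D X Z)

/-- The standard flat connection, `∇^0_X Y = X(Y^a) ∂_a`. -/
def standardFlat (X Y : FormalVF m) : FormalVF m := ∑ a, X (dx a Y) • frame a

/-- The leading term of the formal curve `D` is the standard flat connection. -/
def StartsAtStandardFlat (D : FormalVF m → FormalVF m → FormalVF m) : Prop :=
  ∀ X Y F, PowerSeries.constantCoeff (D X Y F) =
    PowerSeries.constantCoeff (standardFlat X Y F)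

/-- The formal curvature endomorphism. -/
def curvature (D : FormalVF m → FormalVF m → FormalVF m) (X Y Z : FormalVF m) : FormalVF m :=
  D X (D Y Z) - D Y (D X Z) - D ⁅X, Y⁆ Z

/-- The formal Ricci tensor `r(X,Y) = Trace [Z ↦ R(X,Z)Y]`. -/
def ricci (D : FormalVF m → FormalVF m → FormalVF m) (X Y : FormalVF m) : FormalFn m :=
  ∑ a, dx a (curvature D X (frame a) Y)

/-- The Ricci part `E` of the formal curvature tensor, in dimension `2 n`. -/
def ricciPart {n : ℕ} (Ω : Matrix (Fin (2 * n)) (Fin (2 * n)) ℝ)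
    (D : FormalVF (2 * n) → FormalVF (2 * n) → FormalVF (2 * n))
    (X Y Z T : FormalVF (2 * n)) : FormalFn (2 * n) :=
  (-1 / (2 * ((n : ℝ) + 1))) •
    (2 * (omega Ω X Y * ricci D Z T) + omega Ω X Z * ricci D Y T + omega Ω X T * ricci D Y Z
      - omega Ω Y Z * ricci D X T - omega Ω Y T * ricci D X Z)

/-- The formal curvature is of Ricci type: `R = E`, i.e. `W = 0`. -/
def IsRicciType {n : ℕ} (Ω : Matrix (Fin (2 * n)) (Fin (2 * n)) ℝ)
    (D : FormalVF (2 * n) → FormalVF (2 * n) → FormalVF (2 * n)) : Prop :=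
  ∀ X Y Z T, omega Ω (curvature D X Y Z) T = ricciPart Ω D X Y Z T

/-- The set of formal curves of Ricci-type symplectic connections on `(T^{2n}, ω)` starting with
the standard flat connection. -/
def ricciCurves {n : ℕ} (Ω : Matrix (Fin (2 * n)) (Fin (2 * n)) ℝ) :
    Set (FormalVF (2 * n) → FormalVF (2 * n) → FormalVF (2 * n)) :=
  {D | IsSymplecticConnection Ω D ∧ IsRicciType Ω D ∧ StartsAtStandardFlat D}

/-! ### Formal curves of symplectomorphisms -/

/-- The Poisson bracket `{f, g} = X_f(g)` where `i(X_f) ω = df`, on `C^∞(T^m)`. -/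
def bracket (Ω : Matrix (Fin m) (Fin m) ℝ) : Fn m →ₗ[ℝ] Fn m →ₗ[ℝ] Fn m :=
  ∑ a, ∑ b, Ω⁻¹ a b • (LinearMap.mul ℝ (Fn m)).compl₁₂
    (partialFn a : Fn m →ₗ[ℝ] Fn m) (partialFn b : Fn m →ₗ[ℝ] Fn m)

theorem bracket_apply (Ω : Matrix (Fin m) (Fin m) ℝ) (f g : Fn m) :
    bracket Ω f g = ∑ a, ∑ b, Ω⁻¹ a b • (partialFn a f * partialFn b g) := by
  simp [bracket, LinearMap.sum_apply]

/-- The `ℝ⟦t⟧`-bilinear extension of a bilinear operation on `C^∞(T^m)` to `C^∞(T^m)⟦t⟧`. -/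
def extendBilin (β : Fn m →ₗ[ℝ] Fn m →ₗ[ℝ] Fn m) (F G : FormalFn m) : FormalFn m :=
  PowerSeries.mk fun k => ∑ p ∈ Finset.HasAntidiagonal.antidiagonal k,
    β (PowerSeries.coeff p.1 F) (PowerSeries.coeff p.2 G)

/-- A formal curve of symplectomorphisms: a homomorphism of Poisson algebras
`ψ_t : C^∞(T^m) → C^∞(T^m)⟦t⟧` whose leading term `ψ^{(0)}` is an isomorphism. -/
structure FormalSymplectomorphism (Ω : Matrix (Fin m) (Fin m) ℝ) where
  toAlgHom : Fn m →ₐ[ℝ] FormalFn m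
  map_bracket : ∀ f g, toAlgHom (bracket Ω f g) =
    extendBilin (bracket Ω) (toAlgHom f) (toAlgHom g)
  bijective_leading : Function.Bijective fun f => PowerSeries.constantCoeff (toAlgHom f)

/-- The extension of `ψ_t` by linearity over `ℝ⟦t⟧`. -/
def extendFun (ψ : Fn m →ₐ[ℝ] FormalFn m) (F : FormalFn m) : FormalFn m :=
  PowerSeries.mk fun k => ∑ p ∈ Finset.HasAntidiagonal.antidiagonal k,
    PowerSeries.coeff p.1 (ψ (PowerSeries.coeff p.2 F))

theorem extendFun_extendBilin (ψ : Fn m →ₐ[ℝ] FormalFn m) (β : Fn m →ₗ[ℝ] Fn m →ₗ[ℝ] Fn m)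
    (h : ∀ f g, ψ (β f g) = extendBilin β (ψ f) (ψ g)) (F G : FormalFn m) :
    extendFun ψ (extendBilin β F G) = extendBilin β (extendFun ψ F) (extendFun ψ G) := by
  ext1 k
  simp only [extendFun, extendBilin, PowerSeries.coeff_mk, map_sum, LinearMap.sum_apply, h,
    Finset.sum_sigma']
  refine Finset.sum_nbij'
    (fun x => ⟨(x.2.2.1 + x.2.1.1, x.2.2.2 + x.2.1.2), (x.2.2.2, x.2.1.2), (x.2.2.1, x.2.1.1)⟩)
    (fun x => ⟨(x.2.2.1 + x.2.1.1, x.2.2.2 + x.2.1.2), (x.2.2.2, x.2.1.2), (x.2.2.1, x.2.1.1)⟩)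
    ?_ ?_ ?_ ?_ ?_
  all_goals
    rintro ⟨⟨i, j⟩, ⟨k₁, l⟩, ⟨p, q⟩⟩ hx
    simp only [Finset.mem_sigma, Finset.HasAntidiagonal.mem_antidiagonal] at hx
    obtain ⟨h1, rfl, rfl⟩ := hx
    simp [Finset.mem_sigma, Finset.HasAntidiagonal.mem_antidiagonal]
  all_goals omega

theorem extendBilin_mul (F G : FormalFn m) :
    extendBilin (LinearMap.mul ℝ (Fn m)) F G = F * G := by
  ext1 k
  simp [extendBilin, PowerSeries.coeff_mul]

theorem coeff_extendFun (ψ : Fn m →ₐ[ℝ] FormalFn m) (F : FormalFn m) (k : ℕ) :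
    PowerSeries.coeff k (extendFun ψ F) =
      ∑ j ∈ Finset.range k, PowerSeries.coeff (k - j) (ψ (PowerSeries.coeff j F)) +
        PowerSeries.constantCoeff (ψ (PowerSeries.coeff k F)) := by
  rw [extendFun, PowerSeries.coeff_mk, ← Finset.Nat.sum_antidiagonal_swap]
  simp only [Prod.fst_swap, Prod.snd_swap]
  rw [Finset.Nat.sum_antidiagonal_eq_sum_range_succ
    (fun i j => PowerSeries.coeff j (ψ (PowerSeries.coeff i F))), Finset.sum_range_succ]
  simp

/-- The extension of `ψ_t` as a morphism of `ℝ⟦t⟧`-algebras. -/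
def extendHom (ψ : Fn m →ₐ[ℝ] FormalFn m) : FormalFn m →ₐ[ℝ⟦X⟧] FormalFn m :=
  have hmul : ∀ F G, extendFun ψ (F * G) = extendFun ψ F * extendFun ψ G := fun F G => by
    simp only [← extendBilin_mul]
    exact extendFun_extendBilin ψ _ (fun f g => by simp [extendBilin_mul]) F G
  have halg : ∀ r : ℝ⟦X⟧, extendFun ψ (algebraMap ℝ⟦X⟧ (FormalFn m) r) =
      algebraMap ℝ⟦X⟧ (FormalFn m) r := fun r => by
    ext1 k
    rw [coeff_extendFun]
    simp only [PowerSeries.algebraMap_apply'', PowerSeries.coeff_map, AlgHom.commutes]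
    rw [Finset.sum_eq_zero]
    · simp [PowerSeries.algebraMap_apply]
    · intro j hj
      have : k - j ≠ 0 := by have := Finset.mem_range.1 hj; omega
      simp [PowerSeries.algebraMap_apply, PowerSeries.coeff_C, this]
  { toFun := extendFun ψ
    map_one' := by simpa using halg 1
    map_mul' := hmul
    map_zero' := by ext1 k; simp [extendFun]
    map_add' := fun F G => by ext1 k; simp [extendFun, Finset.sum_add_distrib]
    commutes' := halg }

theorem extendHom_apply (ψ : Fn m →ₐ[ℝ] FormalFn m) (F : FormalFn m) :
    extendHom ψ F = extendFun ψ F := rfl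

/-- Coefficientwise recursive solution of `ψ_t F = G`, given a section `s` of `ψ^{(0)}`. -/
def solveCoeff (ψ : Fn m →ₐ[ℝ] FormalFn m) (s : Fn m → Fn m) (G : FormalFn m) : ℕ → Fn m
  | k => s (PowerSeries.coeff k G -
      ∑ j : Fin k, PowerSeries.coeff (k - j) (ψ (solveCoeff ψ s G j)))

theorem extendHom_bijective (ψ : Fn m →ₐ[ℝ] FormalFn m)
    (h : Function.Bijective fun f => PowerSeries.constantCoeff (ψ f)) :
    Function.Bijective (extendHom ψ) := by
  constructor
  · refine (injective_iff_map_eq_zero _).2 fun F hF => ?_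
    ext1 k
    induction k using Nat.strong_induction_on with
    | _ k ih =>
      have hk := congrArg (PowerSeries.coeff k) hF
      rw [extendHom_apply, coeff_extendFun, Finset.sum_eq_zero, zero_add] at hk
      · refine h.1 ?_
        simpa using hk
      · intro j hj
        rw [ih j (Finset.mem_range.1 hj)]
        simp
  · intro G
    obtain ⟨s, hs⟩ := h.2.hasRightInverse
    refine ⟨PowerSeries.mk (solveCoeff ψ s G), ?_⟩
    ext1 k
    rw [extendHom_apply, coeff_extendFun]
    simp only [PowerSeries.coeff_mk]
    conv_lhs => rw [solveCoeff.eq_1 ψ s G k]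
    have := hs (PowerSeries.coeff k G -
      ∑ j : Fin k, PowerSeries.coeff (k - j) (ψ (solveCoeff ψ s G j)))
    simp only at this
    rw [this, Finset.sum_range (fun j => PowerSeries.coeff (k - j) (ψ (solveCoeff ψ s G j)))]
    abel

/-- The extension of a formal curve of symplectomorphisms to an automorphism of the
`ℝ⟦t⟧`-algebra `C^∞(T^m)⟦t⟧`. -/
def FormalSymplectomorphism.extend {Ω : Matrix (Fin m) (Fin m) ℝ}
    (ψ : FormalSymplectomorphism Ω) : FormalFn m ≃ₐ[ℝ⟦X⟧] FormalFn m :=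
  AlgEquiv.ofBijective (extendHom ψ.toAlgHom)
    (extendHom_bijective ψ.toAlgHom ψ.bijective_leading)

theorem FormalSymplectomorphism.extend_apply {Ω : Matrix (Fin m) (Fin m) ℝ}
    (ψ : FormalSymplectomorphism Ω) (F : FormalFn m) :
    ψ.extend F = extendFun ψ.toAlgHom F := rfl

theorem algEquiv_X_mul (Φ : FormalFn m ≃ₐ[ℝ⟦X⟧] FormalFn m) (F : FormalFn m) :
    Φ (PowerSeries.X * F) = PowerSeries.X * Φ F := by
  have hX : (PowerSeries.X : FormalFn m) = algebraMap ℝ⟦X⟧ (FormalFn m) PowerSeries.X := by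
    simp [PowerSeries.algebraMap_apply'']
  rw [map_mul, hX, AlgEquiv.commutes]

theorem algEquiv_eq_of_const (Φ Φ' : FormalFn m ≃ₐ[ℝ⟦X⟧] FormalFn m)
    (h : ∀ f : Fn m, Φ (PowerSeries.C f) = Φ' (PowerSeries.C f)) : Φ = Φ' := by
  have key : ∀ (k : ℕ) (F : FormalFn m),
      PowerSeries.coeff k (Φ F) = PowerSeries.coeff k (Φ' F) := by
    intro k
    induction k with
    | zero =>
      intro F
      rw [PowerSeries.eq_X_mul_shift_add_const F, map_add Φ, map_add Φ', algEquiv_X_mul,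
        algEquiv_X_mul, h]
      simp
    | succ k ih =>
      intro F
      rw [PowerSeries.eq_X_mul_shift_add_const F, map_add Φ, map_add Φ', algEquiv_X_mul,
        algEquiv_X_mul, h, map_add, map_add, PowerSeries.coeff_succ_X_mul,
        PowerSeries.coeff_succ_X_mul, ih]
  ext1 F
  ext1 k
  exact key k F

theorem extendBilin_C (β : Fn m →ₗ[ℝ] Fn m →ₗ[ℝ] Fn m) (f g : Fn m) :
    extendBilin β (PowerSeries.C f) (PowerSeries.C g) = PowerSeries.C (β f g) := by
  ext1 k
  rw [extendBilin, PowerSeries.coeff_mk]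
  cases k with
  | zero => simp
  | succ k =>
    rw [Finset.sum_eq_zero]
    · simp
    · rintro ⟨i, j⟩ hij
      rw [Finset.HasAntidiagonal.mem_antidiagonal] at hij
      by_cases hi : i = 0
      · have : j ≠ 0 := by simp only at hij; omega
        simp [PowerSeries.coeff_C, this]
      · simp [PowerSeries.coeff_C, hi]

theorem exists_extend_eq_iff (Ω : Matrix (Fin m) (Fin m) ℝ)
    (Φ : FormalFn m ≃ₐ[ℝ⟦X⟧] FormalFn m) :
    (∃ ψ : FormalSymplectomorphism Ω, ψ.extend = Φ) ↔
      ∀ F G, Φ (extendBilin (bracket Ω) F G) = extendBilin (bracket Ω) (Φ F) (Φ G) := by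
  constructor
  · rintro ⟨ψ, rfl⟩ F G
    exact extendFun_extendBilin ψ.toAlgHom _ ψ.map_bracket F G
  · intro h
    have hcomm : ∀ r : ℝ, Φ (PowerSeries.C (algebraMap ℝ (Fn m) r)) =
        algebraMap ℝ (FormalFn m) r := fun r => by
      have := Φ.commutes (PowerSeries.C r)
      simpa [PowerSeries.algebraMap_apply'', PowerSeries.algebraMap_apply] using this
    let ψ : FormalSymplectomorphism Ω :=
      { toAlgHom := { (Φ : FormalFn m →+* FormalFn m).comp PowerSeries.C with
          commutes' := hcomm }
        map_bracket := fun f g => by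
          change Φ (PowerSeries.C _) = extendBilin _ (Φ (PowerSeries.C f)) (Φ (PowerSeries.C g))
          rw [← h, extendBilin_C]
        bijective_leading := by
          change Function.Bijective
            ((PowerSeries.constantCoeff).comp
              ((Φ : FormalFn m →+* FormalFn m).comp PowerSeries.C))
          constructor
          · refine (injective_iff_map_eq_zero _).2 fun f hf => ?_
            have hf' : PowerSeries.constantCoeff (Φ (PowerSeries.C f)) = 0 := hf
            obtain ⟨H, hH⟩ := PowerSeries.X_dvd_iff.2 hf'
            have h3 : PowerSeries.C f = PowerSeries.X * Φ.symm H := by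
              apply Φ.injective
              rw [algEquiv_X_mul, hH, AlgEquiv.apply_symm_apply]
            simpa using congrArg PowerSeries.constantCoeff h3
          · intro g
            refine ⟨PowerSeries.constantCoeff (Φ.symm (PowerSeries.C g)), ?_⟩
            change PowerSeries.constantCoeff (Φ (PowerSeries.C _)) = g
            have h4 := congrArg Φ
              (PowerSeries.eq_X_mul_shift_add_const (Φ.symm (PowerSeries.C g)))
            rw [map_add, algEquiv_X_mul, AlgEquiv.apply_symm_apply] at h4
            simpa using (congrArg PowerSeries.constantCoeff h4).symm }
    refine ⟨ψ, algEquiv_eq_of_const _ _ fun f => ?_⟩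
    rw [ψ.extend_apply]
    ext1 k
    rw [coeff_extendFun]
    cases k with
    | zero => simp; rfl
    | succ k =>
      rw [Finset.sum_range_succ']
      simp [PowerSeries.coeff_C]
      rfl

/-- The action of an automorphism on formal vector fields,
`(ψ_t · X_t) F = ψ_t (X_t (ψ_t⁻¹ F))`. -/
def actVF (Φ : FormalFn m ≃ₐ[ℝ⟦X⟧] FormalFn m) (X : FormalVF m) : FormalVF m :=
  Derivation.mk' (Φ.toLinearMap ∘ₗ (X : FormalFn m →ₗ[ℝ⟦X⟧] FormalFn m) ∘ₗ Φ.symm.toLinearMap)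
    (fun F G => by simp)

/-- The action on formal curves of connections,
`(ψ_t · ∇^t)_X Y = ψ_t · (∇^t_{ψ_t⁻¹ · X} ψ_t⁻¹ · Y)`. -/
def actConn (Φ : FormalFn m ≃ₐ[ℝ⟦X⟧] FormalFn m) (D : FormalVF m → FormalVF m → FormalVF m) :
    FormalVF m → FormalVF m → FormalVF m :=
  fun X Y => actVF Φ (D (actVF Φ.symm X) (actVF Φ.symm Y))

theorem actConn_refl (D : FormalVF m → FormalVF m → FormalVF m) :
    actConn AlgEquiv.refl D = D := rfl

theorem actConn_trans (Φ Φ' : FormalFn m ≃ₐ[ℝ⟦X⟧] FormalFn m)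
    (D : FormalVF m → FormalVF m → FormalVF m) :
    actConn Φ' (actConn Φ D) = actConn (Φ.trans Φ') D := rfl

theorem actConn_symm (Φ : FormalFn m ≃ₐ[ℝ⟦X⟧] FormalFn m)
    (D : FormalVF m → FormalVF m → FormalVF m) :
    actConn Φ.symm (actConn Φ D) = D := by
  rw [actConn_trans, AlgEquiv.self_trans_symm, actConn_refl]

/-- Two formal curves of connections are equivalent if they are related by a formal curve of
symplectomorphisms. -/
def equivConn (Ω : Matrix (Fin m) (Fin m) ℝ) :
    Setoid (FormalVF m → FormalVF m → FormalVF m) where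
  r D D' := ∃ ψ : FormalSymplectomorphism Ω, actConn ψ.extend D = D'
  iseqv :=
    { refl := fun D => by
        obtain ⟨ψ, hψ⟩ := (exists_extend_eq_iff Ω AlgEquiv.refl).2 fun F G => rfl
        exact ⟨ψ, by rw [hψ, actConn_refl]⟩
      symm := by
        rintro D D' ⟨ψ, rfl⟩
        have h := (exists_extend_eq_iff Ω ψ.extend).1 ⟨ψ, rfl⟩
        obtain ⟨φ, hφ⟩ := (exists_extend_eq_iff Ω ψ.extend.symm).2 fun F G => by
          apply ψ.extend.injective
          rw [h]
          simp only [AlgEquiv.apply_symm_apply]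
        exact ⟨φ, by rw [hφ, actConn_symm]⟩
      trans := by
        rintro D D' D'' ⟨ψ, rfl⟩ ⟨φ, rfl⟩
        have h := (exists_extend_eq_iff Ω ψ.extend).1 ⟨ψ, rfl⟩
        have h' := (exists_extend_eq_iff Ω φ.extend).1 ⟨φ, rfl⟩
        obtain ⟨χ, hχ⟩ := (exists_extend_eq_iff Ω (ψ.extend.trans φ.extend)).2 fun F G => by
          simp only [AlgEquiv.trans_apply, h, h']
        exact ⟨χ, by rw [hχ, actConn_trans]⟩ }

/-- Formal curves of Ricci-type symplectic connections on `(T^{2n}, ω)` starting with the standard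
flat connection, up to formal curves of symplectomorphisms. -/
instance ricciSetoid {n : ℕ} (Ω : Matrix (Fin (2 * n)) (Fin (2 * n)) ℝ) :
    Setoid (ricciCurves Ω) :=
  (equivConn Ω).comap Subtype.val

/-- The moduli space. -/
abbrev ModuliSpace {n : ℕ} (Ω : Matrix (Fin (2 * n)) (Fin (2 * n)) ℝ) : Type :=
  Quotient (ricciSetoid Ω)

/-! ### Formal curves of linear maps `ℝ^m → sp(m, ℝ)` -/

/-- Formal curves `A^t = ∑_{k ≥ 1} t^k A^{(k)}` of linear maps `ℝ^m → sp(ℝ^m, Ω)` with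
`A^t(X) A^t(Y) = 0` and `A^t(X) Y = A^t(Y) X`. -/
@[ext]
structure LinearCurve (Ω : Matrix (Fin m) (Fin m) ℝ) where
  toLin : (Fin m → ℝ) →ₗ[ℝ] (Matrix (Fin m) (Fin m) ℝ)⟦X⟧
  constantCoeff_eq_zero : ∀ X, PowerSeries.constantCoeff (toLin X) = 0
  mem_sp : ∀ X k, PowerSeries.coeff k (toLin X) ∈ skewAdjointMatricesLieSubalgebra Ω
  mul_eq_zero : ∀ X Y, toLin X * toLin Y = 0
  symmetric : ∀ X Y k, (PowerSeries.coeff k (toLin X)).mulVec Y =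
    (PowerSeries.coeff k (toLin Y)).mulVec X

/-- The real matrix of an integral one. -/
def toReal : GL (Fin m) ℤ →* GL (Fin m) ℝ :=
  Matrix.GeneralLinearGroup.map (Int.castRingHom ℝ)

/-- `Sp(m, ℤ)`: the automorphisms of the lattice `ℤ^m` preserving `Ω`. -/
def spInt (Ω : Matrix (Fin m) (Fin m) ℝ) : Subgroup (GL (Fin m) ℤ) where
  carrier := {C | (toReal C).1.transpose * Ω * (toReal C).1 = Ω}
  one_mem' := by simp
  mul_mem' := by
    intro C C' (hC : _ = _) (hC' : _ = _)
    change (toReal (C * C')).1.transpose * Ω * (toReal (C * C')).1 = Ω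
    rw [map_mul, Units.val_mul, Matrix.transpose_mul]
    conv_rhs => rw [← hC', ← hC]
    simp only [Matrix.mul_assoc]
  inv_mem' := by
    intro C (hC : _ = _)
    change (toReal C⁻¹).1.transpose * Ω * (toReal C⁻¹).1 = Ω
    have h1 : (toReal C).1 * (toReal C⁻¹).1 = 1 := by
      rw [← Units.val_mul, ← map_mul, mul_inv_cancel, map_one, Units.val_one]
    have h2 : (toReal C⁻¹).1.transpose * (toReal C).1.transpose = 1 := by
      rw [← Matrix.transpose_mul, h1, Matrix.transpose_one]
    calc (toReal C⁻¹).1.transpose * Ω * (toReal C⁻¹).1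
        = (toReal C⁻¹).1.transpose * ((toReal C).1.transpose * Ω * (toReal C).1) *
          (toReal C⁻¹).1 := by rw [hC]
      _ = ((toReal C⁻¹).1.transpose * (toReal C).1.transpose) * Ω *
          ((toReal C).1 * (toReal C⁻¹).1) := by simp only [Matrix.mul_assoc]
      _ = Ω := by rw [h1, h2, one_mul, mul_one]

theorem toReal_mul_inv (C : GL (Fin m) ℤ) : (toReal C).1 * (toReal C⁻¹).1 = 1 := by
  rw [← Units.val_mul, ← map_mul, mul_inv_cancel, map_one, Units.val_one]

theorem toReal_inv_mul (C : GL (Fin m) ℤ) : (toReal C⁻¹).1 * (toReal C).1 = 1 := by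
  rw [← Units.val_mul, ← map_mul, inv_mul_cancel, map_one, Units.val_one]

theorem transpose_mul_of_mem {Ω : Matrix (Fin m) (Fin m) ℝ} {C : GL (Fin m) ℤ}
    (h : C ∈ spInt Ω) : (toReal C).1.transpose * Ω = Ω * (toReal C⁻¹).1 := by
  have h' : (toReal C).1.transpose * Ω * (toReal C).1 = Ω := h
  conv_rhs => rw [← h', Matrix.mul_assoc, toReal_mul_inv, mul_one]

/-- The action `(C · A)(X) = C A(C⁻¹ X) C⁻¹` of `Sp(m, ℤ)`. -/
instance (Ω : Matrix (Fin m) (Fin m) ℝ) : MulAction (spInt Ω) (LinearCurve Ω) where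
  smul C A :=
    { toLin :=
        { toFun := fun X => PowerSeries.C (toReal C.1).1 *
            A.toLin ((toReal C.1⁻¹).1.mulVec X) * PowerSeries.C (toReal C.1⁻¹).1
          map_add' := fun X Y => by rw [Matrix.mulVec_add, map_add, mul_add, add_mul]
          map_smul' := fun c X => by
            rw [Matrix.mulVec_smul, map_smul, mul_smul_comm, smul_mul_assoc, RingHom.id_apply] }
      constantCoeff_eq_zero := fun X => by
        simp [A.constantCoeff_eq_zero]
      mem_sp := fun X k => by
        have hA := A.mem_sp ((toReal C.1⁻¹).1.mulVec X) k
        simp only [LinearMap.coe_mk, AddHom.coe_mk, PowerSeries.coeff_mul_C,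
          PowerSeries.coeff_C_mul]
        rw [mem_skewAdjointMatricesLieSubalgebra, mem_skewAdjointMatricesSubmodule,
          Matrix.IsSkewAdjoint, Matrix.IsAdjointPair] at hA ⊢
        have h1 := transpose_mul_of_mem C.2
        have h2 := transpose_mul_of_mem (C⁻¹).2
        rw [Subgroup.coe_inv, inv_inv] at h2
        rw [Matrix.transpose_mul, Matrix.transpose_mul, Matrix.mul_assoc, Matrix.mul_assoc, h1,
          ← Matrix.mul_assoc _ Ω, hA, ← Matrix.mul_assoc, ← Matrix.mul_assoc, h2]
        simp only [Matrix.mul_assoc, neg_mul, mul_neg]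
      mul_eq_zero := fun X Y => by
        simp only [LinearMap.coe_mk, AddHom.coe_mk]
        have h : (PowerSeries.C (toReal C.1⁻¹).1 * PowerSeries.C (toReal C.1).1 :
            (Matrix (Fin m) (Fin m) ℝ)⟦X⟧) = 1 := by
          rw [← map_mul, toReal_inv_mul, map_one]
        have h' : ∀ a b U V : (Matrix (Fin m) (Fin m) ℝ)⟦X⟧,
            (a * U * b) * (a * V * b) = a * (U * (b * a) * V) * b := fun a b U V => by
          simp only [mul_assoc]
        rw [h', h, mul_one, A.mul_eq_zero, mul_zero, zero_mul]
      symmetric := fun X Y k => by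
        simp only [LinearMap.coe_mk, AddHom.coe_mk, PowerSeries.coeff_mul_C,
          PowerSeries.coeff_C_mul, ← Matrix.mulVec_mulVec]
        rw [A.symmetric] }
  one_smul A := by
    apply LinearCurve.ext
    refine LinearMap.ext fun X => ?_
    change PowerSeries.C (toReal 1).1 * A.toLin ((toReal 1⁻¹).1.mulVec X) *
      PowerSeries.C (toReal 1⁻¹).1 = A.toLin X
    simp
  mul_smul C C' A := by
    apply LinearCurve.ext
    refine LinearMap.ext fun X => ?_
    change PowerSeries.C (toReal (C.1 * C'.1)).1 *
        A.toLin ((toReal (C.1 * C'.1)⁻¹).1.mulVec X) * PowerSeries.C (toReal (C.1 * C'.1)⁻¹).1 =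
      PowerSeries.C (toReal C.1).1 * (PowerSeries.C (toReal C'.1).1 *
        A.toLin ((toReal C'.1⁻¹).1.mulVec ((toReal C.1⁻¹).1.mulVec X)) *
        PowerSeries.C (toReal C'.1⁻¹).1) * PowerSeries.C (toReal C.1⁻¹).1
    simp only [mul_inv_rev, map_mul, Units.val_mul, Matrix.mulVec_mulVec, mul_assoc]

/-- The formal curve of connections `∇^0 + A^t`: on invariant vector fields,
`∇^t_{∂_a} ∂_b = A^t(∂_a) ∂_b`. -/
def LinearCurve.connection {Ω : Matrix (Fin m) (Fin m) ℝ} (A : LinearCurve Ω)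
    (X Y : FormalVF m) : FormalVF m :=
  standardFlat X Y + ∑ a, ∑ b, (dx a X * dx b Y) • ∑ c,
    (PowerSeries.mk fun k =>
      (PowerSeries.coeff k (A.toLin (Pi.single a 1))).mulVec (Pi.single b 1) c : ℝ⟦X⟧) • frame c

end RicciTorus

end

open scoped PowerSeries ContDiff

noncomputable section

namespace RicciTorus

variable {m : ℕ}

/-! ### Smooth functions on the torus -/

/-! Formal vector fields form a free module on the invariant frame (`eq_sum_dx_frame`), so a
connection is the same as its Christoffel symbols, which are formal functions; lowered with ω they
are totally symmetric for a symplectic connection. The proof makes these symbols constant, solves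
the algebra that remains, and determines which symplectomorphisms relate two constant solutions.

Constant symbols. Suppose the symbols are constant below degree k and let B be their lowered
coefficient of degree k. The quadratic part of the curvature is then constant in degree k, so the
Ricci-type equation says that the differential of B is, up to a constant, the tensor E(r) of some r.
Differentiating once more gives a Bianchi identity for E(∂r). Contractions with the inverse of Ω
yield ∂_e r_cd = Ω_ec u_d + Ω_ed u_c, then ∂_f u_d = Ω_fd φ, then ∂φ = 0. A derivative of a periodic
function has mean zero, so u, r and finally the differential of B are forced to be constant, and
that last constant is zero. Hence B is a constant plus a third derivative of a function
(`exists_potential_of_ricci`). The exponential of t^k times a Hamiltonian field changes B by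
precisely such a third derivative (`IsRicciLike.exists_constBelow_succ`). The corrections tend to
the identity t-adically and can be composed infinitely often (`IsRicciLike.exists_const`).

Algebra. Constant symbols define a commutative product on the free module of rank 2n over ℝ⟦t⟧, with
multiplications in sp and commutators of Ricci type. A trace computation, valid in every rank except
2, forces all double products to vanish (`RicciProduct.mul_mul_eq_zero`). Conversely, if they vanish
the connection is flat and its Ricci-type equation reads 0 = 0 (`constConnection_mem_ricciCurves`).

Rigidity. If an automorphism carries one constant connection to another, the transformation law and
periodicity show by induction on the degree that its Jacobian is constant
(`frame_jacobian_eq_zero`). The images of cos 2πx and sin 2πx then satisfy a rotation equation whose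
periodic solutions have integral frequency (`exists_int_coJacobian`), so the Jacobian is an integral
matrix. It is symplectic because brackets are preserved, and it alone determines the image of a
constant connection (`LinearCurve.exists_smul_eq`). -/

theorem fderiv_apply_eq_sum (f : Fn m) (x v : Fin m → ℝ) :
    fderiv ℝ f.1 x v = ∑ a, v a * (partialFn a f).1 x := by
  conv_lhs => rw [pi_eq_sum_univ' v]
  rw [map_sum]
  refine Finset.sum_congr rfl fun a _ => ?_
  rw [map_smul, smul_eq_mul]
  rfl

theorem partialFn_comm (a b : Fin m) (f : Fn m) :
    partialFn a (partialFn b f) = partialFn b (partialFn a f) := by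
  refine Subtype.ext <| funext fun x => ?_
  have hf' : ContDiff ℝ ∞ (fderiv ℝ f.1) := f.2.1.fderiv_right (by simp)
  have hd : DifferentiableAt ℝ (fderiv ℝ f.1) x := (hf'.differentiable (by simp)) x
  have key : ∀ u v : Fin m → ℝ,
      fderiv ℝ (fun y => fderiv ℝ f.1 y u) x v = fderiv ℝ (fderiv ℝ f.1) x v u := fun u v => by
    rw [fderiv_clm_apply hd (differentiableAt_const u)]
    simp
  have hs := (f.2.1.contDiffAt (x := x)).isSymmSndFDerivAt (by simp; exact WithTop.coe_le_coe.2 le_top)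
  change fderiv ℝ (fun y => fderiv ℝ f.1 y (Pi.single b 1)) x (Pi.single a 1) =
    fderiv ℝ (fun y => fderiv ℝ f.1 y (Pi.single a 1)) x (Pi.single b 1)
  rw [key, key, hs]

theorem partialFn_algebraMap (a : Fin m) (c : ℝ) :
    partialFn a (algebraMap ℝ (Fn m) c) = 0 := Derivation.map_algebraMap _ _

theorem exists_eq_algebraMap {f : Fn m} (h : ∀ a, partialFn a f = 0) :
    ∃ c : ℝ, f = algebraMap ℝ (Fn m) c := by
  refine ⟨f.1 0, Subtype.ext <| funext fun x => ?_⟩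
  refine is_const_of_fderiv_eq_zero (f.2.1.differentiable (by simp)) (fun y => ?_) x 0
  ext v
  simp only [fderiv_apply_eq_sum, h]
  simp

theorem partialFn_cosFn (a b : Fin m) :
    partialFn a (cosFn b) = -(if a = b then 2 * Real.pi else 0 : ℝ) • sinFn b := by
  refine Subtype.ext <| funext fun x => ?_
  have h : HasFDerivAt (fun x : Fin m → ℝ => 2 * Real.pi * x b)
      ((2 * Real.pi) • ContinuousLinearMap.proj (R := ℝ) (φ := fun _ : Fin m => ℝ) b) x :=
    (ContinuousLinearMap.proj (R := ℝ) (φ := fun _ : Fin m => ℝ) b).hasFDerivAt.const_mul _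
  change fderiv ℝ (fun x : Fin m → ℝ => Real.cos (2 * Real.pi * x b)) x (Pi.single a 1) =
    -(if a = b then 2 * Real.pi else 0 : ℝ) • Real.sin (2 * Real.pi * x b)
  rw [h.cos.fderiv]
  by_cases hab : a = b
  · subst hab; simp; ring
  · simp [hab]

theorem partialFn_sinFn (a b : Fin m) :
    partialFn a (sinFn b) = (if a = b then 2 * Real.pi else 0 : ℝ) • cosFn b := by
  refine Subtype.ext <| funext fun x => ?_
  have h : HasFDerivAt (fun x : Fin m → ℝ => 2 * Real.pi * x b)
      ((2 * Real.pi) • ContinuousLinearMap.proj (R := ℝ) (φ := fun _ : Fin m => ℝ) b) x :=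
    (ContinuousLinearMap.proj (R := ℝ) (φ := fun _ : Fin m => ℝ) b).hasFDerivAt.const_mul _
  change fderiv ℝ (fun x : Fin m → ℝ => Real.sin (2 * Real.pi * x b)) x (Pi.single a 1) =
    (if a = b then 2 * Real.pi else 0 : ℝ) • Real.cos (2 * Real.pi * x b)
  rw [h.sin.fderiv]
  by_cases hab : a = b
  · subst hab; simp; ring
  · simp [hab]

theorem cosFn_sq_add_sinFn_sq (a : Fin m) :
    cosFn a * cosFn a + sinFn a * sinFn a = 1 := by
  refine Subtype.ext <| funext fun x => ?_
  change Real.cos (2 * Real.pi * x a) * Real.cos (2 * Real.pi * x a) +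
    Real.sin (2 * Real.pi * x a) * Real.sin (2 * Real.pi * x a) = 1
  nlinarith [Real.sin_sq_add_cos_sq (2 * Real.pi * x a)]

/-! ### The mean value of a function -/

theorem integrableOn_cube (f : Fn m) :
    MeasureTheory.IntegrableOn f.1 (Set.Icc (0 : Fin m → ℝ) 1) :=
  f.2.1.continuous.continuousOn.integrableOn_compact isCompact_Icc

/-- The mean value of a function on the torus. -/
def mean : Fn m →ₗ[ℝ] ℝ where
  toFun f := ∫ x in Set.Icc (0 : Fin m → ℝ) 1, f.1 x
  map_add' f g := MeasureTheory.integral_add (integrableOn_cube f) (integrableOn_cube g)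
  map_smul' c _ := MeasureTheory.integral_const_mul c _

theorem mean_algebraMap (c : ℝ) : mean (algebraMap ℝ (Fn m) c) = c := by
  change ∫ x in Set.Icc (0 : Fin m → ℝ) 1, c = c
  rw [MeasureTheory.setIntegral_const, MeasureTheory.measureReal_def, Real.volume_Icc_pi]
  simp

/-- Divergence theorem on the unit cube for the field f ∂_a: only the two faces orthogonal to the
direction a contribute, and they cancel by periodicity. -/
theorem mean_partialFn (a : Fin m) (f : Fn m) : mean (partialFn a f) = 0 := by
  obtain _ | m := m
  · exact a.elim0
  have hd : Differentiable ℝ f.1 := f.2.1.differentiable (by simp)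
  have h := MeasureTheory.integral_divergence_of_hasFDerivAt_off_countable' (0 : Fin (m + 1) → ℝ)
    1 zero_le_one (fun i => if i = a then f.1 else 0)
    (fun i x => if i = a then fderiv ℝ f.1 x else 0) ∅ Set.countable_empty
    (fun i => by
      split_ifs
      · exact f.2.1.continuous.continuousOn
      · exact continuousOn_const)
    (fun x _ i => by
      split_ifs
      · exact (hd x).hasFDerivAt
      · exact hasFDerivAt_const _ _)
    (by
      have := integrableOn_cube (partialFn a f)
      refine this.congr_fun (fun x _ => ?_) measurableSet_Icc
      change fderiv ℝ f.1 x (Pi.single a 1) = _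
      rw [Finset.sum_eq_single a]
      · simp
      · intro b _ hb; simp [hb]
      · simp)
  have h1 : ∀ x, ∑ i, (if i = a then fderiv ℝ f.1 x else 0 : (Fin (m + 1) → ℝ) →L[ℝ] ℝ)
      (Pi.single i 1) = (partialFn a f).1 x := fun x => by
    rw [Finset.sum_eq_single a]
    · simp; rfl
    · intro b _ hb; simp [hb]
    · simp
  simp only [h1] at h
  change ∫ x in Set.Icc (0 : Fin (m + 1) → ℝ) 1, (partialFn a f).1 x = 0
  rw [h]
  refine Finset.sum_eq_zero fun i _ => ?_
  rw [sub_eq_zero]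
  refine MeasureTheory.setIntegral_congr_fun measurableSet_Icc fun x _ => ?_
  by_cases hi : i = a
  · subst hi
    simp only [if_true]
    have := f.2.2 (Pi.single i 1) (i.insertNth 0 x)
    rw [show ((0 : Fin (m + 1) → ℝ) i) = 0 from rfl, ← this]
    refine congrArg f.1 (funext fun j => ?_)
    refine Fin.succAboveCases i ?_ (fun j => ?_) j
    · simp
    · simp [Fin.succAbove_ne]
  · simp [hi]

theorem eq_zero_of_partialFn_eq_algebraMap {f : Fn m} {a : Fin m} {c : ℝ}
    (h : partialFn a f = algebraMap ℝ (Fn m) c) : c = 0 := by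
  rw [← mean_algebraMap (m := m) c, ← h, mean_partialFn]

theorem eq_algebraMap_mean {f : Fn m} (h : ∀ a, partialFn a f = 0) :
    f = algebraMap ℝ (Fn m) (mean f) := by
  obtain ⟨c, rfl⟩ := exists_eq_algebraMap h
  rw [mean_algebraMap]

theorem eq_zero_of_partialFn_eq_zero {f : Fn m} (h : ∀ a, partialFn a f = 0) (h0 : mean f = 0) :
    f = 0 := by
  rw [eq_algebraMap_mean h, h0, map_zero]

/-- A derivative with zero gradient is a constant of mean zero. This is the main way in which
compactness of the torus is used: a periodic function cannot grow linearly. -/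
theorem partialFn_eq_zero_of_partialFn_partialFn {f : Fn m} {b : Fin m}
    (h : ∀ a, partialFn a (partialFn b f) = 0) : partialFn b f = 0 :=
  eq_zero_of_partialFn_eq_zero h (mean_partialFn b f)

/-- A periodic closed `1`-form is the sum of a constant one and of an exact one. -/
theorem exists_primitive (f : Fin m → Fn m)
    (h : ∀ a b, partialFn a (f b) = partialFn b (f a)) :
    ∃ g : Fn m, mean g = 0 ∧ ∀ a, f a = algebraMap ℝ (Fn m) (mean (f a)) + partialFn a g := by
  let P : Fin m → ((Fin m → ℝ) →L[ℝ] ℝ) := fun a =>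
    ContinuousLinearMap.proj (R := ℝ) (φ := fun _ : Fin m => ℝ) a
  let θ : (Fin m → ℝ) → ((Fin m → ℝ) →L[ℝ] ℝ) := fun x => ∑ a, (f a).1 x • P a
  have htha : ∀ x v, θ x v = ∑ a, (f a).1 x * v a := fun x v => by
    simp [θ, P]
  have hth : ContDiff ℝ ∞ θ :=
    ContDiff.sum fun a _ => (f a).2.1.smul contDiff_const
  have hfd : ∀ x u v, fderiv ℝ θ x u v = ∑ a, ∑ b, u b * (partialFn b (f a)).1 x * v a := by
    intro x u v
    have : HasFDerivAt θ (∑ a, (fderiv ℝ (f a).1 x).smulRight (P a)) x :=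
      HasFDerivAt.fun_sum fun a _ =>
        ((((f a).2.1.differentiable (by simp)) x).hasFDerivAt).smul_const (P a)
    rw [this.fderiv]
    simp only [sum_apply, ContinuousLinearMap.smulRight_apply,
      fderiv_apply_eq_sum, smul_apply, smul_eq_mul, Finset.sum_mul]
    rfl
  -- Poincaré lemma on ℝ^m. The primitive `H` need not be periodic, but the difference of its values
  -- at x + k and x is independent of x and additive in k.
  obtain ⟨H, hH⟩ := convex_univ.exists_forall_hasFDerivAt_of_fderiv_symmetric isOpen_univ
    (show DifferentiableOn ℝ θ _ from (hth.differentiable (by simp)).differentiableOn) (fun x _ u v => by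
      rw [hfd, hfd, Finset.sum_comm]
      refine Finset.sum_congr rfl fun a _ => Finset.sum_congr rfl fun b _ => ?_
      rw [h a b]; ring)
  have hH' : ∀ x, HasFDerivAt H (θ x) x := fun x => hH x trivial
  have hHs : ContDiff ℝ ∞ H := by
    rw [contDiff_infty_iff_fderiv]
    refine ⟨fun x => (hH' x).differentiableAt, ?_⟩
    rwa [show fderiv ℝ H = θ from funext fun x => (hH' x).fderiv]
  -- periods
  have hper : ∀ (k : Fin m → ℤ) x, H (fun i => x i + k i) - H x = H (fun i => k i) - H 0 := by
    intro k x
    have hd : ∀ y, HasFDerivAt (fun y : Fin m → ℝ => H (y + fun i => (k i : ℝ)) - H y)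
        (θ (y + fun i => (k i : ℝ)) - θ y) y := fun y =>
      ((hasFDerivAt_comp_add_right _).2 (hH' _)).sub (hH' y)
    have h0 : ∀ y, θ (y + fun i => (k i : ℝ)) - θ y = 0 := fun y => by
      rw [sub_eq_zero]
      refine Finset.sum_congr rfl fun a _ => ?_
      congr 1
      exact (f a).2.2 k y
    have := is_const_of_fderiv_eq_zero (𝕜 := ℝ) (fun y => (hd y).differentiableAt)
      (fun y => by rw [(hd y).fderiv, h0]) x 0
    simp only [zero_add] at this
    exact this
  let c : Fin m → ℝ := fun a => H (Pi.single a 1) - H 0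
  have hadd : ∀ k l : Fin m → ℤ, H (fun i => ((k + l) i : ℤ)) - H 0 =
      (H (fun i => k i) - H 0) + (H (fun i => l i) - H 0) := fun k l => by
    have := hper l (fun i => k i)
    have e : (fun i => ((k + l) i : ℝ)) = fun i => (k i : ℝ) + l i := by ext i; simp
    simp only [Pi.add_apply, Int.cast_add] at *
    linarith
  let φ : (Fin m → ℤ) →+ ℝ :=
    { toFun := fun k => H (fun i => k i) - H 0
      map_zero' := by simp [← Pi.zero_def]
      map_add' := hadd }
  have hφ : ∀ k, φ k = ∑ a, c a * k a := fun k => by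
    conv_lhs => rw [pi_eq_sum_univ' k]
    rw [map_sum]
    refine Finset.sum_congr rfl fun a _ => ?_
    have hφa : φ (Pi.single a 1) = c a := by
      change H _ - H 0 = H _ - H 0
      congr 2
      ext i
      by_cases hi : i = a
      · subst hi; simp
      · simp [hi]
    rw [map_zsmul, zsmul_eq_mul, mul_comm, ← hφa]
  -- Subtracting the linear function with the same periods makes the primitive periodic.
  let G : (Fin m → ℝ) → ℝ := fun x => H x - ∑ a, c a * x a
  have hGs : ContDiff ℝ ∞ G :=
    hHs.sub (ContDiff.sum fun a _ => contDiff_const.mul (contDiff_apply ℝ ℝ a))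
  let g : Fn m := ⟨G, hGs, fun k x => by
    have h1 := hper k x
    have h2 := hφ k
    change H (fun i => (k i : ℝ)) - H 0 = _ at h2
    simp only [G, mul_add, Finset.sum_add_distrib]
    linarith⟩
  have hg : ∀ a, f a = algebraMap ℝ (Fn m) (c a) + partialFn a g := fun a => by
    refine Subtype.ext <| funext fun x => ?_
    have hd : HasFDerivAt G (θ x - ∑ b, c b • P b) x :=
      (hH' x).sub (HasFDerivAt.fun_sum fun b _ => (P b).hasFDerivAt.const_mul (c b))
    change (f a).1 x = c a + fderiv ℝ G x (Pi.single a 1)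
    rw [hd.fderiv, sub_apply, htha, sum_apply]
    simp [P, Pi.single_apply]
  have hc : ∀ a, mean (f a) = c a := fun a => by
    rw [hg a, map_add, mean_algebraMap, mean_partialFn, add_zero]
  -- Normalising the mean makes the primitive unique, so that symmetries of the form pass to it.
  refine ⟨g - algebraMap ℝ (Fn m) (mean g), ?_, fun a => ?_⟩
  · rw [map_sub, mean_algebraMap, sub_self]
  · rw [map_sub, partialFn_algebraMap, sub_zero, hc, hg a]

/-! ### Point derivations of the algebra of smooth functions -/

/-- Differentiation under the integral sign; the derivative of the integrand is bounded on the
compact product of [0,1] with a closed ball. -/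
theorem hasFDerivAt_integral_param {E F : Type} [NormedAddCommGroup E] [NormedSpace ℝ E]
    [FiniteDimensional ℝ E] [NormedAddCommGroup F] [NormedSpace ℝ F] [CompleteSpace F]
    {g : ℝ × E → F} (hg : ContDiff ℝ ∞ g) (x : E) :
    HasFDerivAt (fun x => ∫ s in (0 : ℝ)..1, g (s, x))
      (∫ s in (0 : ℝ)..1, (fderiv ℝ g (s, x)).comp (ContinuousLinearMap.inr ℝ ℝ E)) x := by
  have : ProperSpace E := FiniteDimensional.proper ℝ E
  have hg' : Continuous fun p : ℝ × E =>
      (fderiv ℝ g p).comp (ContinuousLinearMap.inr ℝ ℝ E) :=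
    (hg.continuous_fderiv (by simp)).clm_comp continuous_const
  obtain ⟨C, hC⟩ := ((isCompact_Icc (a := (0 : ℝ)) (b := 1)).prod
    (isCompact_closedBall x 1)).exists_bound_of_continuousOn hg'.continuousOn
  refine intervalIntegral.hasFDerivAt_integral_of_dominated_of_fderiv_le
    (F := fun y s => g (s, y))
    (F' := fun y s => (fderiv ℝ g (s, y)).comp (ContinuousLinearMap.inr ℝ ℝ E))
    (bound := fun _ => C) (Metric.ball_mem_nhds x one_pos)
    (Filter.Eventually.of_forall fun y => ?_) ?_ ?_ ?_ ?_ ?_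
  · exact (hg.continuous.comp (by fun_prop : Continuous fun s : ℝ => (s, y))).aestronglyMeasurable
  · exact (hg.continuous.comp (by fun_prop : Continuous fun s : ℝ => (s, x))).intervalIntegrable _ _
  · exact (hg'.comp (by fun_prop : Continuous fun s : ℝ => (s, x))).aestronglyMeasurable
  · refine Filter.Eventually.of_forall fun s hs y hy => hC (s, y) ⟨?_, ?_⟩
    · rw [Set.uIoc_of_le zero_le_one] at hs
      exact ⟨hs.1.le, hs.2⟩
    · exact Metric.ball_subset_closedBall hy
  · exact intervalIntegrable_const
  · refine Filter.Eventually.of_forall fun s _ y _ => ?_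
    have h1 : HasFDerivAt g (fderiv ℝ g (s, y)) (s, y) :=
      ((hg.differentiable (by simp)) _).hasFDerivAt
    exact h1.comp y (hasFDerivAt_prodMk_right s y)

/-- Induction on the order. The target `F` stays universally quantified because the derivative takes
values in another space, that of linear maps from `E` to `F`. -/
theorem contDiff_integral_param {E : Type} [NormedAddCommGroup E] [NormedSpace ℝ E]
    [FiniteDimensional ℝ E] (n : ℕ) : ∀ {F : Type} [NormedAddCommGroup F] [NormedSpace ℝ F]
    [CompleteSpace F] {g : ℝ × E → F} (_ : ContDiff ℝ ∞ g),
    ContDiff ℝ n fun x => ∫ s in (0 : ℝ)..1, g (s, x) := by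
  induction n with
  | zero =>
    intro F _ _ _ g hg
    exact contDiff_zero.2 (continuous_iff_continuousAt.2 fun x =>
      (hasFDerivAt_integral_param hg x).continuousAt)
  | succ n ih =>
    intro F _ _ _ g hg
    rw [Nat.cast_succ, contDiff_succ_iff_fderiv]
    refine ⟨fun x => (hasFDerivAt_integral_param hg x).differentiableAt, by simp, ?_⟩
    rw [show fderiv ℝ (fun x => ∫ s in (0 : ℝ)..1, g (s, x)) = _ from
      funext fun x => (hasFDerivAt_integral_param hg x).fderiv]
    exact ih (g := fun p => (fderiv ℝ g p).comp (ContinuousLinearMap.inr ℝ ℝ E))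
      ((hg.fderiv_right (by simp)).clm_comp contDiff_const)

/-- Hadamard's lemma. -/
theorem exists_hadamard {f : (Fin m → ℝ) → ℝ} (hf : ContDiff ℝ ∞ f) (p : Fin m → ℝ) :
    ∃ h : Fin m → (Fin m → ℝ) → ℝ, (∀ a, ContDiff ℝ ∞ (h a)) ∧
      (∀ a, h a p = fderiv ℝ f p (Pi.single a 1)) ∧
      ∀ x, f x = f p + ∑ a, (x a - p a) * h a x := by
  have hf' : ContDiff ℝ ∞ (fderiv ℝ f) := hf.fderiv_right (by simp)
  -- The quotients are the averages of the partial derivatives of `f` along the segment from p to x.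
  let g : Fin m → ℝ × (Fin m → ℝ) → ℝ := fun a q =>
    fderiv ℝ f (p + q.1 • (q.2 - p)) (Pi.single a 1)
  have hg : ∀ a, ContDiff ℝ ∞ (g a) := fun a =>
    (hf'.comp (by fun_prop : ContDiff ℝ ∞
      fun q : ℝ × (Fin m → ℝ) => p + q.1 • (q.2 - p))).clm_apply contDiff_const
  refine ⟨fun a x => ∫ s in (0 : ℝ)..1, g a (s, x), fun a => ?_, fun a => ?_, fun x => ?_⟩
  · exact contDiff_infty.2 fun n => contDiff_integral_param n (hg a)
  · simp [g]
  · have hd : ∀ s : ℝ, HasDerivAt (fun s : ℝ => f (p + s • (x - p)))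
        (fderiv ℝ f (p + s • (x - p)) (x - p)) s := fun s => by
      have h1 : HasDerivAt (fun s : ℝ => p + s • (x - p)) ((1 : ℝ) • (x - p)) s :=
        ((hasDerivAt_id s).smul_const (x - p)).const_add p
      rw [one_smul] at h1
      exact ((hf.differentiable (by simp)) _).hasFDerivAt.comp_hasDerivAt s h1
    have hc : Continuous fun s : ℝ => fderiv ℝ f (p + s • (x - p)) (x - p) :=
      (hf'.continuous.comp (by fun_prop)).clm_apply continuous_const
    have := intervalIntegral.integral_eq_sub_of_hasDerivAt (fun s _ => hd s)
      (hc.intervalIntegrable 0 1)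
    simp only [one_smul, zero_smul, add_zero, add_sub_cancel] at this
    rw [← sub_eq_iff_eq_add', ← this]
    simp_rw [← intervalIntegral.integral_const_mul]
    rw [← intervalIntegral.integral_finsetSum]
    · refine intervalIntegral.integral_congr fun s _ => ?_
      simp only [g]
      generalize fderiv ℝ f (p + s • (x - p)) = L
      rw [pi_eq_sum_univ' (x - p), map_sum]
      refine Finset.sum_congr rfl fun a _ => ?_
      rw [map_smul, smul_eq_mul, Pi.sub_apply]
    · intro a _
      exact (((hg a).continuous.comp
        (by fun_prop : Continuous fun s : ℝ => (s, x))).const_mul _).intervalIntegrable _ _ 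

/-- A periodic bump function around the point `p`. -/
def bump (p x : Fin m → ℝ) : ℝ :=
  ∏ a, expNegInvGlue (Real.cos (2 * Real.pi * (x a - p a)))

theorem bump_self_ne_zero (p : Fin m → ℝ) : bump p p ≠ 0 :=
  Finset.prod_ne_zero_iff.2 fun a _ => (expNegInvGlue.pos_of_pos (by simp)).ne'

theorem contDiff_bump (p : Fin m → ℝ) : ContDiff ℝ ∞ (bump p) :=
  contDiff_prod fun a _ => expNegInvGlue.contDiff.comp
    (Real.contDiff_cos.comp (by fun_prop))

theorem bump_add_int (p : Fin m → ℝ) (k : Fin m → ℤ) (x : Fin m → ℝ) :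
    bump p (fun i => x i + k i) = bump p x := by
  refine Finset.prod_congr rfl fun a _ => ?_
  rw [← Real.cos_add_int_mul_two_pi (2 * Real.pi * (x a - p a)) (k a)]
  ring_nf

/-- The point of `x + ℤ^m` nearest to `p`. -/
def nearest (p x : Fin m → ℝ) : Fin m → ℝ := fun a => x a - (round (x a - p a) : ℤ)

/-- Cutting off a function around `p` and extending it periodically. -/
def cutoff (p : Fin m → ℝ) (g : (Fin m → ℝ) → ℝ) (hg : ContDiff ℝ ∞ g) : Fn m :=
  ⟨fun x => bump p x * g (nearest p x), by
    refine contDiff_iff_contDiffAt.2 fun x => ?_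
    -- The rounding in `nearest` jumps only where some coordinate differs from that of p by a
    -- half-integer, that is where the cosine is -1. Near such a point the cosine is negative and
    -- the bump function vanishes identically.
    by_cases hx : ∀ a, Real.cos (2 * Real.pi * (x a - p a)) ≠ -1
    · -- the rounding is locally constant
      have hloc : ∀ a, ∀ᶠ y in nhds x, round (y a - p a) = round (x a - p a) := fun a => by
        have hne : x a - p a - round (x a - p a) ≠ 1 / 2 ∧
            x a - p a - round (x a - p a) ≠ -(1 / 2) := by
          constructor <;> intro h <;> apply hx a
          · rw [show x a - p a = 1 / 2 + round (x a - p a) by linarith,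
              show 2 * Real.pi * (1 / 2 + (round (x a - p a) : ℝ)) =
                Real.pi + (round (x a - p a) : ℤ) * (2 * Real.pi) by ring,
              Real.cos_add_int_mul_two_pi, Real.cos_pi]
          · rw [show x a - p a = -(1 / 2) + round (x a - p a) by linarith,
              show 2 * Real.pi * (-(1 / 2) + (round (x a - p a) : ℝ)) =
                -Real.pi + (round (x a - p a) : ℤ) * (2 * Real.pi) by ring,
              Real.cos_add_int_mul_two_pi, Real.cos_neg, Real.cos_pi]
        have habs := abs_le.1 (abs_sub_round (x a - p a))
        have h1 : x a - p a - round (x a - p a) < 1 / 2 := lt_of_le_of_ne habs.2 hne.1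
        have h2 : -(1 / 2) < x a - p a - round (x a - p a) := lt_of_le_of_ne habs.1 hne.2.symm
        have hc : ContinuousAt (fun y : Fin m → ℝ => y a - p a - round (x a - p a)) x :=
          (((continuous_apply a).sub continuous_const).sub continuous_const).continuousAt
        filter_upwards [hc.eventually (gt_mem_nhds h1), hc.eventually (lt_mem_nhds h2)]
          with y hy1 hy2
        rw [round_eq, Int.floor_eq_iff]
        constructor <;> linarith
      have hev : (fun y => bump p y * g (nearest p y)) =ᶠ[nhds x]
          fun y => bump p y * g (fun a => y a - (round (x a - p a) : ℤ)) := by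
        filter_upwards [Filter.eventually_all.2 hloc] with y hy
        unfold nearest
        simp only [hy]
      refine ContDiffAt.congr_of_eventuallyEq ?_ hev
      refine ((contDiff_bump p).mul (hg.comp ?_)).contDiffAt
      fun_prop
    · push Not at hx
      obtain ⟨a, ha⟩ := hx
      have hc : ContinuousAt (fun y : Fin m → ℝ => Real.cos (2 * Real.pi * (y a - p a))) x :=
        (Real.continuous_cos.comp (continuous_const.mul
          ((continuous_apply a).sub continuous_const))).continuousAt
      have hev : (fun y => bump p y * g (nearest p y)) =ᶠ[nhds x] fun _ => 0 := by
        filter_upwards [hc.eventually (gt_mem_nhds (show Real.cos (2 * Real.pi * (x a - p a)) < 0 by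
          rw [ha]; norm_num))] with y hy
        rw [bump, Finset.prod_eq_zero (Finset.mem_univ a)
          (expNegInvGlue.zero_of_nonpos hy.le), zero_mul]
      exact contDiffAt_const.congr_of_eventuallyEq hev,
  fun k x => by
    change bump p _ * g _ = bump p x * g _
    rw [bump_add_int]
    refine congrArg (fun y => bump p x * g y) (funext fun a => ?_)
    simp only [nearest]
    rw [show x a + (k a : ℝ) - p a = x a - p a + (k a : ℤ) by ring, round_add_intCast]
    push_cast
    ring⟩

theorem cutoff_apply_self (p : Fin m → ℝ) (g : (Fin m → ℝ) → ℝ) (hg : ContDiff ℝ ∞ g) :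
    (cutoff p g hg).1 p = bump p p * g p := by
  change bump p p * g (nearest p p) = _
  rw [show nearest p p = p from funext fun a => by simp [nearest]]

/-- A derivation of `C^∞(T^m)` at a point. -/
structure PointDerivation (p : Fin m → ℝ) where
  toLin : Fn m →ₗ[ℝ] ℝ
  leibniz : ∀ f g, toLin (f * g) = f.1 p * toLin g + g.1 p * toLin f

/-- Hadamard's lemma shows that a point derivation sees only the gradient. Its factors are not
periodic, so each is cut off; this costs one bump factor per term, and two in the product. -/
theorem PointDerivation.eq_sum_cutoff {p : Fin m → ℝ} (v : PointDerivation p) (f : Fn m) :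
    v.toLin f = ∑ a, (partialFn a f).1 p * ((bump p p)⁻¹ *
      v.toLin (cutoff p (fun x => x a - p a) (by fun_prop))) := by
  obtain ⟨h, hs, hp, hf⟩ := exists_hadamard f.2.1 p
  have h1 : v.toLin 1 = 0 := by
    have := v.leibniz 1 1
    simp only [mul_one, OneMemClass.coe_one, Pi.one_apply, one_mul] at this
    linarith
  have hc : v.toLin (algebraMap ℝ (Fn m) (f.1 p)) = 0 := by
    rw [Algebra.algebraMap_eq_smul_one, map_smul, h1, smul_zero]
  let η : Fn m := cutoff p (fun _ => 1) contDiff_const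
  have hη : η.1 p = bump p p := by rw [cutoff_apply_self, mul_one]
  have hnear : ∀ x, f.1 x = f.1 (nearest p x) := fun x => by
    have := f.2.2 (fun a => - round (x a - p a)) x
    rw [← this]
    refine congrArg f.1 (funext fun a => ?_)
    simp [nearest, sub_eq_add_neg]
  -- The Leibniz rule at p, applied to both sides, isolates `v.toLin f`: on the left f - f(p)
  -- vanishes at p, on the right the cut-off coordinates do.
  have key : (η * η) * (f - algebraMap ℝ (Fn m) (f.1 p)) =
      ∑ a, cutoff p (fun x => x a - p a) (by fun_prop) * cutoff p (h a) (hs a) := by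
    refine Subtype.ext <| funext fun x => ?_
    have e : (∑ a, cutoff p (fun x => x a - p a) (by fun_prop) * cutoff p (h a) (hs a) : Fn m).1 x
        = ∑ a, (bump p x * (nearest p x a - p a)) * (bump p x * h a (nearest p x)) := by
      rw [AddSubmonoidClass.coe_finsetSum, Finset.sum_apply]
      rfl
    rw [e]
    change (bump p x * 1 * (bump p x * 1)) * (f.1 x - f.1 p) = _
    rw [hnear x, hf (nearest p x), add_sub_cancel_left, Finset.mul_sum]
    exact Finset.sum_congr rfl fun a _ => by ring
  have := congrArg v.toLin key
  rw [v.leibniz, map_sub, hc, map_sum] at this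
  simp only [v.leibniz, cutoff_apply_self, hp] at this
  have hz : (f - algebraMap ℝ (Fn m) (f.1 p)).1 p = 0 := by
    change f.1 p - f.1 p = 0
    simp
  rw [hz] at this
  change η.1 p * η.1 p * _ + _ = _ at this
  rw [hη] at this
  have hb := bump_self_ne_zero p
  have e : v.toLin f = (bump p p)⁻¹ * (bump p p)⁻¹ * (bump p p * bump p p * v.toLin f) := by
    field_simp
  simp only [sub_zero, zero_mul, add_zero, sub_self, mul_zero, zero_add] at this
  rw [e, this, Finset.mul_sum]
  refine Finset.sum_congr rfl fun a _ => ?_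
  change _ = fderiv ℝ f.1 p (Pi.single a 1) * _
  field_simp

/-- The weights of `eq_sum_cutoff`, which depend on the cut-off, are recovered by testing on the
sine and cosine of each angle and using that their squares add up to 1. -/
theorem PointDerivation.apply_eq {p : Fin m → ℝ} (v : PointDerivation p) (f : Fn m) :
    v.toLin f = ∑ a, (partialFn a f).1 p * ((2 * Real.pi)⁻¹ *
      ((cosFn a).1 p * v.toLin (sinFn a) - (sinFn a).1 p * v.toLin (cosFn a))) := by
  rw [v.eq_sum_cutoff f]
  refine Finset.sum_congr rfl fun a _ => ?_
  congr 1
  rw [v.eq_sum_cutoff (sinFn a), v.eq_sum_cutoff (cosFn a), Finset.sum_eq_single a,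
    Finset.sum_eq_single a, partialFn_sinFn, partialFn_cosFn]
  · have h : (cosFn a).1 p * (cosFn a).1 p + (sinFn a).1 p * (sinFn a).1 p = 1 :=
      congrFun (congrArg Subtype.val (cosFn_sq_add_sinFn_sq a)) p
    generalize (bump p p)⁻¹ * v.toLin _ = w
    have e1 : ((if a = a then 2 * Real.pi else 0 : ℝ) • cosFn a).1 p =
        2 * Real.pi * (cosFn a).1 p := by rw [if_pos rfl]; rfl
    have e2 : (-(if a = a then 2 * Real.pi else 0 : ℝ) • sinFn a).1 p =
        -(2 * Real.pi * (sinFn a).1 p) := by rw [if_pos rfl, neg_smul]; rfl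
    rw [e1, e2]
    have hpi := Real.pi_pos.ne'
    field_simp
    linear_combination (-w) * h
  · intro b _ hb
    rw [partialFn_cosFn, if_neg hb]
    simp
  · simp
  · intro b _ hb
    rw [partialFn_sinFn, if_neg hb]
    simp
  · simp

/-! ### Formal vector fields in the invariant frame -/

@[simp] theorem coeff_frame (a : Fin m) (F : FormalFn m) (k : ℕ) :
    PowerSeries.coeff k (frame a F) = partialFn a (PowerSeries.coeff k F) :=
  PowerSeries.coeff_mk k fun k => partialFn a (PowerSeries.coeff k F)

@[simp] theorem formalVF_sum_apply {ι : Type*} (s : Finset ι) (X : ι → FormalVF m)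
    (F : FormalFn m) : (∑ i ∈ s, X i) F = ∑ i ∈ s, X i F := by
  induction s using Finset.cons_induction with
  | empty => simp
  | cons i s hi ih => rw [Finset.sum_cons, Finset.sum_cons, Derivation.add_apply, ih]

@[simp] theorem formalVF_sub_apply (X Y : FormalVF m) (F : FormalFn m) :
    (X - Y) F = X F - Y F := rfl

theorem formalVF_lie_apply (X Y : FormalVF m) (F : FormalFn m) :
    ⁅X, Y⁆ F = X (Y F) - Y (X F) := rfl

theorem real_smul_formalFn (c : ℝ) (F : FormalFn m) :
    c • F = PowerSeries.C (algebraMap ℝ (Fn m) c) * F := by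
  rw [Algebra.smul_def, PowerSeries.algebraMap_apply]

@[simp] theorem coeff_real_smul (c : ℝ) (F : FormalFn m) (k : ℕ) :
    PowerSeries.coeff k (c • F) = c • PowerSeries.coeff k F := by
  rw [real_smul_formalFn, PowerSeries.coeff_C_mul, ← Algebra.smul_def]

theorem C_real_smul (c : ℝ) (f : Fn m) :
    (PowerSeries.C (c • f) : FormalFn m) = c • PowerSeries.C f := by
  rw [real_smul_formalFn, ← map_mul, ← Algebra.smul_def]

@[simp] theorem frame_C (a : Fin m) (f : Fn m) :
    frame a (PowerSeries.C f) = PowerSeries.C (partialFn a f) := by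
  ext1 k
  rw [coeff_frame, PowerSeries.coeff_C, PowerSeries.coeff_C]
  split_ifs <;> simp

theorem frame_comm (a b : Fin m) (F : FormalFn m) :
    frame a (frame b F) = frame b (frame a F) := by
  ext1 k
  simp only [coeff_frame, partialFn_comm]

theorem lie_frame (a b : Fin m) : ⁅(frame a : FormalVF m), frame b⁆ = 0 := by
  ext1 F
  rw [formalVF_lie_apply, frame_comm, sub_self, Derivation.zero_apply]

theorem exists_eq_algebraMap_of_frame {F : FormalFn m} (h : ∀ a, frame a F = 0) :
    ∃ r : ℝ⟦X⟧, F = algebraMap ℝ⟦X⟧ (FormalFn m) r := by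
  have : ∀ k, ∃ c : ℝ, PowerSeries.coeff k F = algebraMap ℝ (Fn m) c := fun k =>
    exists_eq_algebraMap fun a => by rw [← coeff_frame, h, map_zero]
  choose c hc using this
  refine ⟨PowerSeries.mk c, ?_⟩
  ext1 k
  rw [hc, PowerSeries.algebraMap_apply'', PowerSeries.coeff_map, PowerSeries.coeff_mk]

theorem coeff_algebraMap (r : ℝ⟦X⟧) (k : ℕ) :
    PowerSeries.coeff k (algebraMap ℝ⟦X⟧ (FormalFn m) r) =
      algebraMap ℝ (Fn m) (PowerSeries.coeff k r) := by
  rw [PowerSeries.algebraMap_apply'', PowerSeries.coeff_map]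

theorem algebraMap_fn_injective : Function.Injective (algebraMap ℝ (Fn m)) := fun c d h => by
  rw [← mean_algebraMap (m := m) c, h, mean_algebraMap]

theorem algebraMap_formalFn_injective :
    Function.Injective (algebraMap ℝ⟦X⟧ (FormalFn m)) := fun r s h => by
  ext k
  apply algebraMap_fn_injective (m := m)
  rw [← coeff_algebraMap, h, coeff_algebraMap]

theorem C_algebraMap (c : ℝ) : (PowerSeries.C (algebraMap ℝ (Fn m) c) : FormalFn m) =
    algebraMap ℝ⟦X⟧ (FormalFn m) (PowerSeries.C c) := by
  rw [PowerSeries.algebraMap_apply'', PowerSeries.map_C]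

theorem formalVF_real_smul (X : FormalVF m) (c : ℝ) (F : FormalFn m) :
    X (c • F) = c • X F := by
  rw [real_smul_formalFn, C_algebraMap, Derivation.leibniz, Derivation.map_algebraMap,
    real_smul_formalFn, C_algebraMap]
  simp

theorem formalVF_X_mul (X : FormalVF m) (F : FormalFn m) :
    X (PowerSeries.X * F) = PowerSeries.X * X F := by
  have hX : (PowerSeries.X : FormalFn m) = algebraMap ℝ⟦X⟧ (FormalFn m) PowerSeries.X := by
    simp [PowerSeries.algebraMap_apply'']
  rw [Derivation.leibniz, hX, Derivation.map_algebraMap]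
  simp

/-- Linearity over ℝ⟦t⟧ lets a derivation commute with multiplication by t. Writing F as tG plus a
constant series moves the question from degree k + 1 to degree k, so no continuity need be assumed.
-/
theorem formalVF_ext_C {X Y : FormalVF m}
    (h : ∀ f : Fn m, X (PowerSeries.C f) = Y (PowerSeries.C f)) : X = Y := by
  have key : ∀ (k : ℕ) (F : FormalFn m),
      PowerSeries.coeff k (X F) = PowerSeries.coeff k (Y F) := by
    intro k
    induction k with
    | zero =>
      intro F
      rw [PowerSeries.eq_X_mul_shift_add_const F, map_add X, map_add Y, formalVF_X_mul,
        formalVF_X_mul, h]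
      simp
    | succ k ih =>
      intro F
      rw [PowerSeries.eq_X_mul_shift_add_const F, map_add X, map_add Y, formalVF_X_mul,
        formalVF_X_mul, h, map_add, map_add, PowerSeries.coeff_succ_X_mul,
        PowerSeries.coeff_succ_X_mul, ih]
  ext1 F
  ext1 k
  exact key k F

@[simp] theorem dx_add (a : Fin m) (X Y : FormalVF m) : dx a (X + Y) = dx a X + dx a Y := by
  simp only [dx, Derivation.add_apply, ← smul_add]
  congr 1
  ring

@[simp] theorem dx_smul (a : Fin m) (F : FormalFn m) (X : FormalVF m) :
    dx a (F • X) = F * dx a X := by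
  simp only [dx, Derivation.smul_apply, smul_eq_mul, mul_smul_comm]
  congr 1
  ring

/-- `dx^a` as a linear form on formal vector fields. -/
def dxLin (a : Fin m) : FormalVF m →ₗ[FormalFn m] FormalFn m where
  toFun := dx a
  map_add' := dx_add a
  map_smul' := dx_smul a

@[simp] theorem dx_zero (a : Fin m) : dx a (0 : FormalVF m) = 0 := (dxLin a).map_zero

@[simp] theorem dx_neg (a : Fin m) (X : FormalVF m) : dx a (-X) = -dx a X := (dxLin a).map_neg X

@[simp] theorem dx_sub (a : Fin m) (X Y : FormalVF m) : dx a (X - Y) = dx a X - dx a Y :=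
  (dxLin a).map_sub X Y

@[simp] theorem dx_sum {ι : Type*} (a : Fin m) (s : Finset ι) (X : ι → FormalVF m) :
    dx a (∑ i ∈ s, X i) = ∑ i ∈ s, dx a (X i) := map_sum (dxLin a) X s

theorem coeff_dx (a : Fin m) (X : FormalVF m) (k : ℕ) :
    PowerSeries.coeff k (dx a X) = (2 * Real.pi)⁻¹ •
      (cosFn a * PowerSeries.coeff k (X (PowerSeries.C (sinFn a))) -
        sinFn a * PowerSeries.coeff k (X (PowerSeries.C (cosFn a)))) := by
  simp only [dx, coeff_real_smul, map_sub, PowerSeries.coeff_C_mul]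

@[simp] theorem dx_frame (a b : Fin m) : dx a (frame b) = if a = b then 1 else 0 := by
  have h := cosFn_sq_add_sinFn_sq a
  have hpi := Real.pi_pos.ne'
  rw [dx, frame_C, frame_C, partialFn_cosFn, partialFn_sinFn]
  by_cases hab : b = a
  · subst hab
    rw [← map_mul, ← map_mul, ← map_sub]
    simp only [if_true]
    rw [show cosFn b * (2 * Real.pi) • cosFn b - sinFn b * -(2 * Real.pi) • sinFn b =
      (2 * Real.pi) • (cosFn b * cosFn b + sinFn b * sinFn b) by
        rw [mul_smul_comm, mul_smul_comm, neg_smul, smul_add, sub_neg_eq_add], h]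
    rw [C_real_smul, smul_smul, inv_mul_cancel₀ (by positivity), one_smul, map_one]
  · rw [if_neg hab, if_neg (Ne.symm hab)]
    simp

/-- It suffices to test on constant series. There each coefficient, evaluated at a point p, is a
point derivation, to which `PointDerivation.apply_eq` applies. -/
theorem eq_sum_dx_frame (X : FormalVF m) : X = ∑ a, dx a X • frame a := by
  refine formalVF_ext_C fun f => ?_
  ext1 k
  refine Subtype.ext <| funext fun p => ?_
  let v : PointDerivation p :=
    { toLin :=
        { toFun := fun f => (PowerSeries.coeff k (X (PowerSeries.C f))).1 p
          map_add' := fun f g => by rw [map_add, map_add, map_add]; rfl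
          map_smul' := fun c f => by
            rw [C_real_smul, formalVF_real_smul, coeff_real_smul]
            rfl }
      leibniz := fun f g => by
        change (PowerSeries.coeff k (X (PowerSeries.C (f * g)))).1 p = _
        rw [map_mul, Derivation.leibniz, smul_eq_mul, smul_eq_mul, map_add,
          PowerSeries.coeff_C_mul, PowerSeries.coeff_C_mul]
        rfl }
  refine (v.apply_eq f).trans ?_
  rw [show (∑ a, dx a X • frame a : FormalVF m) (PowerSeries.C f) =
    ∑ a, dx a X * PowerSeries.C (partialFn a f) by
      simp, map_sum, AddSubmonoidClass.coe_finsetSum,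
    Finset.sum_apply]
  refine Finset.sum_congr rfl fun a _ => ?_
  rw [PowerSeries.coeff_mul_C, coeff_dx, mul_comm]
  rfl

theorem formalVF_apply (X : FormalVF m) (F : FormalFn m) : X F = ∑ a, dx a X * frame a F := by
  conv_lhs => rw [eq_sum_dx_frame X]
  simp

theorem formalVF_ext_dx {X Y : FormalVF m} (h : ∀ a, dx a X = dx a Y) : X = Y := by
  rw [eq_sum_dx_frame X, eq_sum_dx_frame Y]
  simp only [h]

/-! ### Connections in the invariant frame -/

@[simp] theorem dx_standardFlat (c : Fin m) (X Y : FormalVF m) :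
    dx c (standardFlat X Y) = X (dx c Y) := by
  simp [standardFlat]

theorem dx_lie (c : Fin m) (X Y : FormalVF m) : dx c ⁅X, Y⁆ = X (dx c Y) - Y (dx c X) := by
  have h : ⁅X, Y⁆ = ∑ b, (X (dx b Y) - Y (dx b X)) • frame b := by
    ext1 F
    rw [formalVF_lie_apply, formalVF_apply Y F, formalVF_apply X F, map_sum, map_sum]
    simp only [Derivation.leibniz, smul_eq_mul, Finset.sum_add_distrib, sub_mul,
      Finset.sum_sub_distrib, formalVF_sum_apply, Derivation.smul_apply]
    -- The second-order terms cancel because the invariant fields commute.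
    have hs : ∑ b, dx b Y * X (frame b F) = ∑ b, dx b X * Y (frame b F) := by
      simp only [formalVF_apply X (frame _ F), formalVF_apply Y (frame _ F), Finset.mul_sum]
      rw [Finset.sum_comm]
      refine Finset.sum_congr rfl fun a _ => Finset.sum_congr rfl fun b _ => ?_
      rw [frame_comm a b]
      ring
    rw [hs]
    simp only [mul_comm (frame _ F)]
    ring
  rw [h]
  simp

theorem omega_add_left (Ω : Matrix (Fin m) (Fin m) ℝ) (X X' Y : FormalVF m) :
    omega Ω (X + X') Y = omega Ω X Y + omega Ω X' Y := by
  simp only [omega, dx_add, add_mul, smul_add, Finset.sum_add_distrib]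

theorem omega_smul_left (Ω : Matrix (Fin m) (Fin m) ℝ) (F : FormalFn m) (X Y : FormalVF m) :
    omega Ω (F • X) Y = F * omega Ω X Y := by
  simp only [omega, dx_smul, mul_assoc, Finset.mul_sum, mul_smul_comm]

theorem omega_add_right (Ω : Matrix (Fin m) (Fin m) ℝ) (X Y Y' : FormalVF m) :
    omega Ω X (Y + Y') = omega Ω X Y + omega Ω X Y' := by
  simp only [omega, dx_add, mul_add, smul_add, Finset.sum_add_distrib]

theorem omega_smul_right (Ω : Matrix (Fin m) (Fin m) ℝ) (F : FormalFn m) (X Y : FormalVF m) :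
    omega Ω X (F • Y) = F * omega Ω X Y := by
  simp only [omega, dx_smul, Finset.mul_sum, mul_smul_comm, mul_left_comm]

/-- `ω` as a bilinear form. -/
def omegaBilin (Ω : Matrix (Fin m) (Fin m) ℝ) :
    FormalVF m →ₗ[FormalFn m] FormalVF m →ₗ[FormalFn m] FormalFn m :=
  LinearMap.mk₂ _ (omega Ω) (omega_add_left Ω) (omega_smul_left Ω) (omega_add_right Ω)
    (omega_smul_right Ω)

theorem omegaBilin_apply (Ω : Matrix (Fin m) (Fin m) ℝ) (X Y : FormalVF m) :
    omegaBilin Ω X Y = omega Ω X Y := rfl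

@[simp] theorem omega_zero_left (Ω : Matrix (Fin m) (Fin m) ℝ) (Y : FormalVF m) :
    omega Ω 0 Y = 0 := (omegaBilin Ω).map_zero₂ Y

theorem omega_frame_right (Ω : Matrix (Fin m) (Fin m) ℝ) (X : FormalVF m) (b : Fin m) :
    omega Ω X (frame b) = ∑ a, Ω a b • dx a X := by
  simp [omega]

@[simp] theorem omega_frame (Ω : Matrix (Fin m) (Fin m) ℝ) (a b : Fin m) :
    omega Ω (frame a) (frame b) = algebraMap ℝ⟦X⟧ (FormalFn m) (PowerSeries.C (Ω a b)) := by
  simp [omega, real_smul_formalFn, C_algebraMap]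

namespace IsConnection

variable {D : FormalVF m → FormalVF m → FormalVF m}

theorem zero_left (hD : IsConnection D) (Y : FormalVF m) : D 0 Y = 0 := by
  simpa using hD.smul_left 0 0 Y

theorem zero_right (hD : IsConnection D) (X : FormalVF m) : D X 0 = 0 := by
  simpa using hD.leibniz 0 X 0

theorem sub_left (hD : IsConnection D) (X X' Y : FormalVF m) :
    D (X - X') Y = D X Y - D X' Y := by
  have h := hD.add_left (X - X') X' Y
  rw [show X - X' + X' = X from formalVF_ext_dx fun c => by simp] at h
  exact formalVF_ext_dx fun c => by simp [h]

theorem sum_left (hD : IsConnection D) {ι : Type*} (s : Finset ι) (X : ι → FormalVF m)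
    (Y : FormalVF m) : D (∑ i ∈ s, X i) Y = ∑ i ∈ s, D (X i) Y := by
  induction s using Finset.cons_induction with
  | empty => simp [hD.zero_left]
  | cons i s hi ih => rw [Finset.sum_cons, Finset.sum_cons, hD.add_left, ih]

theorem sum_right (hD : IsConnection D) {ι : Type*} (s : Finset ι) (X : FormalVF m)
    (Y : ι → FormalVF m) : D X (∑ i ∈ s, Y i) = ∑ i ∈ s, D X (Y i) := by
  induction s using Finset.cons_induction with
  | empty => simp [hD.zero_right]
  | cons i s hi ih => rw [Finset.sum_cons, Finset.sum_cons, hD.add_right, ih]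

/-- Two connections agree if they agree on a frame. -/
theorem ext_frame (hD : IsConnection D) {D' : FormalVF m → FormalVF m → FormalVF m}
    (hD' : IsConnection D') (h : ∀ a b, D (frame a) (frame b) = D' (frame a) (frame b)) :
    D = D' := by
  funext X Y
  rw [eq_sum_dx_frame X, eq_sum_dx_frame Y]
  simp only [hD.sum_left, hD'.sum_left, hD.sum_right, hD'.sum_right, hD.smul_left, hD'.smul_left,
    hD.leibniz, hD'.leibniz, h]

theorem apply_frame_right (hD : IsConnection D) (X Y : FormalVF m) :
    D X Y = ∑ b, (X (dx b Y) • frame b + dx b Y • D X (frame b)) := by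
  conv_lhs => rw [eq_sum_dx_frame Y]
  simp only [hD.sum_right, hD.leibniz]

theorem curvature_add_right (hD : IsConnection D) (X Y Z Z' : FormalVF m) :
    curvature D X Y (Z + Z') = curvature D X Y Z + curvature D X Y Z' := by
  simp only [curvature, hD.add_right]
  exact formalVF_ext_dx fun c => by simp only [dx_add, dx_sub]; ring

theorem curvature_smul_right (hD : IsConnection D) (F : FormalFn m) (X Y Z : FormalVF m) :
    curvature D X Y (F • Z) = F • curvature D X Y Z := by
  simp only [curvature, hD.leibniz, hD.add_right, formalVF_lie_apply]
  exact formalVF_ext_dx fun c => by simp only [dx_add, dx_sub, dx_smul]; ring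

theorem curvature_skew (hD : IsConnection D) (X Y Z : FormalVF m) :
    curvature D X Y Z = -curvature D Y X Z := by
  have h : D ⁅X, Y⁆ Z = D 0 Z - D ⁅Y, X⁆ Z := by
    rw [← hD.sub_left]
    congr 1
    exact formalVF_ext_dx fun c => by simp only [dx_sub, dx_lie, dx_zero]; ring
  simp only [curvature, h, hD.zero_left]
  exact formalVF_ext_dx fun c => by simp only [dx_sub, dx_zero, dx_neg]; ring

theorem curvature_add_left (hD : IsConnection D) (X X' Y Z : FormalVF m) :
    curvature D (X + X') Y Z = curvature D X Y Z + curvature D X' Y Z := by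
  have h : ⁅X + X', Y⁆ = ⁅X, Y⁆ + ⁅X', Y⁆ :=
    formalVF_ext_dx fun c => by simp only [dx_add, dx_lie, map_add, Derivation.add_apply]; ring
  simp only [curvature, h, hD.add_left, hD.add_right]
  exact formalVF_ext_dx fun c => by simp only [dx_add, dx_sub]; ring

theorem curvature_smul_left (hD : IsConnection D) (F : FormalFn m) (X Y Z : FormalVF m) :
    curvature D (F • X) Y Z = F • curvature D X Y Z := by
  have h : ⁅F • X, Y⁆ = F • ⁅X, Y⁆ - Y F • X := by
    ext1 G
    simp only [formalVF_lie_apply, Derivation.smul_apply, formalVF_sub_apply,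
      Derivation.leibniz, smul_eq_mul]
    ring
  simp only [curvature, h, hD.smul_left, hD.leibniz, hD.sub_left]
  exact formalVF_ext_dx fun c => by simp only [dx_add, dx_sub, dx_smul]; ring

/-- The curvature vanishes if it does on a frame. -/
theorem curvature_eq_zero (hD : IsConnection D)
    (h : ∀ a b c, curvature D (frame a) (frame b) (frame c) = 0) (X Y Z : FormalVF m) :
    curvature D X Y Z = 0 := by
  have hl : ∀ Y Z, (∀ a, curvature D (frame a) Y Z = 0) → ∀ X, curvature D X Y Z = 0 := by
    intro Y Z h X
    let L : FormalVF m →ₗ[FormalFn m] FormalVF m :=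
      { toFun := fun X => curvature D X Y Z
        map_add' := fun X X' => hD.curvature_add_left X X' Y Z
        map_smul' := fun F X => hD.curvature_smul_left F X Y Z }
    change L X = 0
    rw [eq_sum_dx_frame X, map_sum]
    exact Finset.sum_eq_zero fun a _ => by rw [map_smul]; change _ • curvature D _ Y Z = 0; simp [h]
  have hr : ∀ X Y, (∀ c, curvature D X Y (frame c) = 0) → ∀ Z, curvature D X Y Z = 0 := by
    intro X Y h Z
    let L : FormalVF m →ₗ[FormalFn m] FormalVF m :=
      { toFun := fun Z => curvature D X Y Z
        map_add' := hD.curvature_add_right X Y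
        map_smul' := fun F Z => hD.curvature_smul_right F X Y Z }
    change L Z = 0
    rw [eq_sum_dx_frame Z, map_sum]
    exact Finset.sum_eq_zero fun a _ => by rw [map_smul]; change _ • curvature D X Y _ = 0; simp [h]
  refine hr X Y (fun c => hl _ _ (fun a => ?_) X) Z
  rw [hD.curvature_skew, hl _ _ (fun b => h b a c) Y]
  exact formalVF_ext_dx fun c => by simp

end IsConnection

theorem dx_curvature_frame {D : FormalVF m → FormalVF m → FormalVF m} (hD : IsConnection D)
    (a b c d : Fin m) :
    dx d (curvature D (frame a) (frame b) (frame c)) =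
      frame a (dx d (D (frame b) (frame c))) - frame b (dx d (D (frame a) (frame c))) +
        ∑ e, (dx e (D (frame b) (frame c)) * dx d (D (frame a) (frame e)) -
          dx e (D (frame a) (frame c)) * dx d (D (frame b) (frame e))) := by
  have h : ∀ a b, dx d (D (frame a) (D (frame b) (frame c))) =
      frame a (dx d (D (frame b) (frame c))) +
        ∑ e, dx e (D (frame b) (frame c)) * dx d (D (frame a) (frame e)) := fun a b => by
    rw [hD.apply_frame_right]
    simp [Finset.sum_add_distrib]
  rw [curvature, lie_frame, hD.zero_left, dx_sub, dx_sub, dx_zero, h, h, Finset.sum_sub_distrib]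
  ring

theorem dx_series_smul (c : Fin m) (r : ℝ⟦X⟧) (X : FormalVF m) :
    dx c (r • X) = algebraMap ℝ⟦X⟧ (FormalFn m) r * dx c X := by
  rw [← dx_smul]
  congr 1

theorem algebraMap_real_smul (c : ℝ) (r : ℝ⟦X⟧) :
    algebraMap ℝ⟦X⟧ (FormalFn m) (c • r) = c • algebraMap ℝ⟦X⟧ (FormalFn m) r := by
  ext1 k
  rw [coeff_algebraMap, coeff_real_smul, coeff_algebraMap, PowerSeries.coeff_smul, smul_eq_mul,
    map_mul, Algebra.smul_def]

theorem sum_rotate {ι M : Type*} [Fintype ι] [AddCommMonoid M] (f : ι → ι → ι → M) :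
    ∑ b, ∑ c, ∑ a, f a b c = ∑ a, ∑ b, ∑ c, f a b c :=
  (Finset.sum_congr rfl fun _ _ => Finset.sum_comm).trans Finset.sum_comm

theorem sum_reverse {ι M : Type*} [Fintype ι] [AddCommMonoid M] (f : ι → ι → ι → M) :
    ∑ b, ∑ c, ∑ d, f b c d = ∑ d, ∑ c, ∑ b, f b c d :=
  (sum_rotate fun d b c => f b c d).trans (Finset.sum_congr rfl fun _ _ => Finset.sum_comm)

/-! ### Connections with constant coefficients -/

/-- The connection `∇^0 + Γ` with constant Christoffel symbols `Γ a b c = Γ_{ab}^c`. -/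
def constConnection (Γ : Fin m → Fin m → Fin m → ℝ⟦X⟧) (X Y : FormalVF m) : FormalVF m :=
  standardFlat X Y + ∑ a, ∑ b, (dx a X * dx b Y) • ∑ c, Γ a b c • frame c

theorem dx_constConnection (Γ : Fin m → Fin m → Fin m → ℝ⟦X⟧) (c : Fin m) (X Y : FormalVF m) :
    dx c (constConnection Γ X Y) = X (dx c Y) +
      ∑ a, ∑ b, dx a X * dx b Y * algebraMap ℝ⟦X⟧ (FormalFn m) (Γ a b c) := by
  simp [constConnection, dx_series_smul]

theorem constConnection_isConnection (Γ : Fin m → Fin m → Fin m → ℝ⟦X⟧) :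
    IsConnection (constConnection Γ) where
  add_left X X' Y := formalVF_ext_dx fun c => by
    simp only [dx_constConnection, dx_add, Derivation.add_apply, add_mul, Finset.sum_add_distrib]
    ring
  smul_left F X Y := formalVF_ext_dx fun c => by
    simp only [dx_constConnection, dx_smul, Derivation.smul_apply, smul_eq_mul, mul_add,
      Finset.mul_sum, mul_assoc]
  add_right X Y Y' := formalVF_ext_dx fun c => by
    simp only [dx_constConnection, dx_add, map_add, add_mul, mul_add, Finset.sum_add_distrib]
    ring
  leibniz F X Y := formalVF_ext_dx fun c => by
    simp only [dx_constConnection, dx_add, dx_smul, Derivation.leibniz, smul_eq_mul, mul_add,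
      Finset.mul_sum, mul_assoc, mul_left_comm _ F]
    ring

theorem dx_constConnection_frame (Γ : Fin m → Fin m → Fin m → ℝ⟦X⟧) (a b c : Fin m) :
    dx c (constConnection Γ (frame a) (frame b)) =
      algebraMap ℝ⟦X⟧ (FormalFn m) (Γ a b c) := by
  have h : frame a (if c = b then 1 else 0 : FormalFn m) = 0 := by split_ifs <;> simp
  simp [dx_constConnection, h]

theorem constConnection_torsion_free {Γ : Fin m → Fin m → Fin m → ℝ⟦X⟧}
    (h : ∀ a b c, Γ a b c = Γ b a c) (X Y : FormalVF m) :
    constConnection Γ X Y - constConnection Γ Y X = ⁅X, Y⁆ := formalVF_ext_dx fun c => by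
  have hs : ∑ a, ∑ b, dx a X * dx b Y * algebraMap ℝ⟦X⟧ (FormalFn m) (Γ a b c) =
      ∑ a, ∑ b, dx a Y * dx b X * algebraMap ℝ⟦X⟧ (FormalFn m) (Γ a b c) := by
    rw [Finset.sum_comm]
    refine Finset.sum_congr rfl fun a _ => Finset.sum_congr rfl fun b _ => ?_
    rw [h a b]
    ring
  rw [dx_sub, dx_lie, dx_constConnection, dx_constConnection, hs]
  ring

theorem constConnection_parallel {Ω : Matrix (Fin m) (Fin m) ℝ}
    {Γ : Fin m → Fin m → Fin m → ℝ⟦X⟧}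
    (h : ∀ a b c, ∑ d, Ω d c • Γ a b d + ∑ d, Ω b d • Γ a c d = 0) (X Y Z : FormalVF m) :
    X (omega Ω Y Z) = omega Ω (constConnection Γ X Y) Z + omega Ω Y (constConnection Γ X Z) := by
  -- These are all the terms that contain Γ; the hypothesis that each endomorphism Γ_a is skew for Ω
  -- cancels them. What is left is the Leibniz rule for the flat connection.
  have hs : ∑ b, ∑ c, Ω b c • ((∑ a, ∑ d, dx a X * dx d Y *
        algebraMap ℝ⟦X⟧ (FormalFn m) (Γ a d b)) * dx c Z) +
      ∑ b, ∑ c, Ω b c • (dx b Y * (∑ a, ∑ d, dx a X * dx d Z *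
        algebraMap ℝ⟦X⟧ (FormalFn m) (Γ a d c))) = 0 := by
    have e1 : ∑ b, ∑ c, Ω b c • ((∑ a, ∑ d, dx a X * dx d Y *
        algebraMap ℝ⟦X⟧ (FormalFn m) (Γ a d b)) * dx c Z) =
        ∑ a, ∑ b, ∑ c, dx a X * dx b Y * dx c Z *
          algebraMap ℝ⟦X⟧ (FormalFn m) (∑ d, Ω d c • Γ a b d) := by
      simp only [map_sum, algebraMap_real_smul, Finset.mul_sum, Finset.sum_mul, Finset.smul_sum]
      rw [sum_rotate fun a b c => ∑ d, _]
      refine Finset.sum_congr rfl fun a _ => ?_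
      rw [sum_reverse]
      refine Finset.sum_congr rfl fun b _ => Finset.sum_congr rfl fun c _ =>
        Finset.sum_congr rfl fun d _ => ?_
      rw [mul_smul_comm]
      congr 1
      ring
    have e2 : ∑ b, ∑ c, Ω b c • (dx b Y * (∑ a, ∑ d, dx a X * dx d Z *
        algebraMap ℝ⟦X⟧ (FormalFn m) (Γ a d c))) =
        ∑ a, ∑ b, ∑ c, dx a X * dx b Y * dx c Z *
          algebraMap ℝ⟦X⟧ (FormalFn m) (∑ d, Ω b d • Γ a c d) := by
      simp only [map_sum, algebraMap_real_smul, Finset.mul_sum, Finset.smul_sum]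
      rw [sum_rotate fun a b c => ∑ d, _]
      refine Finset.sum_congr rfl fun a _ => Finset.sum_congr rfl fun b _ => ?_
      rw [Finset.sum_comm]
      refine Finset.sum_congr rfl fun c _ => Finset.sum_congr rfl fun d _ => ?_
      rw [mul_smul_comm]
      congr 1
      ring
    rw [e1, e2]
    simp only [← Finset.sum_add_distrib, ← mul_add, ← map_add, h, map_zero, mul_zero,
      Finset.sum_const_zero]
  have hX : X (omega Ω Y Z) = ∑ b, ∑ c, Ω b c • (X (dx b Y) * dx c Z) +
      ∑ b, ∑ c, Ω b c • (dx b Y * X (dx c Z)) := by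
    simp only [omega, map_sum, formalVF_real_smul, Derivation.leibniz, smul_eq_mul, smul_add,
      Finset.sum_add_distrib, mul_comm (dx _ Z)]
    ring
  rw [hX]
  simp only [omega, dx_constConnection, add_mul, mul_add, smul_add, Finset.sum_add_distrib]
  linear_combination -hs

theorem constConnection_curvature {Γ : Fin m → Fin m → Fin m → ℝ⟦X⟧}
    (h : ∀ a b c d, ∑ e, Γ b c e * Γ a e d = 0) (X Y Z : FormalVF m) :
    curvature (constConnection Γ) X Y Z = 0 := by
  refine (constConnection_isConnection Γ).curvature_eq_zero (fun a b c => ?_) X Y Z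
  refine formalVF_ext_dx fun d => ?_
  rw [dx_curvature_frame (constConnection_isConnection Γ)]
  simp only [dx_constConnection_frame, Derivation.map_algebraMap, Finset.sum_sub_distrib,
    ← map_mul, ← map_sum, h, map_zero, dx_zero, sub_zero, add_zero]

/-- The last hypothesis makes the connection flat, so both curvature tensors vanish and the
Ricci-type equation is trivial. -/
theorem constConnection_mem_ricciCurves {n : ℕ} {Ω : Matrix (Fin (2 * n)) (Fin (2 * n)) ℝ}
    {Γ : Fin (2 * n) → Fin (2 * n) → Fin (2 * n) → ℝ⟦X⟧}
    (h0 : ∀ a b c, PowerSeries.constantCoeff (Γ a b c) = 0)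
    (hsymm : ∀ a b c, Γ a b c = Γ b a c)
    (hsp : ∀ a b c, ∑ d, Ω d c • Γ a b d + ∑ d, Ω b d • Γ a c d = 0)
    (hmul : ∀ a b c d, ∑ e, Γ b c e * Γ a e d = 0) :
    constConnection Γ ∈ ricciCurves Ω := by
  refine ⟨{ constConnection_isConnection Γ with
    torsion_free := constConnection_torsion_free hsymm
    parallel := constConnection_parallel hsp }, fun X Y Z T => ?_, fun X Y F => ?_⟩
  · simp [ricciPart, ricci, constConnection_curvature hmul]
  · rw [formalVF_apply, formalVF_apply (standardFlat X Y)]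
    simp only [dx_constConnection, dx_standardFlat, map_sum, map_mul, map_add]
    have hz : ∀ a b c, PowerSeries.constantCoeff
        (algebraMap ℝ⟦X⟧ (FormalFn (2 * n)) (Γ a b c)) = 0 := fun a b c => by
      rw [← PowerSeries.coeff_zero_eq_constantCoeff_apply, coeff_algebraMap,
        PowerSeries.coeff_zero_eq_constantCoeff_apply, h0, map_zero]
    simp [hz]

/-! ### The coefficients of a formal curve of linear maps -/

namespace LinearCurve

variable {Ω : Matrix (Fin m) (Fin m) ℝ}

/-- `A^t(∂_a) ∂_b = ∑_c (A.christoffel a b c) ∂_c`. -/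
def christoffel (A : LinearCurve Ω) (a b c : Fin m) : ℝ⟦X⟧ :=
  PowerSeries.mk fun k =>
    (PowerSeries.coeff k (A.toLin (Pi.single a 1))).mulVec (Pi.single b 1) c

theorem coeff_christoffel (A : LinearCurve Ω) (a b c : Fin m) (k : ℕ) :
    PowerSeries.coeff k (A.christoffel a b c) =
      PowerSeries.coeff k (A.toLin (Pi.single a 1)) c b := by
  rw [christoffel, PowerSeries.coeff_mk, Matrix.mulVec_single_one]
  rfl

theorem connection_eq (A : LinearCurve Ω) : A.connection = constConnection A.christoffel := rfl

theorem christoffel_zero (A : LinearCurve Ω) (a b c : Fin m) :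
    PowerSeries.constantCoeff (A.christoffel a b c) = 0 := by
  rw [← PowerSeries.coeff_zero_eq_constantCoeff_apply, coeff_christoffel,
    PowerSeries.coeff_zero_eq_constantCoeff_apply, A.constantCoeff_eq_zero]
  rfl

theorem christoffel_symm (A : LinearCurve Ω) (a b c : Fin m) :
    A.christoffel a b c = A.christoffel b a c := by
  ext k
  simp only [christoffel, PowerSeries.coeff_mk, A.symmetric (Pi.single a 1)]

theorem christoffel_sp (A : LinearCurve Ω) (a b c : Fin m) :
    ∑ d, Ω d c • A.christoffel a b d + ∑ d, Ω b d • A.christoffel a c d = 0 := by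
  ext k
  have h := A.mem_sp (Pi.single a 1) k
  rw [mem_skewAdjointMatricesLieSubalgebra, mem_skewAdjointMatricesSubmodule,
    Matrix.IsSkewAdjoint, Matrix.IsAdjointPair] at h
  have h' := congrFun (congrFun h b) c
  simp only [map_add, map_sum, PowerSeries.coeff_smul, coeff_christoffel, smul_eq_mul]
  simp only [Matrix.mul_apply, Matrix.transpose_apply, Matrix.neg_apply, mul_neg,
    Finset.sum_neg_distrib] at h'
  simp only [mul_comm (Ω _ c)]
  rw [h']
  simp

theorem christoffel_mul (A : LinearCurve Ω) (a b c d : Fin m) :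
    ∑ e, A.christoffel b c e * A.christoffel a e d = 0 := by
  ext k
  have h := congrArg (PowerSeries.coeff k) (A.mul_eq_zero (Pi.single a 1) (Pi.single b 1))
  rw [PowerSeries.coeff_mul] at h
  have h' := congrFun (congrFun h d) c
  simp only [Matrix.sum_apply, Matrix.mul_apply, map_zero, Matrix.zero_apply] at h'
  simp only [map_sum, mul_comm (A.christoffel b c _), PowerSeries.coeff_mul, coeff_christoffel,
    map_zero]
  rw [Finset.sum_comm, h']

theorem ext_christoffel {A B : LinearCurve Ω} (h : A.christoffel = B.christoffel) : A = B := by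
  apply LinearCurve.ext
  refine LinearMap.pi_ext' fun a => LinearMap.ext_ring ?_
  ext k c b
  change PowerSeries.coeff k (A.toLin (Pi.single a 1)) c b =
    PowerSeries.coeff k (B.toLin (Pi.single a 1)) c b
  rw [← coeff_christoffel, h, coeff_christoffel]

theorem connection_mem {n : ℕ} {Ω : Matrix (Fin (2 * n)) (Fin (2 * n)) ℝ} (A : LinearCurve Ω) :
    A.connection ∈ ricciCurves Ω :=
  constConnection_mem_ricciCurves A.christoffel_zero A.christoffel_symm A.christoffel_sp
    A.christoffel_mul

theorem exists_christoffel_eq (Γ : Fin m → Fin m → Fin m → ℝ⟦X⟧)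
    (h0 : ∀ a b c, PowerSeries.constantCoeff (Γ a b c) = 0)
    (hsymm : ∀ a b c, Γ a b c = Γ b a c)
    (hsp : ∀ a b c, ∑ d, Ω d c • Γ a b d + ∑ d, Ω b d • Γ a c d = 0)
    (hmul : ∀ a b c d, ∑ e, Γ b c e * Γ a e d = 0) :
    ∃ A : LinearCurve Ω, A.christoffel = Γ := by
  -- The lower index b labels columns and the upper index c labels rows: `M a k` represents the
  -- coefficient of degree k of the endomorphism attached to ∂_a.
  let M : Fin m → ℕ → Matrix (Fin m) (Fin m) ℝ := fun a k =>
    Matrix.of fun c b => PowerSeries.coeff k (Γ a b c)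
  let T : (Fin m → ℝ) →ₗ[ℝ] (Matrix (Fin m) (Fin m) ℝ)⟦X⟧ :=
    { toFun := fun X => PowerSeries.mk fun k => ∑ a, X a • M a k
      map_add' := fun X Y => by
        ext1 k
        simp [add_smul, Finset.sum_add_distrib]
      map_smul' := fun r X => by
        ext1 k
        simp [Finset.smul_sum, smul_smul] }
  have hT : ∀ X k, PowerSeries.coeff k (T X) = ∑ a, X a • M a k := fun X k =>
    PowerSeries.coeff_mk k fun k => ∑ a, X a • M a k
  have hM : ∀ a b k l, ∀ c d, ∑ e, M a k d e * M b l e c = ∑ e,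
      PowerSeries.coeff k (Γ a e d) * PowerSeries.coeff l (Γ b c e) := fun _ _ _ _ _ _ => rfl
  refine ⟨⟨T, fun X => ?_, fun X k => ?_, fun X Y => ?_, fun X Y k => ?_⟩, ?_⟩
  · rw [← PowerSeries.coeff_zero_eq_constantCoeff_apply, hT]
    refine Finset.sum_eq_zero fun a _ => ?_
    rw [show M a 0 = 0 by ext c b; simp [M, h0], smul_zero]
  · rw [hT]
    refine Submodule.sum_mem _ fun a _ => Submodule.smul_mem _ _ ?_
    change M a k ∈ skewAdjointMatricesLieSubalgebra Ω
    rw [mem_skewAdjointMatricesLieSubalgebra, mem_skewAdjointMatricesSubmodule,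
      Matrix.IsSkewAdjoint, Matrix.IsAdjointPair]
    ext b c
    have h := congrArg (PowerSeries.coeff k) (hsp a b c)
    simp only [map_add, map_sum, PowerSeries.coeff_smul, smul_eq_mul, map_zero] at h
    simp only [Matrix.mul_apply, Matrix.transpose_apply, Matrix.neg_apply, mul_neg,
      Finset.sum_neg_distrib, M, Matrix.of_apply]
    rw [eq_neg_iff_add_eq_zero, ← h]
    simp only [mul_comm]
  · ext1 k
    rw [PowerSeries.coeff_mul]
    simp only [hT, Finset.sum_mul, Finset.mul_sum, smul_mul_smul_comm, map_zero]
    rw [Finset.sum_comm]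
    refine Finset.sum_eq_zero fun a _ => ?_
    rw [Finset.sum_comm]
    refine Finset.sum_eq_zero fun b _ => ?_
    rw [← Finset.smul_sum]
    convert smul_zero _
    ext d c
    have h := congrArg (PowerSeries.coeff k) (hmul b a c d)
    simp only [map_sum, mul_comm (Γ a c _), PowerSeries.coeff_mul, map_zero] at h
    rw [Finset.sum_comm] at h
    simpa [Matrix.sum_apply, Matrix.mul_apply, M] using h
  · simp only [hT, Matrix.sum_mulVec, Matrix.smul_mulVec]
    ext c
    simp only [Finset.sum_apply, Pi.smul_apply, Matrix.mulVec, dotProduct, smul_eq_mul,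
      Finset.mul_sum, M, Matrix.of_apply]
    rw [Finset.sum_comm]
    refine Finset.sum_congr rfl fun a _ => Finset.sum_congr rfl fun b _ => ?_
    rw [hsymm a b]
    ring
  · funext a b c
    ext k
    rw [coeff_christoffel]
    change PowerSeries.coeff k (T (Pi.single a 1)) c b = _
    rw [hT, Finset.sum_eq_single a]
    · simp [M]
    · intro a' _ ha
      simp [ha]
    · simp

end LinearCurve

/-! ### Commutative products with curvature of Ricci type -/

section Product

variable {K V : Type*} [CommRing K] [AddCommGroup V] [Module K V]

/-- A commutative product `p` on a symplectic module whose curvature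
`[p a, p b]` is the Ricci-type tensor built from a symmetric form `r`. -/
structure RicciProduct (w : V →ₗ[K] V →ₗ[K] K) (p : V →ₗ[K] V →ₗ[K] V)
    (r : V →ₗ[K] V →ₗ[K] K) (c : K) : Prop where
  skew : ∀ x y, w x y = -w y x
  comm : ∀ x y, p x y = p y x
  symm : ∀ x y, r x y = r y x
  sp : ∀ x y z, w (p x y) z = -w y (p x z)
  ricci : ∀ x y z t, w (p x (p y z)) t - w (p y (p x z)) t =
    c * (2 * w x y * r z t + w x z * r y t + w x t * r y z - w y z * r x t - w y t * r x z)

namespace RicciProduct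

variable {w : V →ₗ[K] V →ₗ[K] K} {p : V →ₗ[K] V →ₗ[K] V} {r : V →ₗ[K] V →ₗ[K] K} {c : K}

theorem apply_self [IsDomain K] [CharZero K] (h : RicciProduct w p r c) (a : V) : w a a = 0 := by
  have h2 : (2 : K) * w a a = 0 := by linear_combination h.skew a a
  simpa using h2

/-- The square of a multiplication, an element of sp, is self-adjoint for w; hence skewness in b and
d. -/
theorem mul_mul_swap (h : RicciProduct w p r c) (a b d : V) :
    w (p a (p a b)) d = -w (p a (p a d)) b := by
  rw [h.sp, h.sp, h.skew, neg_neg]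

/-- Both sides equal minus w of aa against bd = db. So the two halves of the curvature identity at
(a, b, a, d) have opposite symmetry in b and d and can be separated. -/
theorem square_mul_swap (h : RicciProduct w p r c) (a b d : V) :
    w (p b (p a a)) d = w (p d (p a a)) b := by
  rw [h.sp b, h.sp d, h.comm b d]

/-- The part of the curvature identity that is symmetric in b and d. -/
theorem square_mul [IsDomain K] [CharZero K] (h : RicciProduct w p r c) (a b d : V) :
    w (p (p a a) b) d = -2 * c * (r a b * w a d + w a b * r a d) := by
  have h1 := h.ricci a b a d
  have h2 := h.ricci a d a b
  rw [h.comm b a, h.apply_self, h.skew b a, h.symm b a] at h1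
  rw [h.comm d a, h.apply_self, h.skew d a, h.symm d a, h.skew d b] at h2
  refine mul_left_cancel₀ (two_ne_zero (α := K)) ?_
  rw [h.comm]
  linear_combination h.square_mul_swap a b d + h.mul_mul_swap a b d - h1 - h2

/-- The part of the curvature identity that is skew in b and d. -/
theorem mul_mul [IsDomain K] [CharZero K] (h : RicciProduct w p r c) (a b d : V) :
    2 * w (p a (p a b)) d = -2 * c * (r a a * w b d + r a b * w a d - w a b * r a d) := by
  have h1 := h.ricci a b a d
  have h2 := h.ricci a d a b
  rw [h.comm b a, h.apply_self, h.skew b a, h.symm b a] at h1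
  rw [h.comm d a, h.apply_self, h.skew d a, h.symm d a, h.skew d b] at h2
  linear_combination h.square_mul_swap a b d + h.mul_mul_swap a b d + h1 - h2

/-- Write L_a for multiplication by a and e = aa. The symmetric part of the curvature identity gives
L_e as an explicit operator of rank at most two, hence its square; the skew part, applied to e,
gives that square again. Comparing the traces of the two expressions, and of their squares, kills
the Ricci form. -/
theorem mul_mul_eq_zero [IsDomain K] [CharZero K] [Module.Free K V] [Module.Finite K V]
    (h : RicciProduct w p r c) (hdim : 3 ≤ Module.finrank K V)
    (hsurj : ∀ φ : V →ₗ[K] K, ∃ v, ∀ b, w v b = φ b) (hinj : ∀ v, (∀ b, w v b = 0) → v = 0)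
    (x y z : V) : p x (p y z) = 0 := by
  have hext : ∀ u v, (∀ d, w u d = w v d) → u = v := fun u v huv =>
    sub_eq_zero.1 (hinj _ fun b => by rw [map_sub, LinearMap.sub_apply, huv, sub_self])
  have h0 := h.apply_self
  -- the Ricci endomorphism
  choose ρ hρ using fun a => hsurj ((-2 * c) • r a)
  have hρ' : ∀ a b, w (ρ a) b = -2 * c * r a b := fun a b => by
    rw [hρ, LinearMap.smul_apply, smul_eq_mul]
  have hsq : ∀ a b, p (p a a) b = w (ρ a) b • a + w a b • ρ a := fun a b => hext _ _ fun d => by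
    rw [h.square_mul, map_add, map_smul, map_smul, LinearMap.add_apply, LinearMap.smul_apply,
      LinearMap.smul_apply, smul_eq_mul, smul_eq_mul, hρ', hρ']
    ring
  have hmm : ∀ a b, (2 : K) • p a (p a b) = w (ρ a) a • b + w (ρ a) b • a - w a b • ρ a :=
    fun a b => hext _ _ fun d => by
      simp only [map_add, map_smul, map_sub, LinearMap.add_apply, LinearMap.smul_apply,
        LinearMap.sub_apply, smul_eq_mul, h.mul_mul, hρ']
      ring
  have hlam : ∀ a, w (ρ a) a = 0 := by
    intro a
    set e := p a a with he
    set l := w (ρ a) a with hl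
    set μ := w (ρ e) e with hμ
    let T : V →ₗ[K] V := (w (ρ a)).smulRight a - (w a).smulRight (ρ a)
    let T' : V →ₗ[K] V := (w (ρ e)).smulRight e - (w e).smulRight (ρ e)
    have hT : ∀ b, T b = w (ρ a) b • a - w a b • ρ a := fun _ => rfl
    have hT' : ∀ b, T' b = w (ρ e) b • e - w e b • ρ e := fun _ => rfl
    have haρ : w a (ρ a) = -l := h.skew _ _
    have heρ : w e (ρ e) = -μ := h.skew _ _
    have htr : LinearMap.trace K V T = 2 * l := by
      rw [map_sub, LinearMap.trace_smulRight, LinearMap.trace_smulRight, haρ]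
      ring
    have htr' : LinearMap.trace K V T' = 2 * μ := by
      rw [map_sub, LinearMap.trace_smulRight, LinearMap.trace_smulRight, heρ]
      ring
    have hTT : T * T = l • T := by
      ext b
      rw [Module.End.mul_apply, LinearMap.smul_apply]
      simp only [hT, map_sub, map_smul, smul_eq_mul, h0, haρ, ← hl]
      module
    have hTT' : T' * T' = μ • T' := by
      ext b
      rw [Module.End.mul_apply, LinearMap.smul_apply]
      simp only [hT', map_sub, map_smul, smul_eq_mul, h0, heρ, ← hμ]
      module
    have key : (2 * l) • T = μ • (1 : V →ₗ[K] V) + T' := by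
      ext b
      have h1 := hmm e b
      rw [hsq a b, map_add, map_smul, map_smul, hsq, hsq] at h1
      simp only [h0, haρ, ← hl, ← hμ] at h1
      simp only [LinearMap.smul_apply, LinearMap.add_apply, hT, hT', Module.End.one_apply]
      rw [add_sub_assoc] at h1
      rw [← h1]
      module
    have t1 := congrArg (LinearMap.trace K V) key
    have t2 := congrArg (LinearMap.trace K V) (congrArg (fun S : V →ₗ[K] V => S * S) key)
    simp only [map_smul, map_add, htr, htr', LinearMap.trace_one, smul_eq_mul] at t1
    simp only [hTT, mul_add, add_mul, mul_one, smul_mul_assoc, mul_smul_comm,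
      hTT', one_mul, map_smul, map_add, htr, htr', LinearMap.trace_one, smul_eq_mul] at t2
    set N := Module.finrank K V
    -- The traces give 4l² = (N + 2)μ and 8l⁴ = (N + 6)μ². Eliminating l leaves (N + 4)(N - 2)μ² =
    -- 0, which is where rank 2 must be excluded.
    have hN : ((N : K) + 4) * ((N : K) - 2) ≠ 0 := by
      have : ((N : K) + 4) * ((N : K) - 2) = (((N + 4) * (N - 2) : ℕ) : K) := by
        rw [Nat.cast_mul, Nat.cast_sub (by omega)]
        push_cast
        ring
      rw [this]
      exact Nat.cast_ne_zero.2 (Nat.mul_ne_zero (by omega) (by omega))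
    have hμ0 : ((N : K) + 4) * ((N : K) - 2) * (μ * μ) = 0 := by
      linear_combination (-(4 * l ^ 2) - (N + 2) * μ) * t1 + 2 * t2
    have hμ0 : μ = 0 := by
      have := (mul_eq_zero.1 hμ0).resolve_left hN
      simpa using this
    have hl0 : (4 : K) * (l * l) = 0 := by
      rw [hμ0] at t1
      linear_combination t1
    simpa using hl0
  -- Polarisation of `hlam`.
  have hr : ∀ a b, -2 * c * r a b = 0 := fun a b => by
    have h1 := hlam (a + b)
    have h2 := hlam a
    have h3 := hlam b
    rw [hρ'] at h1 h2 h3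
    simp only [map_add, LinearMap.add_apply] at h1
    have h4 : (2 : K) * (-2 * c * r a b) = 0 := by
      linear_combination h1 - h2 - h3 + 2 * c * h.symm b a
    exact (mul_eq_zero.1 h4).resolve_left two_ne_zero
  have hsq0 : ∀ a b, p (p a a) b = 0 := fun a b => hinj _ fun d => by
    rw [h.square_mul]
    linear_combination w a d * hr a b + w a b * hr a d
  -- Polarisation of `hsq0`: the double product itself vanishes, not only the one with a square.
  have h5 := hsq0 (y + z) x
  simp only [map_add, LinearMap.add_apply, hsq0, h.comm z y, zero_add, add_zero] at h5
  have h6 : (2 : K) • p (p y z) x = 0 := by rw [two_smul, h5]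
  rw [h.comm]
  refine hinj _ fun d => ?_
  have h7 := congrArg (fun v => w v d) h6
  simp only [map_smul, LinearMap.smul_apply, smul_eq_mul, map_zero, LinearMap.zero_apply] at h7
  exact (mul_eq_zero.1 h7).resolve_left two_ne_zero

end RicciProduct

end Product

/-! ### Contractions with a symplectic form -/

section Contraction

variable {M : Type*} [AddCommGroup M] [Module ℝ M] {Ω : Matrix (Fin m) (Fin m) ℝ}

theorem inv_skew (hskew : Ω.transpose = -Ω) (hdet : IsUnit Ω.det) :
    Ω⁻¹.transpose = -Ω⁻¹ := by
  rw [Matrix.transpose_nonsing_inv, hskew]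
  refine Matrix.inv_eq_left_inv ?_
  rw [neg_mul_neg, Matrix.nonsing_inv_mul _ hdet]

theorem skew_apply (hskew : Ω.transpose = -Ω) (a b : Fin m) : Ω a b = -Ω b a := by
  have := congrFun (congrFun hskew b) a
  simpa using this

theorem sum_inv_mul (hdet : IsUnit Ω.det) (b c : Fin m) :
    ∑ a, Ω⁻¹ b a * Ω a c = if b = c then 1 else 0 := by
  rw [← Matrix.mul_apply, Matrix.nonsing_inv_mul _ hdet, Matrix.one_apply]

theorem sum_mul_inv (hdet : IsUnit Ω.det) (b c : Fin m) :
    ∑ a, Ω b a * Ω⁻¹ a c = if b = c then 1 else 0 := by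
  rw [← Matrix.mul_apply, Matrix.mul_nonsing_inv _ hdet, Matrix.one_apply]

/-- Contraction with the inverse of `Ω`. -/
def contract (Ω : Matrix (Fin m) (Fin m) ℝ) (f : Fin m → Fin m → M) : M :=
  ∑ b, ∑ a, Ω⁻¹ b a • f a b

theorem contract_add (f g : Fin m → Fin m → M) :
    contract Ω (fun a b => f a b + g a b) = contract Ω f + contract Ω g := by
  simp only [contract, smul_add, Finset.sum_add_distrib]

theorem contract_sub (f g : Fin m → Fin m → M) :
    contract Ω (fun a b => f a b - g a b) = contract Ω f - contract Ω g := by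
  simp only [contract, smul_sub, Finset.sum_sub_distrib]

theorem contract_smul (c : ℝ) (f : Fin m → Fin m → M) :
    contract Ω (fun a b => c • f a b) = c • contract Ω f := by
  simp only [contract, Finset.smul_sum, smul_comm c]

theorem contract_first (hdet : IsUnit Ω.det) (c : Fin m) (f : Fin m → M) :
    contract Ω (fun a b => Ω a c • f b) = f c := by
  simp only [contract, smul_smul, ← Finset.sum_smul, sum_inv_mul hdet]
  simp

theorem contract_second (hskew : Ω.transpose = -Ω) (hdet : IsUnit Ω.det) (c : Fin m)
    (f : Fin m → M) : contract Ω (fun a b => Ω b c • f a) = -f c := by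
  rw [contract, Finset.sum_comm]
  have h : ∀ a, ∑ b, Ω⁻¹ b a * Ω b c = -if c = a then 1 else 0 := fun a => by
    rw [← sum_mul_inv hdet c a, ← Finset.sum_neg_distrib]
    exact Finset.sum_congr rfl fun b _ => by rw [skew_apply hskew b c]; ring
  simp only [smul_smul, ← Finset.sum_smul, h]
  simp

theorem contract_self (hdet : IsUnit Ω.det) (x : M) :
    contract Ω (fun a b => Ω a b • x) = (m : ℝ) • x := by
  simp only [contract, smul_smul, ← Finset.sum_smul, sum_inv_mul hdet]
  simp

theorem contract_swap (hskew : Ω.transpose = -Ω) (hdet : IsUnit Ω.det) (f : Fin m → Fin m → M) :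
    contract Ω (fun a b => f b a) = -contract Ω f := by
  simp only [contract]
  rw [Finset.sum_comm, ← Finset.sum_neg_distrib]
  refine Finset.sum_congr rfl fun b _ => ?_
  rw [← Finset.sum_neg_distrib]
  refine Finset.sum_congr rfl fun a _ => ?_
  rw [skew_apply (inv_skew hskew hdet) a b, neg_smul]

theorem contract_zero : contract Ω (fun _ _ => (0 : M)) = 0 := by simp [contract]

/-- The tensor `r ↦ E(r)` of Ricci type, up to its constant factor. -/
def ricciTensor (Ω : Matrix (Fin m) (Fin m) ℝ) (r : Fin m → Fin m → M) (a b c d : Fin m) : M :=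
  (2 : ℝ) • (Ω a b • r c d) + Ω a c • r b d + Ω a d • r b c - Ω b c • r a d - Ω b d • r a c

/-- The first term contributes 2m and each of the other four contributes 1. Thus r can be read off
from its Ricci-type tensor, which is used both for the Bianchi identity and to see that r is
constant when the curvature is. -/
theorem contract_ricciTensor (hskew : Ω.transpose = -Ω) (hdet : IsUnit Ω.det)
    {r : Fin m → Fin m → M} (hr : ∀ c d, r c d = r d c) (c d : Fin m) :
    contract Ω (fun a b => ricciTensor Ω r a b c d) = (2 * (m : ℝ) + 4) • r c d := by
  simp only [ricciTensor, contract_add, contract_sub, contract_smul, contract_self hdet,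
    contract_first hdet c (fun b => r b d), contract_first hdet d (fun b => r b c),
    contract_second hskew hdet c (fun b => r b d), contract_second hskew hdet d (fun b => r b c),
    hr d c]
  module

/-- The second Bianchi identity for a tensor of Ricci type determines the covariant derivative of
its Ricci tensor. -/
theorem exists_of_bianchi (hm : 3 ≤ m) (hskew : Ω.transpose = -Ω) (hdet : IsUnit Ω.det)
    {ρ : Fin m → Fin m → Fin m → M} (hρ : ∀ e c d, ρ e c d = ρ e d c)
    (h : ∀ e a b c d, ricciTensor Ω (ρ e) a b c d + ricciTensor Ω (ρ a) b e c d +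
      ricciTensor Ω (ρ b) e a c d = 0) :
    ∃ u : Fin m → M, ∀ e c d, ρ e c d = Ω e c • u d + Ω e d • u c := by
  let D : Fin m → M := fun d => contract Ω fun a b => ρ a b d
  -- Contraction of the Bianchi identity over a and b, divided by two.
  have h1 : ∀ e c d, (m : ℝ) • ρ e c d - ρ c e d - ρ d e c = Ω e c • D d + Ω e d • D c := by
    intro e c d
    have hc : contract Ω (fun a b => ricciTensor Ω (ρ e) a b c d + ricciTensor Ω (ρ a) b e c d +
      ricciTensor Ω (ρ b) e a c d) = 0 := by simp only [h, contract_zero]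
    rw [contract_add, contract_add, contract_ricciTensor hskew hdet (hρ e)] at hc
    have hD : ∀ d, contract Ω (fun a b => ρ b a d) = -D d := fun d =>
      contract_swap hskew hdet fun a b => ρ a b d
    have e1 : ∀ a, Ω e a = -Ω a e := skew_apply hskew e
    have e2 : ∀ d, contract Ω (fun a b => Ω a e • ρ b c d) = ρ e c d := fun d =>
      contract_first hdet e fun b => ρ b c d
    have e3 : ∀ x y, contract Ω (fun a b => Ω a x • ρ b e y) = ρ x e y := fun x y =>
      contract_first hdet x fun b => ρ b e y
    have e4 : contract Ω (fun a b => Ω b e • ρ a c d) = -ρ e c d :=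
      contract_second hskew hdet e fun b => ρ b c d
    have e5 : ∀ x y, contract Ω (fun a b => Ω b x • ρ a e y) = -ρ x e y := fun x y =>
      contract_second hskew hdet x fun b => ρ b e y
    have hb : contract Ω (fun a b => ricciTensor Ω (ρ a) b e c d) =
        -(2 : ℝ) • ρ e c d - ρ c e d - ρ d e c - Ω e c • D d - Ω e d • D c := by
      simp only [ricciTensor, contract_add, contract_sub, contract_smul, e4, e5]
      module
    have hb' : contract Ω (fun a b => ricciTensor Ω (ρ b) e a c d) =
        -(2 : ℝ) • ρ e c d - ρ c e d - ρ d e c - Ω e c • D d - Ω e d • D c := by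
      have e6 : ∀ a b, (2 : ℝ) • (Ω e a • ρ b c d) = -(2 : ℝ) • (Ω a e • ρ b c d) :=
        fun a b => by rw [e1]; module
      simp only [ricciTensor, e6, contract_add, contract_sub, contract_smul, e2, e3, hD]
      module
    rw [hb, hb'] at hc
    have h2 : (2 : ℝ) • ((m : ℝ) • ρ e c d - ρ c e d - ρ d e c) =
        (2 : ℝ) • (Ω e c • D d + Ω e d • D c) := by
      linear_combination (norm := module) hc
    exact smul_right_injective M (two_ne_zero (α := ℝ)) h2
  -- In the cyclic sum of `h1` the right-hand sides cancel by skewness of Ω, leaving m - 2 times the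
  -- cyclic sum of ρ. Adding it back to `h1` turns the coefficient m into m + 1.
  have hcyc : ∀ e c d, ρ e c d + ρ c e d + ρ d e c = 0 := by
    intro e c d
    have h2 := h1 e c d
    have h3 := h1 c e d
    have h4 := h1 d e c
    rw [hρ d c e, skew_apply hskew c e] at h3
    rw [hρ e d c, hρ c d e, skew_apply hskew d e, skew_apply hskew d c] at h4
    have h5 : ((m : ℝ) - 2) • (ρ e c d + ρ c e d + ρ d e c) = 0 := by
      linear_combination (norm := module) h2 + h3 + h4
    have hm2 : (m : ℝ) - 2 ≠ 0 := by
      have : (3 : ℝ) ≤ m := by exact_mod_cast hm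
      linarith
    exact (smul_eq_zero.1 h5).resolve_left hm2
  have hm1 : (m : ℝ) + 1 ≠ 0 := by positivity
  refine ⟨fun d => ((m : ℝ) + 1)⁻¹ • D d, fun e c d => ?_⟩
  refine smul_right_injective M hm1 ?_
  have h2 : ((m : ℝ) + 1) • ρ e c d = Ω e c • D d + Ω e d • D c := by
    linear_combination (norm := module) h1 e c d + hcyc e c d
  simp only [h2, smul_add, smul_comm ((m : ℝ) + 1), inv_smul_smul₀ hm1]

/-- Contraction over e and c gives m v_fd = Ω_fd times the contraction of v. The hypothesis is the
commutation of the second derivatives of r, with v_fd = ∂_f u_d. -/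
theorem exists_of_symmetric (hm : m ≠ 0) (hskew : Ω.transpose = -Ω) (hdet : IsUnit Ω.det)
    {v : Fin m → Fin m → M}
    (h : ∀ e f c d, Ω e c • v f d + Ω e d • v f c = Ω f c • v e d + Ω f d • v e c) :
    ∃ φ : M, ∀ f d, v f d = Ω f d • φ := by
  have hm' : (m : ℝ) ≠ 0 := Nat.cast_ne_zero.2 hm
  refine ⟨(m : ℝ)⁻¹ • contract Ω fun e c => v e c, fun f d => ?_⟩
  have h1 : contract Ω (fun e c => Ω e c • v f d + Ω e d • v f c) =
      contract Ω (fun e c => Ω f c • v e d + Ω f d • v e c) := by simp only [h]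
  have e1 : ∀ e c, Ω f c • v e d = (-1 : ℝ) • (Ω c f • v e d) := fun e c => by
    rw [skew_apply hskew f c]; module
  simp only [e1, contract_add, contract_smul, contract_self hdet,
    contract_first hdet d (fun c => v f c), contract_second hskew hdet f (fun e => v e d)] at h1
  refine smul_right_injective M hm' ?_
  simp only [smul_comm (m : ℝ), inv_smul_smul₀ hm']
  linear_combination (norm := module) h1

/-- Contraction over f and d gives m g_e = g_e. It is applied to the gradient of φ, the hypothesis
being the commutation of the second derivatives of u. -/
theorem eq_zero_of_symmetric (hm : 2 ≤ m) (hskew : Ω.transpose = -Ω) (hdet : IsUnit Ω.det)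
    {g : Fin m → M} (h : ∀ e f d, Ω f d • g e = Ω e d • g f) (e : Fin m) : g e = 0 := by
  have h1 : contract Ω (fun f d => Ω f d • g e) = contract Ω (fun f d => Ω e d • g f) := by
    simp only [h]
  have e1 : ∀ f d, Ω e d • g f = (-1 : ℝ) • (Ω d e • g f) := fun f d => by
    rw [skew_apply hskew e d]; module
  simp only [e1, contract_smul, contract_self hdet, contract_second hskew hdet e g] at h1
  have h2 : ((m : ℝ) - 1) • g e = 0 := by
    linear_combination (norm := module) h1
  have hm2 : (m : ℝ) - 1 ≠ 0 := by
    have : (2 : ℝ) ≤ m := by exact_mod_cast hm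
    linarith
  exact (smul_eq_zero.1 h2).resolve_left hm2

end Contraction

/-! ### The linearised Ricci-type equation -/

/-- A symmetric tensor whose differential vanishes is the sum of a constant one and of a third
derivative. -/
theorem exists_potential {B : Fin m → Fin m → Fin m → Fn m} (h12 : ∀ a b c, B a b c = B b a c)
    (h23 : ∀ a b c, B a b c = B a c b)
    (hB : ∀ a b c d, partialFn a (B b c d) = partialFn b (B a c d)) :
    ∃ h : Fn m, ∀ a b c, B a b c = algebraMap ℝ (Fn m) (mean (B a b c)) +
      partialFn a (partialFn b (partialFn c h)) := by
  -- Three successive primitives. Each is taken with mean zero, so that the symmetry of B descends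
  -- and no constant term appears after the first integration.
  choose H hH0 hH using fun c d => exists_primitive (fun b => B b c d) fun a b => hB a b c d
  have hsymm : ∀ c d, H c d = H d c := fun c d => by
    refine sub_eq_zero.1 (eq_zero_of_partialFn_eq_zero (fun b => ?_) ?_)
    · have h1 := hH c d b
      have h2 := hH d c b
      rw [h23 b d c] at h2
      rw [map_sub, ← add_sub_add_left_eq_sub _ _ (algebraMap ℝ (Fn m) (mean (B b c d))), ← h1,
        ← h2, sub_self]
    · rw [map_sub, hH0, hH0, sub_self]
  have hcl : ∀ b c d, partialFn b (H c d) = partialFn c (H b d) := fun b c d => by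
    have h1 := hH c d b
    have h2 := hH b d c
    rw [h12 c b d] at h2
    exact add_left_cancel (h1.symm.trans h2)
  choose G hG0 hG using fun d => exists_primitive (fun c => H c d) fun a b => hcl a b d
  simp only [hH0, map_zero, zero_add] at hG
  obtain ⟨h, -, hh⟩ := exists_primitive G fun a b => by rw [← hG, ← hG, hsymm]
  refine ⟨h, fun a b c => ?_⟩
  simp only [hG0, map_zero, zero_add] at hh
  rw [← hh, ← hG, ← hH]

/-- If the differential of a symmetric tensor is of Ricci type up to a constant, then the
tensor is the sum of a constant one and of a third derivative. -/
theorem exists_potential_of_ricci {Ω : Matrix (Fin m) (Fin m) ℝ} (hm : 3 ≤ m)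
    (hskew : Ω.transpose = -Ω) (hdet : IsUnit Ω.det) {B : Fin m → Fin m → Fin m → Fn m}
    (h12 : ∀ a b c, B a b c = B b a c) (h23 : ∀ a b c, B a b c = B a c b)
    {r : Fin m → Fin m → Fn m} (hr : ∀ c d, r c d = r d c) {Q : Fin m → Fin m → Fin m → Fin m → ℝ}
    (h : ∀ a b c d, partialFn a (B b c d) - partialFn b (B a c d) +
      algebraMap ℝ (Fn m) (Q a b c d) = ricciTensor Ω r a b c d) :
    ∃ h : Fn m, ∀ a b c, B a b c = algebraMap ℝ (Fn m) (mean (B a b c)) +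
      partialFn a (partialFn b (partialFn c h)) := by
  have hE : ∀ e a b c d, partialFn e (ricciTensor Ω r a b c d) =
      ricciTensor Ω (fun c d => partialFn e (r c d)) a b c d := fun e a b c d => by
    simp only [ricciTensor, map_add, map_sub, Derivation.map_smul]
  -- Differentiating kills the constants Q, and the cyclic sum of the derivatives of an exact form
  -- vanishes: this is the Bianchi identity required.
  obtain ⟨u, hu⟩ := exists_of_bianchi hm hskew hdet (ρ := fun e c d => partialFn e (r c d))
    (fun e c d => by rw [hr]) fun e a b c d => by
      simp only [← hE, ← h, map_add, map_sub, partialFn_algebraMap]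
      rw [partialFn_comm e a, partialFn_comm e b, partialFn_comm a b]
      abel
  have hv : ∀ e f c d, Ω e c • partialFn f (u d) + Ω e d • partialFn f (u c) =
      Ω f c • partialFn e (u d) + Ω f d • partialFn e (u c) := fun e f c d => by
    have := partialFn_comm f e (r c d)
    rw [hu, hu] at this
    simpa only [map_add, Derivation.map_smul] using this
  obtain ⟨φ, hφ⟩ := exists_of_symmetric (by omega) hskew hdet hv
  have hφ0 : ∀ e, partialFn e φ = 0 := fun e =>
    eq_zero_of_symmetric (by omega) hskew hdet (g := fun e => partialFn e φ) (fun e f d => by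
      have := partialFn_comm e f (u d)
      rw [hφ, hφ] at this
      simpa only [Derivation.map_smul] using this) e
  -- Going back up from the constant φ: each object has constant derivatives, and by periodicity
  -- these constants are zero.
  have hu0 : ∀ f d, partialFn f (u d) = 0 := fun f d =>
    partialFn_eq_zero_of_partialFn_partialFn fun e => by
      rw [hφ, Derivation.map_smul, hφ0, smul_zero]
  have hr0 : ∀ e c d, partialFn e (r c d) = 0 := fun e c d =>
    partialFn_eq_zero_of_partialFn_partialFn fun f => by
      rw [hu, map_add, Derivation.map_smul, Derivation.map_smul, hu0, hu0]
      simp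
  -- With r constant the differential of B is constant; being a combination of derivatives it has
  -- mean zero, so it vanishes.
  refine exists_potential h12 h23 fun a b c d => ?_
  refine sub_eq_zero.1 (eq_zero_of_partialFn_eq_zero (fun e => ?_) ?_)
  · have := congrArg (partialFn e) (h a b c d)
    rw [hE, map_add, partialFn_algebraMap, add_zero] at this
    rw [this]
    simp [ricciTensor, hr0]
  · rw [map_sub, mean_partialFn, mean_partialFn, sub_self]

/-! ### Curvature of Ricci type, with an unspecified Ricci tensor -/

/-- A formal curve of symplectic connections starting with the standard flat one, whose curvature
is built in the Ricci-type way from some tensor. -/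
structure IsRicciLike (Ω : Matrix (Fin m) (Fin m) ℝ)
    (D : FormalVF m → FormalVF m → FormalVF m) : Prop extends IsSymplecticConnection Ω D where
  starts : StartsAtStandardFlat D
  exists_ricci : ∃ r : FormalVF m → FormalVF m → FormalFn m, ∀ X Y Z T,
    omega Ω (curvature D X Y Z) T =
      2 * (omega Ω X Y * r Z T) + omega Ω X Z * r Y T + omega Ω X T * r Y Z
        - omega Ω Y Z * r X T - omega Ω Y T * r X Z

/-- The normalising constant is absorbed into the tensor. Forgetting that this tensor is a trace of
the curvature makes the condition visibly invariant under automorphisms. -/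
theorem isRicciLike_of_mem {n : ℕ} {Ω : Matrix (Fin (2 * n)) (Fin (2 * n)) ℝ}
    {D : FormalVF (2 * n) → FormalVF (2 * n) → FormalVF (2 * n)} (h : D ∈ ricciCurves Ω) :
    IsRicciLike Ω D :=
  { h.1 with
    starts := h.2.2
    exists_ricci := ⟨fun X Y => (-1 / (2 * ((n : ℝ) + 1))) • ricci D X Y, fun X Y Z T => by
      rw [h.2.1, ricciPart]
      simp only [smul_add, smul_sub, mul_smul_comm]⟩ }

theorem omega_skew {Ω : Matrix (Fin m) (Fin m) ℝ} (hskew : Ω.transpose = -Ω) (X Y : FormalVF m) :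
    omega Ω X Y = -omega Ω Y X := by
  rw [omega, omega, Finset.sum_comm, ← Finset.sum_neg_distrib]
  refine Finset.sum_congr rfl fun a _ => ?_
  rw [← Finset.sum_neg_distrib]
  refine Finset.sum_congr rfl fun b _ => ?_
  rw [skew_apply hskew b a, neg_smul, mul_comm]

theorem omega_sub_left (Ω : Matrix (Fin m) (Fin m) ℝ) (X X' Y : FormalVF m) :
    omega Ω (X - X') Y = omega Ω X Y - omega Ω X' Y := by
  simp only [omega, dx_sub, sub_mul, smul_sub, Finset.sum_sub_distrib]

theorem dx_eq_of_omega {Ω : Matrix (Fin m) (Fin m) ℝ} (hdet : IsUnit Ω.det) (X : FormalVF m)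
    (d : Fin m) : dx d X = ∑ c, Ω⁻¹ c d • omega Ω X (frame c) := by
  have h := sum_mul_inv hdet
  simp only [omega_frame_right, Finset.smul_sum, smul_smul]
  rw [Finset.sum_comm]
  simp only [← Finset.sum_smul, mul_comm (Ω⁻¹ _ _), h]
  simp

/-- All coefficients of degree less than `k` are constant functions. -/
def ConstBelow (k : ℕ) (F : FormalFn m) : Prop :=
  ∀ j < k, ∀ a, partialFn a (PowerSeries.coeff j F) = 0

/-- Neither factor has a term of degree 0, so the coefficient of degree k only involves coefficients
of degree strictly between 0 and k. -/
theorem ConstBelow.partialFn_coeff_mul {k : ℕ} {F G : FormalFn m} (hF : ConstBelow k F)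
    (hG : ConstBelow k G) (hF0 : PowerSeries.constantCoeff F = 0)
    (hG0 : PowerSeries.constantCoeff G = 0) (a : Fin m) :
    partialFn a (PowerSeries.coeff k (F * G)) = 0 := by
  rw [PowerSeries.coeff_mul, map_sum]
  refine Finset.sum_eq_zero fun p hp => ?_
  rw [Finset.HasAntidiagonal.mem_antidiagonal] at hp
  rw [← PowerSeries.coeff_zero_eq_constantCoeff_apply] at hF0 hG0
  by_cases h1 : p.1 = 0
  · rw [h1, hF0, zero_mul, map_zero]
  by_cases h2 : p.2 = 0
  · rw [h2, hG0, mul_zero, map_zero]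
  rw [Derivation.leibniz, hF _ (by omega), hG _ (by omega), smul_zero, smul_zero, add_zero]

namespace IsSymplecticConnection

variable {Ω : Matrix (Fin m) (Fin m) ℝ} {D : FormalVF m → FormalVF m → FormalVF m}

theorem frame_symm (h : IsSymplecticConnection Ω D) (a b : Fin m) :
    D (frame a) (frame b) = D (frame b) (frame a) := by
  refine formalVF_ext_dx fun c => sub_eq_zero.1 ?_
  rw [← dx_sub, h.torsion_free, lie_frame, dx_zero]

theorem lowered_symm (h : IsSymplecticConnection Ω D) (hskew : Ω.transpose = -Ω)
    (a b c : Fin m) : omega Ω (D (frame a) (frame b)) (frame c) =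
      omega Ω (D (frame a) (frame c)) (frame b) := by
  have h1 := h.parallel (frame a) (frame b) (frame c)
  rw [omega_frame, Derivation.map_algebraMap, omega_skew hskew (frame b)] at h1
  linear_combination -h1

/-- Parallelism of ω moves the outer covariant derivative off the first argument. The linear part is
then the differential of the lowered symbols, and the rest is quadratic in them. -/
theorem omega_curvature (h : IsSymplecticConnection Ω D) (a b c d : Fin m) :
    omega Ω (curvature D (frame a) (frame b) (frame c)) (frame d) =
      frame a (omega Ω (D (frame b) (frame c)) (frame d)) -
        frame b (omega Ω (D (frame a) (frame c)) (frame d)) +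
      (omega Ω (D (frame a) (frame c)) (D (frame b) (frame d)) -
        omega Ω (D (frame b) (frame c)) (D (frame a) (frame d))) := by
  rw [curvature, lie_frame, h.zero_left, omega_sub_left, omega_sub_left, omega_zero_left,
    h.parallel, h.parallel]
  ring

end IsSymplecticConnection

namespace IsRicciLike

variable {Ω : Matrix (Fin m) (Fin m) ℝ} {D : FormalVF m → FormalVF m → FormalVF m}

theorem constantCoeff_dx (h : IsRicciLike Ω D) (a b c : Fin m) :
    PowerSeries.constantCoeff (dx c (D (frame a) (frame b))) = 0 := by
  have h1 : ∀ X : FormalVF m, PowerSeries.constantCoeff (dx c X) = (2 * Real.pi)⁻¹ •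
      (cosFn c * PowerSeries.constantCoeff (X (PowerSeries.C (sinFn c))) -
        sinFn c * PowerSeries.constantCoeff (X (PowerSeries.C (cosFn c)))) := fun X => by
    simpa using coeff_dx c X 0
  have h2 : dx c (standardFlat (frame a) (frame b)) = 0 := by
    rw [dx_standardFlat, dx_frame]
    split_ifs <;> simp
  rw [h1, h.starts, h.starts, ← h1, h2, map_zero]

/-- In the invariant frame, the curvature is of Ricci type for a symmetric tensor. -/
theorem exists_ricci_frame (h : IsRicciLike Ω D) (hm : m ≠ 0) (hskew : Ω.transpose = -Ω)
    (hdet : IsUnit Ω.det) : ∃ r : Fin m → Fin m → FormalFn m, (∀ c d, r c d = r d c) ∧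
      ∀ a b c d, omega Ω (curvature D (frame a) (frame b) (frame c)) (frame d) =
        ricciTensor Ω r a b c d := by
  obtain ⟨r, hr⟩ := h.exists_ricci
  have hE : ∀ a b c d, omega Ω (curvature D (frame a) (frame b) (frame c)) (frame d) =
      ricciTensor Ω (fun c d => r (frame c) (frame d)) a b c d := fun a b c d => by
    rw [hr]
    simp only [omega_frame, ricciTensor, ← C_algebraMap, ← real_smul_formalFn, two_mul, two_smul]
  refine ⟨fun c d => r (frame c) (frame d), fun c d => ?_, hE⟩
  -- The curvature has values in sp, hence is symmetric in c and d. In the difference of the two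
  -- Ricci-type expressions only the term with Ω_ab survives.
  have hs : ∀ a b, (2 : ℝ) • (Ω a b • (r (frame c) (frame d) - r (frame d) (frame c))) = 0 := by
    intro a b
    have h1 := hE a b c d
    have h2 := hE a b d c
    rw [h.omega_curvature] at h1 h2
    rw [h.lowered_symm hskew b d c, h.lowered_symm hskew a d c,
      omega_skew hskew (D (frame a) (frame d)), omega_skew hskew (D (frame b) (frame d))] at h2
    simp only [ricciTensor, two_smul] at h1 h2
    rw [two_smul, smul_sub]
    linear_combination h2 - h1
  have h3 : contract Ω (fun a b => (2 : ℝ) • (Ω a b • (r (frame c) (frame d) -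
      r (frame d) (frame c)))) = 0 := by simp only [hs, contract_zero]
  rw [contract_smul, contract_self hdet, smul_eq_zero, smul_eq_zero] at h3
  rcases h3 with h3 | h3 | h3
  · norm_num at h3
  · exact absurd h3 (Nat.cast_ne_zero.2 hm)
  · exact sub_eq_zero.1 h3

/-- The quadratic part of the curvature is constant in degree k, so the coefficient of degree k
satisfies the linearised equation of `exists_potential_of_ricci`. The sign of the potential is the
one wanted for the Hamiltonian of the correcting symplectomorphism. -/
theorem exists_potential_coeff (h : IsRicciLike Ω D) (hm : 3 ≤ m) (hskew : Ω.transpose = -Ω)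
    (hdet : IsUnit Ω.det) {k : ℕ}
    (hk : ∀ a b c, ConstBelow k (dx c (D (frame a) (frame b)))) :
    ∃ f : Fn m, ∀ a b c e, partialFn e (PowerSeries.coeff k
      (omega Ω (D (frame a) (frame b)) (frame c)) + partialFn a (partialFn b (partialFn c f))) =
        0 := by
  obtain ⟨r, hr, hE⟩ := h.exists_ricci_frame (by omega) hskew hdet
  have hq : ∀ a b c d, ∃ q : ℝ, PowerSeries.coeff k
      (omega Ω (D (frame a) (frame c)) (D (frame b) (frame d)) -
        omega Ω (D (frame b) (frame c)) (D (frame a) (frame d))) = algebraMap ℝ (Fn m) q := by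
    intro a b c d
    refine exists_eq_algebraMap fun e => ?_
    have hω : ∀ a b c d, partialFn e (PowerSeries.coeff k
        (omega Ω (D (frame a) (frame c)) (D (frame b) (frame d)))) = 0 := fun a b c d => by
      simp only [omega, map_sum, coeff_real_smul, Derivation.map_smul]
      refine Finset.sum_eq_zero fun x _ => Finset.sum_eq_zero fun y _ => ?_
      rw [(hk a c x).partialFn_coeff_mul (hk b d y) (h.constantCoeff_dx _ _ _)
        (h.constantCoeff_dx _ _ _), smul_zero]
    rw [map_sub, map_sub, hω, hω, sub_self]
  choose Q hQ using hq
  obtain ⟨f, hf⟩ := exists_potential_of_ricci hm hskew hdet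
    (B := fun a b c => PowerSeries.coeff k (omega Ω (D (frame a) (frame b)) (frame c)))
    (fun a b c => by rw [h.frame_symm]) (fun a b c => by rw [h.lowered_symm hskew])
    (r := fun c d => PowerSeries.coeff k (r c d)) (fun c d => by rw [hr]) (Q := Q)
    (fun a b c d => by
      have := congrArg (PowerSeries.coeff k) (hE a b c d)
      rw [h.omega_curvature, map_add, map_sub, hQ, coeff_frame, coeff_frame] at this
      rw [this]
      simp only [ricciTensor, map_add, map_sub, coeff_real_smul])
  refine ⟨-f, fun a b c e => ?_⟩
  have := hf a b c
  rw [this]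
  simp only [map_neg, map_add, partialFn_algebraMap, zero_add]
  simp

end IsRicciLike

theorem sum_exchange {ι M : Type*} [Fintype ι] [AddCommMonoid M] (f : ι → ι → ι → ι → M) :
    ∑ a, ∑ b, ∑ x, ∑ y, f a b x y = ∑ x, ∑ y, ∑ a, ∑ b, f a b x y := by
  rw [sum_rotate fun x a b => ∑ y, f a b x y]
  exact Finset.sum_congr rfl fun x _ => sum_rotate fun y a b => f a b x y

/-! ### The action of automorphisms -/

section Action

variable (Φ : FormalFn m ≃ₐ[ℝ⟦X⟧] FormalFn m)

theorem actVF_apply (X : FormalVF m) (F : FormalFn m) : actVF Φ X F = Φ (X (Φ.symm F)) := rfl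

@[simp] theorem actVF_symm_actVF (X : FormalVF m) : actVF Φ.symm (actVF Φ X) = X := by
  ext1 F
  simp [actVF_apply]

@[simp] theorem actVF_actVF_symm (X : FormalVF m) : actVF Φ (actVF Φ.symm X) = X := by
  ext1 F
  simp [actVF_apply]

theorem actVF_add (X Y : FormalVF m) : actVF Φ (X + Y) = actVF Φ X + actVF Φ Y := by
  ext1 F
  simp [actVF_apply]

theorem actVF_sub (X Y : FormalVF m) : actVF Φ (X - Y) = actVF Φ X - actVF Φ Y := by
  ext1 F
  simp only [actVF_apply, formalVF_sub_apply, map_sub]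

theorem actVF_smul (F : FormalFn m) (X : FormalVF m) :
    actVF Φ (F • X) = Φ F • actVF Φ X := by
  ext1 G
  simp [actVF_apply]

theorem actVF_sum {ι : Type*} (s : Finset ι) (X : ι → FormalVF m) :
    actVF Φ (∑ i ∈ s, X i) = ∑ i ∈ s, actVF Φ (X i) := by
  ext1 F
  simp [actVF_apply]

theorem actVF_lie (X Y : FormalVF m) : actVF Φ ⁅X, Y⁆ = ⁅actVF Φ X, actVF Φ Y⁆ := by
  ext1 F
  simp [actVF_apply, formalVF_lie_apply]

theorem actConn_actVF (D : FormalVF m → FormalVF m → FormalVF m) (X Y : FormalVF m) :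
    actConn Φ D (actVF Φ X) (actVF Φ Y) = actVF Φ (D X Y) := by
  simp [actConn]

theorem IsConnection.actConn {D : FormalVF m → FormalVF m → FormalVF m} (hD : IsConnection D) :
    IsConnection (actConn Φ D) where
  add_left X X' Y := by simp only [RicciTorus.actConn, actVF_add, hD.add_left]
  smul_left F X Y := by
    simp only [RicciTorus.actConn, actVF_smul, hD.smul_left, AlgEquiv.apply_symm_apply]
  add_right X Y Y' := by simp only [RicciTorus.actConn, actVF_add, hD.add_right]
  leibniz F X Y := by
    simp only [RicciTorus.actConn, actVF_smul, actVF_add, hD.leibniz, AlgEquiv.apply_symm_apply,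
      actVF_actVF_symm]
    congr 2
    simp [actVF_apply]

theorem actConn_eq_of_frame {D D' : FormalVF m → FormalVF m → FormalVF m} (hD : IsConnection D)
    (hD' : IsConnection D')
    (h : ∀ a b, D' (actVF Φ (frame a)) (actVF Φ (frame b)) = actVF Φ (D (frame a) (frame b))) :
    actConn Φ D = D' := by
  have h1 : D = actConn Φ.symm D' := hD.ext_frame (hD'.actConn Φ.symm) fun a b => by
    rw [actConn, AlgEquiv.symm_symm, h, actVF_symm_actVF]
  rw [h1, actConn_trans, AlgEquiv.symm_trans_self, actConn_refl]

theorem curvature_actConn (D : FormalVF m → FormalVF m → FormalVF m) (X Y Z : FormalVF m) :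
    curvature (actConn Φ D) (actVF Φ X) (actVF Φ Y) (actVF Φ Z) = actVF Φ (curvature D X Y Z) := by
  simp only [curvature, actConn_actVF, ← actVF_lie, ← actVF_sub]

/-- The matrix of `Φ · ∂_a` in the invariant frame. -/
def jacobian : Matrix (Fin m) (Fin m) (FormalFn m) :=
  Matrix.of fun a c => dx c (actVF Φ (frame a))

/-- The matrix expressing the invariant frame in the frame `Φ · ∂_a`. -/
def coJacobian : Matrix (Fin m) (Fin m) (FormalFn m) :=
  Matrix.of fun a c => Φ (dx c (actVF Φ.symm (frame a)))

theorem actVF_frame (a : Fin m) : actVF Φ (frame a) = ∑ c, jacobian Φ a c • frame c :=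
  eq_sum_dx_frame _

theorem frame_eq_sum_actVF (a : Fin m) :
    frame a = ∑ c, coJacobian Φ a c • actVF Φ (frame c) := by
  conv_lhs => rw [← actVF_actVF_symm Φ (frame a), eq_sum_dx_frame (actVF Φ.symm (frame a)),
    actVF_sum]
  simp only [actVF_smul]
  rfl

theorem frame_apply_map (a : Fin m) (F : FormalFn m) :
    frame a (Φ F) = ∑ c, coJacobian Φ a c * Φ (frame c F) := by
  conv_lhs => rw [frame_eq_sum_actVF Φ a]
  simp [actVF_apply]

theorem coJacobian_mul_jacobian : coJacobian Φ * jacobian Φ = 1 := by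
  ext1 a d
  have h := congrArg (dx d) (frame_eq_sum_actVF Φ a)
  rw [Matrix.mul_apply, Matrix.one_apply]
  simp only [dx_frame, dx_sum, dx_smul] at h
  simp only [eq_comm (a := a)]
  exact h.symm

theorem jacobian_mul_coJacobian : jacobian Φ * coJacobian Φ = 1 :=
  mul_eq_one_comm.1 (coJacobian_mul_jacobian Φ)

/-- The images of the frame under Φ are linearly independent: the coefficients, pulled back by the
inverse of Φ, are those of a vanishing vector field. -/
theorem eq_zero_of_sum_mul_map_frame {M : Fin m → FormalFn m}
    (h : ∀ F, ∑ x, M x * Φ (frame x F) = 0) (x : Fin m) : M x = 0 := by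
  have hY : (∑ x, Φ.symm (M x) • frame x : FormalVF m) = 0 := by
    ext1 F
    apply Φ.injective
    simpa using h F
  have h1 := congrArg (dx x) hY
  simpa using h1

/-! ### Automorphisms preserving the Poisson bracket preserve ω -/

theorem extendBilin_bracket (Ω : Matrix (Fin m) (Fin m) ℝ) (F G : FormalFn m) :
    extendBilin (bracket Ω) F G = ∑ a, ∑ b, Ω⁻¹ a b • (frame a F * frame b G) := by
  ext1 k
  rw [extendBilin, PowerSeries.coeff_mk]
  simp only [map_sum, coeff_real_smul, PowerSeries.coeff_mul, bracket_apply, coeff_frame,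
    Finset.smul_sum]
  rw [Finset.sum_comm]
  refine Finset.sum_congr rfl fun a _ => ?_
  rw [Finset.sum_comm]

/-- The matrix `Ω` with coefficients in the algebra of formal functions. -/
def formalMatrix (Ω : Matrix (Fin m) (Fin m) ℝ) : Matrix (Fin m) (Fin m) (FormalFn m) :=
  Ω.map ((algebraMap ℝ⟦X⟧ (FormalFn m)).comp PowerSeries.C)

theorem formalMatrix_apply (Ω : Matrix (Fin m) (Fin m) ℝ) (a b : Fin m) :
    formalMatrix Ω a b = algebraMap ℝ⟦X⟧ (FormalFn m) (PowerSeries.C (Ω a b)) := rfl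

theorem formalMatrix_mul (Ω Ω' : Matrix (Fin m) (Fin m) ℝ) :
    formalMatrix (Ω * Ω') = formalMatrix Ω * formalMatrix Ω' := Matrix.map_mul

theorem formalMatrix_one : formalMatrix (1 : Matrix (Fin m) (Fin m) ℝ) = 1 :=
  Matrix.map_one _ (map_zero _) (map_one _)

theorem real_smul_eq (c : ℝ) (F : FormalFn m) :
    c • F = algebraMap ℝ⟦X⟧ (FormalFn m) (PowerSeries.C c) * F := by
  rw [real_smul_formalFn, C_algebraMap]

variable {Φ} {Ω : Matrix (Fin m) (Fin m) ℝ}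
  (hΦ : ∀ F G, Φ (extendBilin (bracket Ω) F G) = extendBilin (bracket Ω) (Φ F) (Φ G))

include hΦ

/-- Expand Φ of the bracket of F and G, and the bracket of ΦF and ΦG, in the derivatives of F and G.
Both being arbitrary, independence of the transported frame can be applied twice to compare
coefficients. -/
theorem coJacobian_symplectic :
    (coJacobian Φ).transpose * formalMatrix Ω⁻¹ * coJacobian Φ = formalMatrix Ω⁻¹ := by
  set N := (coJacobian Φ).transpose * formalMatrix Ω⁻¹ * coJacobian Φ - formalMatrix Ω⁻¹ with hN
  have hNa : ∀ x y, N x y = ∑ a, ∑ b, Ω⁻¹ a b • (coJacobian Φ a x * coJacobian Φ b y) -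
      algebraMap ℝ⟦X⟧ (FormalFn m) (PowerSeries.C (Ω⁻¹ x y)) := fun x y => by
    rw [hN, Matrix.sub_apply, formalMatrix_apply, Matrix.mul_apply]
    simp only [Matrix.mul_apply, Matrix.transpose_apply, Finset.sum_mul, formalMatrix_apply,
      real_smul_eq]
    rw [Finset.sum_comm]
    congr 1
    exact Finset.sum_congr rfl fun a _ => Finset.sum_congr rfl fun b _ => by ring
  have key : ∀ F G, ∑ x, (∑ y, N x y * Φ (frame y G)) * Φ (frame x F) = 0 := by
    intro F G
    have h := hΦ F G
    rw [extendBilin_bracket, extendBilin_bracket] at h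
    have e1 : Φ (∑ a, ∑ b, Ω⁻¹ a b • (frame a F * frame b G)) = ∑ x, ∑ y,
        algebraMap ℝ⟦X⟧ (FormalFn m) (PowerSeries.C (Ω⁻¹ x y)) *
          (Φ (frame x F) * Φ (frame y G)) := by
      simp only [map_sum, real_smul_eq, map_mul, AlgEquiv.commutes]
    have e2 : ∑ a, ∑ b, Ω⁻¹ a b • (frame a (Φ F) * frame b (Φ G)) = ∑ x, ∑ y,
        (∑ a, ∑ b, Ω⁻¹ a b • (coJacobian Φ a x * coJacobian Φ b y)) *
          (Φ (frame x F) * Φ (frame y G)) := by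
      simp only [frame_apply_map, Finset.sum_mul_sum, Finset.smul_sum]
      rw [sum_exchange]
      simp only [Finset.sum_mul]
      refine Finset.sum_congr rfl fun x _ => Finset.sum_congr rfl fun y _ =>
        Finset.sum_congr rfl fun a _ => Finset.sum_congr rfl fun b _ => ?_
      rw [smul_mul_assoc]
      congr 1
      ring
    rw [e1, e2] at h
    rw [← sub_eq_zero.2 h.symm, ← Finset.sum_sub_distrib]
    refine Finset.sum_congr rfl fun x _ => ?_
    rw [← Finset.sum_sub_distrib, Finset.sum_mul]
    refine Finset.sum_congr rfl fun y _ => ?_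
    rw [hNa]
    ring
  have h1 : ∀ x G, ∑ y, N x y * Φ (frame y G) = 0 := fun x G =>
    eq_zero_of_sum_mul_map_frame Φ (fun F => key F G) x
  refine sub_eq_zero.1 (hN.symm.trans ?_)
  ext1 x y
  exact eq_zero_of_sum_mul_map_frame Φ (h1 x) y

theorem jacobian_symplectic (hdet : IsUnit Ω.det) :
    jacobian Φ * formalMatrix Ω * (jacobian Φ).transpose = formalMatrix Ω := by
  have hKJ := coJacobian_mul_jacobian Φ
  have hPO : formalMatrix Ω⁻¹ * formalMatrix Ω = 1 := by
    rw [← formalMatrix_mul, Matrix.nonsing_inv_mul _ hdet, formalMatrix_one]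
  have hOP : formalMatrix Ω * formalMatrix Ω⁻¹ = 1 := by
    rw [← formalMatrix_mul, Matrix.mul_nonsing_inv _ hdet, formalMatrix_one]
  have h1 : (jacobian Φ).transpose * formalMatrix Ω⁻¹ * jacobian Φ = formalMatrix Ω⁻¹ := by
    have hJK : (jacobian Φ).transpose * (coJacobian Φ).transpose = 1 := by
      rw [← Matrix.transpose_mul, hKJ, Matrix.transpose_one]
    calc (jacobian Φ).transpose * formalMatrix Ω⁻¹ * jacobian Φ
        = ((jacobian Φ).transpose * (coJacobian Φ).transpose) * formalMatrix Ω⁻¹ *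
          (coJacobian Φ * jacobian Φ) := by
          conv_lhs => rw [← coJacobian_symplectic hΦ]
          simp only [Matrix.mul_assoc]
      _ = _ := by rw [hJK, hKJ, Matrix.one_mul, Matrix.mul_one]
  have h2 : jacobian Φ * (formalMatrix Ω * (jacobian Φ).transpose * formalMatrix Ω⁻¹) = 1 := by
    rw [mul_eq_one_comm]
    calc formalMatrix Ω * (jacobian Φ).transpose * formalMatrix Ω⁻¹ * jacobian Φ
        = formalMatrix Ω * ((jacobian Φ).transpose * formalMatrix Ω⁻¹ * jacobian Φ) := by
          simp only [Matrix.mul_assoc]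
      _ = 1 := by rw [h1, hOP]
  calc jacobian Φ * formalMatrix Ω * (jacobian Φ).transpose
      = jacobian Φ * (formalMatrix Ω * (jacobian Φ).transpose * formalMatrix Ω⁻¹) *
          formalMatrix Ω := by
        simp only [Matrix.mul_assoc, hPO, Matrix.mul_one]
    _ = _ := by rw [h2, Matrix.one_mul]

theorem omega_actVF (hdet : IsUnit Ω.det) (X Y : FormalVF m) :
    omega Ω (actVF Φ X) (actVF Φ Y) = Φ (omega Ω X Y) := by
  have hf : ∀ a b, omega Ω (actVF Φ (frame a)) (actVF Φ (frame b)) =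
      algebraMap ℝ⟦X⟧ (FormalFn m) (PowerSeries.C (Ω a b)) := fun a b => by
    have h := congrFun (congrFun (jacobian_symplectic hΦ hdet) a) b
    rw [formalMatrix_apply] at h
    rw [← h, Matrix.mul_apply]
    simp only [Matrix.mul_apply, Finset.sum_mul, Matrix.transpose_apply, formalMatrix_apply,
      omega, real_smul_eq]
    rw [Finset.sum_comm]
    refine Finset.sum_congr rfl fun c _ => Finset.sum_congr rfl fun d _ => ?_
    simp only [jacobian, Matrix.of_apply]
    ring
  conv_lhs => rw [eq_sum_dx_frame X, eq_sum_dx_frame Y, actVF_sum, actVF_sum, ← omegaBilin_apply]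
  simp only [actVF_smul, map_sum, map_smul, LinearMap.sum_apply, LinearMap.smul_apply,
    omegaBilin_apply, hf, smul_eq_mul]
  simp only [omega, map_sum, real_smul_eq, map_mul, AlgEquiv.commutes, Finset.mul_sum]
  rw [Finset.sum_comm]
  exact Finset.sum_congr rfl fun a _ => Finset.sum_congr rfl fun b _ => by ring

/-- Every clause is natural once Φ preserves ω, except the starting point, which is assumed: the
leading term of Φ may move the flat connection. -/
theorem IsRicciLike.actConn (hdet : IsUnit Ω.det) {D : FormalVF m → FormalVF m → FormalVF m}
    (hD : IsRicciLike Ω D) (hs : StartsAtStandardFlat (actConn Φ D)) :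
    IsRicciLike Ω (actConn Φ D) where
  toIsSymplecticConnection :=
    { hD.toIsConnection.actConn Φ with
      torsion_free := fun X Y => by
        rw [RicciTorus.actConn, RicciTorus.actConn, ← actVF_sub, hD.torsion_free, actVF_lie,
          actVF_actVF_symm, actVF_actVF_symm]
      parallel := fun X Y Z => by
        obtain ⟨X, rfl⟩ : ∃ X', actVF Φ X' = X := ⟨_, actVF_actVF_symm Φ X⟩
        obtain ⟨Y, rfl⟩ : ∃ X', actVF Φ X' = Y := ⟨_, actVF_actVF_symm Φ Y⟩
        obtain ⟨Z, rfl⟩ : ∃ X', actVF Φ X' = Z := ⟨_, actVF_actVF_symm Φ Z⟩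
        rw [actConn_actVF, actConn_actVF, omega_actVF hΦ hdet, omega_actVF hΦ hdet,
          omega_actVF hΦ hdet, actVF_apply, AlgEquiv.symm_apply_apply, hD.parallel, map_add] }
  starts := hs
  exists_ricci := by
    obtain ⟨r, hr⟩ := hD.exists_ricci
    refine ⟨fun X Y => Φ (r (actVF Φ.symm X) (actVF Φ.symm Y)), fun X Y Z T => ?_⟩
    obtain ⟨X, rfl⟩ : ∃ X', actVF Φ X' = X := ⟨_, actVF_actVF_symm Φ X⟩
    obtain ⟨Y, rfl⟩ : ∃ X', actVF Φ X' = Y := ⟨_, actVF_actVF_symm Φ Y⟩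
    obtain ⟨Z, rfl⟩ : ∃ X', actVF Φ X' = Z := ⟨_, actVF_actVF_symm Φ Z⟩
    obtain ⟨T, rfl⟩ : ∃ X', actVF Φ X' = T := ⟨_, actVF_actVF_symm Φ T⟩
    simp only [actVF_symm_actVF, curvature_actConn, omega_actVF hΦ hdet, hr, map_add, map_sub,
      map_mul, map_ofNat]

end Action

/-! ### Transformation of the Christoffel symbols -/

/-- The derivative of Φ·∂_b along ∂_a is computed in two ways, expanding either Φ·∂_b in the
invariant frame or ∂_a in the transported one. In this form no second derivative of Φ has to be
isolated. -/
theorem christoffel_actConn {D : FormalVF m → FormalVF m → FormalVF m} (hD : IsConnection D)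
    (Φ : FormalFn m ≃ₐ[ℝ⟦X⟧] FormalFn m) (a b c : Fin m) :
    frame a (jacobian Φ b c) +
        ∑ d, jacobian Φ b d * dx c (actConn Φ D (frame a) (frame d)) =
      ∑ e, ∑ f, coJacobian Φ a e * Φ (dx f (D (frame e) (frame b))) * jacobian Φ f c := by
  have hD' := hD.actConn Φ
  have h1 : dx c (actConn Φ D (frame a) (actVF Φ (frame b))) =
      frame a (jacobian Φ b c) +
        ∑ d, jacobian Φ b d * dx c (actConn Φ D (frame a) (frame d)) := by
    rw [actVF_frame, hD'.sum_right]
    simp only [hD'.leibniz, dx_sum, dx_add, dx_smul, dx_frame, Finset.sum_add_distrib]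
    simp
  have h2 : dx c (actConn Φ D (frame a) (actVF Φ (frame b))) =
      ∑ e, ∑ f, coJacobian Φ a e * Φ (dx f (D (frame e) (frame b))) * jacobian Φ f c := by
    conv_lhs => rw [frame_eq_sum_actVF Φ a]
    rw [hD'.sum_left]
    simp only [hD'.smul_left, actConn_actVF, dx_sum, dx_smul]
    refine Finset.sum_congr rfl fun e _ => ?_
    conv_lhs => rw [eq_sum_dx_frame (D (frame e) (frame b)), actVF_sum]
    simp only [actVF_smul, dx_sum, dx_smul, Finset.mul_sum, mul_assoc]
    rfl
  rw [← h1, h2]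

/-- `Φ` is the identity modulo `t^k`. -/
def CloseToId (k : ℕ) (Φ : FormalFn m ≃ₐ[ℝ⟦X⟧] FormalFn m) : Prop :=
  ∀ F, (PowerSeries.X : FormalFn m) ^ k ∣ Φ F - F

theorem dvd_frame {k : ℕ} {F : FormalFn m} (h : (PowerSeries.X : FormalFn m) ^ k ∣ F)
    (a : Fin m) : (PowerSeries.X : FormalFn m) ^ k ∣ frame a F := by
  rw [PowerSeries.X_pow_dvd_iff] at h ⊢
  intro j hj
  rw [coeff_frame, h j hj, map_zero]

namespace CloseToId

variable {k : ℕ} {Φ : FormalFn m ≃ₐ[ℝ⟦X⟧] FormalFn m}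

theorem symm (h : CloseToId k Φ) : CloseToId k Φ.symm := fun F => by
  have h1 := h (Φ.symm F)
  rw [AlgEquiv.apply_symm_apply] at h1
  rwa [dvd_sub_comm]

theorem jacobian (h : CloseToId k Φ) (a c : Fin m) :
    (PowerSeries.X : FormalFn m) ^ k ∣ RicciTorus.jacobian Φ a c - (1 : Matrix _ _ _) a c := by
  have h1 : ∀ F, (PowerSeries.X : FormalFn m) ^ k ∣ actVF Φ (frame a) F - frame a F := fun F => by
    have h2 := dvd_add (h (frame a (Φ.symm F))) (dvd_frame (h.symm F) a)
    rw [map_sub] at h2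
    rw [actVF_apply]
    convert h2 using 1
    ring
  have h2 : RicciTorus.jacobian Φ a c - (1 : Matrix _ _ _) a c =
      (2 * Real.pi)⁻¹ • (PowerSeries.C (cosFn c) * (actVF Φ (frame a) (PowerSeries.C (sinFn c)) -
        frame a (PowerSeries.C (sinFn c))) -
      PowerSeries.C (sinFn c) * (actVF Φ (frame a) (PowerSeries.C (cosFn c)) -
        frame a (PowerSeries.C (cosFn c)))) := by
    have h3 := dx_frame c a
    simp only [eq_comm (a := c)] at h3
    rw [Matrix.one_apply, ← h3, RicciTorus.jacobian, Matrix.of_apply, dx, dx, ← smul_sub]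
    congr 1
    ring
  rw [h2, real_smul_formalFn]
  exact ((((h1 _).mul_left _).sub ((h1 _).mul_left _))).mul_left _

theorem coJacobian (h : CloseToId k Φ) (a c : Fin m) :
    (PowerSeries.X : FormalFn m) ^ k ∣ RicciTorus.coJacobian Φ a c - (1 : Matrix _ _ _) a c := by
  have h1 := dvd_add (h (dx c (actVF Φ.symm (frame a)))) (h.symm.jacobian a c)
  simp only [RicciTorus.jacobian, RicciTorus.coJacobian, Matrix.of_apply] at h1 ⊢
  convert h1 using 1
  ring

/-- Since Φ commutes with multiplication by t, one order is gained on series without constant term.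
-/
theorem map (h : CloseToId k Φ) {F : FormalFn m} (hF : PowerSeries.X ∣ F) :
    PowerSeries.X ^ (k + 1) ∣ Φ F - F := by
  obtain ⟨G, rfl⟩ := hF
  rw [algEquiv_X_mul, ← mul_sub, pow_succ']
  exact mul_dvd_mul_left _ (h G)

/-- The effect on Christoffel symbols of an automorphism close to the identity. -/
theorem christoffel_sub {D : FormalVF m → FormalVF m → FormalVF m} (hD : IsConnection D)
    (h : CloseToId k Φ) (hk : k ≠ 0)
    (h0 : ∀ a b c, PowerSeries.X ∣ dx c (D (frame a) (frame b))) (a b c : Fin m) :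
    PowerSeries.X ^ (k + 1) ∣ dx c (actConn Φ D (frame a) (frame b)) -
      dx c (D (frame a) (frame b)) + frame a (RicciTorus.jacobian Φ b c) := by
  -- the error terms
  have main : ∀ a b c, dx c (actConn Φ D (frame a) (frame b)) - dx c (D (frame a) (frame b)) +
      frame a (RicciTorus.jacobian Φ b c) =
      (∑ e, ∑ f, ((RicciTorus.coJacobian Φ a e - (1 : Matrix _ _ _) a e) *
          Φ (dx f (D (frame e) (frame b))) * RicciTorus.jacobian Φ f c +
        (1 : Matrix _ _ _) a e * Φ (dx f (D (frame e) (frame b))) *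
          (RicciTorus.jacobian Φ f c - (1 : Matrix _ _ _) f c))) +
      (Φ (dx c (D (frame a) (frame b))) - dx c (D (frame a) (frame b))) -
      ∑ d, (RicciTorus.jacobian Φ b d - (1 : Matrix _ _ _) b d) *
        dx c (actConn Φ D (frame a) (frame d)) := by
    intro a b c
    have h1 := christoffel_actConn hD Φ a b c
    have h2 : ∑ d, (1 : Matrix _ _ _) b d * dx c (actConn Φ D (frame a) (frame d)) =
        dx c (actConn Φ D (frame a) (frame b)) := by simp [Matrix.one_apply]
    have h3 : ∑ e, ∑ f, (1 : Matrix _ _ _) a e * Φ (dx f (D (frame e) (frame b))) *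
        (1 : Matrix _ _ _) f c = Φ (dx c (D (frame a) (frame b))) := by simp [Matrix.one_apply]
    simp only [sub_mul, mul_sub, Finset.sum_sub_distrib, Finset.sum_add_distrib, h2, h3, ← h1]
    ring
  have hX : ∀ {n : ℕ}, n ≠ 0 → (PowerSeries.X : FormalFn m) ∣ PowerSeries.X ^ n := fun hn =>
    dvd_pow_self _ hn
  have hΦ0 : ∀ a b c, PowerSeries.X ∣ Φ (dx c (D (frame a) (frame b))) := fun a b c => by
    have h1 := dvd_add ((hX k.succ_ne_zero).trans (h.map (h0 a b c))) (h0 a b c)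
    rwa [sub_add_cancel] at h1
  have hd : ∀ a b c, PowerSeries.X ∣ frame a (RicciTorus.jacobian Φ b c) := fun a b c => by
    have h1 := dvd_frame ((h.jacobian b c)) a
    have h2 : frame a ((1 : Matrix (Fin m) (Fin m) (FormalFn m)) b c) = 0 := by
      rw [Matrix.one_apply]
      split_ifs <;> simp
    rw [map_sub, h2, sub_zero] at h1
    exact (hX hk).trans h1
  -- In the double sum each term pairs a deviation of order k with a symbol of order 1.
  have hE : ∀ a b c, PowerSeries.X ^ (k + 1) ∣
      (∑ e, ∑ f, ((RicciTorus.coJacobian Φ a e - (1 : Matrix _ _ _) a e) *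
          Φ (dx f (D (frame e) (frame b))) * RicciTorus.jacobian Φ f c +
        (1 : Matrix _ _ _) a e * Φ (dx f (D (frame e) (frame b))) *
          (RicciTorus.jacobian Φ f c - (1 : Matrix _ _ _) f c))) +
      (Φ (dx c (D (frame a) (frame b))) - dx c (D (frame a) (frame b))) := fun a b c => by
    refine dvd_add (Finset.dvd_sum fun e _ => Finset.dvd_sum fun f _ => dvd_add ?_ ?_)
      (h.map (h0 a b c))
    · rw [pow_succ]
      exact (mul_dvd_mul (h.coJacobian a e) (hΦ0 e b f)).mul_right _
    · rw [pow_succ', mul_assoc]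
      exact (mul_dvd_mul (hΦ0 e b f) (h.jacobian f c)).mul_left _
  -- The last sum of `main` contains the new symbols themselves. A first, coarse use of `main` shows
  -- that they have order 1; this is then fed back to reach order k + 1.
  have h0' : ∀ a b c, PowerSeries.X ∣ dx c (actConn Φ D (frame a) (frame b)) := fun a b c => by
    have h1 : PowerSeries.X ∣ dx c (actConn Φ D (frame a) (frame b)) -
        dx c (D (frame a) (frame b)) + frame a (RicciTorus.jacobian Φ b c) := by
      rw [main]
      exact dvd_sub ((hX k.succ_ne_zero).trans (hE a b c)) (Finset.dvd_sum fun d _ =>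
        ((hX hk).trans (h.jacobian b d)).mul_right _)
    have h2 := dvd_add (dvd_sub h1 (hd a b c)) (h0 a b c)
    convert h2 using 1
    ring
  rw [main]
  refine dvd_sub (hE a b c) (Finset.dvd_sum fun d _ => ?_)
  rw [pow_succ]
  exact mul_dvd_mul (h.jacobian b d) (h0' a d c)

theorem dvd_christoffel_sub {D : FormalVF m → FormalVF m → FormalVF m} (hD : IsConnection D)
    (h : CloseToId k Φ) (hk : k ≠ 0)
    (h0 : ∀ a b c, PowerSeries.X ∣ dx c (D (frame a) (frame b))) (a b c : Fin m) :
    PowerSeries.X ^ k ∣ dx c (actConn Φ D (frame a) (frame b)) - dx c (D (frame a) (frame b)) := by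
  have h1 := (pow_dvd_pow _ k.le_succ).trans (h.christoffel_sub hD hk h0 a b c)
  have h2 := dvd_frame ((h.jacobian b c)) a
  have h3 : frame a ((1 : Matrix (Fin m) (Fin m) (FormalFn m)) b c) = 0 := by
    rw [Matrix.one_apply]
    split_ifs <;> simp
  rw [map_sub, h3, sub_zero] at h2
  simpa using dvd_sub h1 h2

end CloseToId

theorem IsConnection.startsAtStandardFlat {D : FormalVF m → FormalVF m → FormalVF m}
    (hD : IsConnection D) (h0 : ∀ a b c, PowerSeries.X ∣ dx c (D (frame a) (frame b))) :
    StartsAtStandardFlat D := by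
  have h0' : ∀ a b c, PowerSeries.constantCoeff (dx c (D (frame a) (frame b))) = 0 :=
    fun a b c => PowerSeries.X_dvd_iff.1 (h0 a b c)
  have h1 : ∀ a b F, PowerSeries.constantCoeff (D (frame a) (frame b) F) = 0 := fun a b F => by
    rw [formalVF_apply, map_sum]
    exact Finset.sum_eq_zero fun c _ => by rw [map_mul, h0', zero_mul]
  have h2 : ∀ X b F, PowerSeries.constantCoeff (D X (frame b) F) = 0 := fun X b F => by
    rw [eq_sum_dx_frame X, hD.sum_left]
    simp only [hD.smul_left, formalVF_sum_apply, Derivation.smul_apply, smul_eq_mul, map_sum,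
      map_mul, h1, mul_zero, Finset.sum_const_zero]
  intro X Y F
  rw [hD.apply_frame_right, standardFlat]
  simp only [formalVF_sum_apply, Derivation.add_apply, Derivation.smul_apply, smul_eq_mul, map_sum,
      map_mul, map_add, h2, mul_zero, add_zero]

/-! ### Exponentials of Hamiltonian derivations -/

section DividedPower

variable {V : Type*} [AddCommGroup V] [Module ℝ V]

/-- The divided powers `X^j / j!` of an endomorphism. -/
def divPow (X : V →ₗ[ℝ] V) (j : ℕ) : V →ₗ[ℝ] V := ((j.factorial : ℝ)⁻¹) • (X ^ j)

theorem divPow_zero (X : V →ₗ[ℝ] V) (f : V) : divPow X 0 f = f := by simp [divPow]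

theorem divPow_one (X : V →ₗ[ℝ] V) (f : V) : divPow X 1 f = X f := by simp [divPow]

theorem apply_divPow (X : V →ₗ[ℝ] V) (j : ℕ) (f : V) :
    X (divPow X j f) = ((j : ℝ) + 1) • divPow X (j + 1) f := by
  have h : ((j : ℝ) + 1) ≠ 0 := by positivity
  rw [divPow, divPow, LinearMap.smul_apply, LinearMap.smul_apply, map_smul, pow_succ',
    Module.End.mul_apply, smul_smul, Nat.factorial_succ]
  congr 1
  push_cast
  field_simp

/-- Leibniz rule for divided powers. The induction multiplies by n + 1 and writes it as the sum of
the two exponents. The operation β is arbitrary so as to cover both the product and the Poisson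
bracket. -/
theorem divPow_bilin {X : V →ₗ[ℝ] V} {β : V →ₗ[ℝ] V →ₗ[ℝ] V}
    (hX : ∀ f g, X (β f g) = β (X f) g + β f (X g)) (n : ℕ) (f g : V) :
    divPow X n (β f g) =
      ∑ p ∈ Finset.HasAntidiagonal.antidiagonal n, β (divPow X p.1 f) (divPow X p.2 g) := by
  induction n with
  | zero => simp [divPow_zero]
  | succ n ih =>
    have h : ((n : ℝ) + 1) ≠ 0 := by positivity
    refine (smul_right_injective V h) ?_
    change ((n : ℝ) + 1) • divPow X (n + 1) (β f g) = ((n : ℝ) + 1) • _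
    rw [← apply_divPow, ih, map_sum]
    simp only [hX, apply_divPow, map_smul, LinearMap.smul_apply]
    have h1 : ((n : ℝ) + 1) • ∑ p ∈ Finset.HasAntidiagonal.antidiagonal (n + 1),
        β (divPow X p.1 f) (divPow X p.2 g) =
        ∑ p ∈ Finset.HasAntidiagonal.antidiagonal (n + 1),
          (p.1 : ℝ) • β (divPow X p.1 f) (divPow X p.2 g) +
        ∑ p ∈ Finset.HasAntidiagonal.antidiagonal (n + 1),
          (p.2 : ℝ) • β (divPow X p.1 f) (divPow X p.2 g) := by
      rw [Finset.smul_sum, ← Finset.sum_add_distrib]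
      refine Finset.sum_congr rfl fun p hp => ?_
      rw [← add_smul, ← Nat.cast_add, Finset.HasAntidiagonal.mem_antidiagonal.1 hp]
      push_cast
      rfl
    rw [h1, Finset.Nat.sum_antidiagonal_succ, Finset.Nat.sum_antidiagonal_succ',
      Finset.sum_add_distrib]
    simp

end DividedPower

/-- `exp (t^k X) f`. -/
def expFun (k : ℕ) (X : Fn m →ₗ[ℝ] Fn m) (f : Fn m) : FormalFn m :=
  PowerSeries.mk fun N => if k ∣ N then divPow X (N / k) f else 0

/-- Only degrees divisible by k contribute, and on those the antidiagonal of kn is the dilated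
antidiagonal of n. -/
theorem expFun_bilin {k : ℕ} (hk : k ≠ 0) {X : Fn m →ₗ[ℝ] Fn m}
    {β : Fn m →ₗ[ℝ] Fn m →ₗ[ℝ] Fn m}
    (hX : ∀ f g, X (β f g) = β (X f) g + β f (X g)) (f g : Fn m) :
    expFun k X (β f g) = extendBilin β (expFun k X f) (expFun k X g) := by
  ext1 N
  simp only [expFun, extendBilin, PowerSeries.coeff_mk]
  by_cases hN : k ∣ N
  · obtain ⟨n, rfl⟩ := hN
    rw [if_pos (dvd_mul_right k n), Nat.mul_div_cancel_left _ (Nat.pos_of_ne_zero hk),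
      divPow_bilin hX]
    refine Finset.sum_of_injOn (fun p => (k * p.1, k * p.2)) ?_ ?_ ?_ ?_
    · rintro ⟨p, q⟩ - ⟨p', q'⟩ - h
      simpa [hk] using h
    · rintro ⟨p, q⟩ h
      simp only [Finset.mem_coe, Finset.HasAntidiagonal.mem_antidiagonal] at h ⊢
      rw [← mul_add, h]
    · rintro ⟨p, q⟩ h h'
      by_cases hp : k ∣ p
      · by_cases hq : k ∣ q
        · refine absurd ?_ h'
          obtain ⟨p, rfl⟩ := hp
          obtain ⟨q, rfl⟩ := hq
          refine ⟨(p, q), ?_, rfl⟩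
          simp only [Finset.mem_coe, Finset.HasAntidiagonal.mem_antidiagonal] at h ⊢
          rw [← mul_add] at h
          exact Nat.eq_of_mul_eq_mul_left (Nat.pos_of_ne_zero hk) h
        · rw [if_neg hq, map_zero]
      · rw [if_neg hp, map_zero, LinearMap.zero_apply]
    · rintro ⟨p, q⟩ -
      simp only [dvd_mul_right, if_true, Nat.mul_div_cancel_left _ (Nat.pos_of_ne_zero hk)]
  · rw [if_neg hN, Finset.sum_eq_zero]
    rintro ⟨p, q⟩ h
    rw [Finset.HasAntidiagonal.mem_antidiagonal] at h
    by_cases hp : k ∣ p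
    · rw [if_neg (c := k ∣ q) fun hq => hN (h ▸ dvd_add hp hq), map_zero]
    · rw [if_neg hp, map_zero, LinearMap.zero_apply]

/-- `exp (t^k X)` for a derivation `X`. -/
def expHom (k : ℕ) (hk : k ≠ 0) (X : Derivation ℝ (Fn m) (Fn m)) : Fn m →ₐ[ℝ] FormalFn m :=
  AlgHom.ofLinearMap
    { toFun := expFun k (X : Fn m →ₗ[ℝ] Fn m)
      map_add' := fun f g => by
        ext1 N
        simp only [expFun, PowerSeries.coeff_mk, map_add]
        split_ifs <;> simp
      map_smul' := fun c f => by
        ext1 N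
        rw [RingHom.id_apply, coeff_real_smul]
        simp only [expFun, PowerSeries.coeff_mk, map_smul]
        split_ifs <;> simp }
    (by
      ext1 N
      simp only [LinearMap.coe_mk, AddHom.coe_mk, expFun, PowerSeries.coeff_mk,
        PowerSeries.coeff_one]
      rcases Nat.eq_zero_or_pos N with rfl | hN
      · simp [divPow_zero]
      · rw [if_neg hN.ne']
        split_ifs with h
        · obtain ⟨n, rfl⟩ := h
          obtain ⟨n, rfl⟩ : ∃ n', n = n' + 1 :=
            Nat.exists_eq_succ_of_ne_zero (by rintro rfl; simp at hN)
          rw [Nat.mul_div_cancel_left _ (Nat.pos_of_ne_zero hk), divPow, LinearMap.smul_apply,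
            pow_succ, Module.End.mul_apply, Derivation.coeFn_coe, X.map_one_eq_zero, map_zero,
            smul_zero]
        · rfl)
    (fun f g => by
      have h := expFun_bilin hk (X := (X : Fn m →ₗ[ℝ] Fn m)) (β := LinearMap.mul ℝ (Fn m))
        (fun f g => by simp [mul_comm, add_comm]) f g
      rw [extendBilin_mul] at h
      exact h)

/-- The Hamiltonian derivation `{f, ·}`. -/
def hamiltonian (Ω : Matrix (Fin m) (Fin m) ℝ) (f : Fn m) : Derivation ℝ (Fn m) (Fn m) :=
  ∑ b, (∑ a, Ω⁻¹ a b • partialFn a f) • partialFn b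

theorem hamiltonian_apply (Ω : Matrix (Fin m) (Fin m) ℝ) (f g : Fn m) :
    hamiltonian Ω f g = ∑ b, (∑ a, Ω⁻¹ a b • partialFn a f) * partialFn b g := by
  rw [hamiltonian, ← Derivation.coeFnAddMonoidHom_apply, map_sum, Finset.sum_apply]
  rfl

theorem hamiltonian_apply_eq_bracket (Ω : Matrix (Fin m) (Fin m) ℝ) (f g : Fn m) :
    hamiltonian Ω f g = bracket Ω f g := by
  rw [hamiltonian_apply, bracket_apply, Finset.sum_comm]
  simp only [Finset.sum_mul, smul_mul_assoc]

theorem partialFn_bracket (Ω : Matrix (Fin m) (Fin m) ℝ) (c : Fin m) (f g : Fn m) :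
    partialFn c (bracket Ω f g) = bracket Ω (partialFn c f) g + bracket Ω f (partialFn c g) := by
  simp only [bracket_apply, map_sum, ← Finset.sum_add_distrib]
  refine Finset.sum_congr rfl fun a _ => Finset.sum_congr rfl fun b _ => ?_
  rw [Derivation.map_smul, Derivation.leibniz, ← smul_add, partialFn_comm c a, partialFn_comm c b]
  congr 1
  simp only [smul_eq_mul]
  ring

/-- After expansion the second derivatives of g and h match on the two sides. Those of f, collected
in `h4`, cancel by skewness of the inverse of Ω. -/
theorem bracket_jacobi {Ω : Matrix (Fin m) (Fin m) ℝ} (hskew : Ω.transpose = -Ω)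
    (hdet : IsUnit Ω.det) (f g h : Fn m) :
    bracket Ω f (bracket Ω g h) = bracket Ω (bracket Ω f g) h + bracket Ω g (bracket Ω f h) := by
  have hs : ∀ a b, Ω⁻¹ a b = -Ω⁻¹ b a := fun a b =>
    congrFun (congrFun (inv_skew hskew hdet) b) a
  have h1 : bracket Ω f (bracket Ω g h) = ∑ c, ∑ d, Ω⁻¹ c d •
      (bracket Ω f (partialFn c g) * partialFn d h +
        partialFn c g * bracket Ω f (partialFn d h)) := by
    rw [bracket_apply Ω g h, map_sum]
    simp only [map_sum, map_smul]
    refine Finset.sum_congr rfl fun a _ => Finset.sum_congr rfl fun b _ => ?_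
    congr 1
    simp only [← hamiltonian_apply_eq_bracket, Derivation.leibniz, smul_eq_mul]
    ring
  have h2 : bracket Ω (bracket Ω f g) h = ∑ c, ∑ d, Ω⁻¹ c d •
      (bracket Ω (partialFn c f) g * partialFn d h +
        bracket Ω f (partialFn c g) * partialFn d h) := by
    rw [bracket_apply Ω _ h]
    simp only [partialFn_bracket, add_mul]
  have h3 : bracket Ω g (bracket Ω f h) = ∑ c, ∑ d, Ω⁻¹ c d •
      (partialFn c g * bracket Ω (partialFn d f) h +
        partialFn c g * bracket Ω f (partialFn d h)) := by
    rw [bracket_apply Ω g]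
    simp only [partialFn_bracket, mul_add]
  have h4 : ∑ c, ∑ d, Ω⁻¹ c d • (bracket Ω (partialFn c f) g * partialFn d h) =
      -∑ c, ∑ d, Ω⁻¹ c d • (partialFn c g * bracket Ω (partialFn d f) h) := by
    simp only [bracket_apply, Finset.sum_mul, Finset.mul_sum, Finset.smul_sum]
    rw [sum_exchange fun c d a b => Ω⁻¹ c d • (partialFn c g *
      Ω⁻¹ a b • (partialFn a (partialFn d f) * partialFn b h))]
    simp only [← Finset.sum_neg_distrib]
    refine Finset.sum_congr rfl fun c _ => Finset.sum_congr rfl fun d _ => ?_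
    rw [Finset.sum_comm]
    refine Finset.sum_congr rfl fun b _ => Finset.sum_congr rfl fun a _ => ?_
    rw [hs b a, partialFn_comm c a]
    simp only [smul_mul_assoc, mul_smul_comm, smul_smul, ← neg_smul]
    congr 1
    · ring
    · ring
  rw [h1, h2, h3]
  simp only [smul_add, Finset.sum_add_distrib] at h4 ⊢
  rw [h4]
  abel

/-- The formal curve of symplectomorphisms `exp (t^k {f, ·})`. -/
def expSymplectomorphism {Ω : Matrix (Fin m) (Fin m) ℝ} (hskew : Ω.transpose = -Ω)
    (hdet : IsUnit Ω.det) (k : ℕ) (hk : k ≠ 0) (f : Fn m) : FormalSymplectomorphism Ω where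
  toAlgHom := expHom k hk (hamiltonian Ω f)
  map_bracket := fun g h => expFun_bilin hk (fun g h => by
    simp only [Derivation.coeFn_coe, hamiltonian_apply_eq_bracket]
    exact bracket_jacobi hskew hdet f g h) g h
  bijective_leading := by
    have h : (fun g => PowerSeries.constantCoeff (expHom k hk (hamiltonian Ω f) g)) = id := by
      funext g
      change PowerSeries.constantCoeff (expFun k _ g) = g
      rw [← PowerSeries.coeff_zero_eq_constantCoeff_apply, expFun, PowerSeries.coeff_mk,
        if_pos (dvd_zero k), Nat.zero_div, divPow_zero]
    rw [h]
    exact Function.bijective_id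

/-! ### First-order effect of the exponentials -/

theorem coeff_expFun_of_lt {k j : ℕ} (hj : j ≠ 0) (hjk : j < k) (X : Fn m →ₗ[ℝ] Fn m) (f : Fn m) :
    PowerSeries.coeff j (expFun k X f) = 0 := by
  rw [expFun, PowerSeries.coeff_mk, if_neg]
  exact fun h => absurd (Nat.le_of_dvd (Nat.pos_of_ne_zero hj) h) (not_le.2 hjk)

theorem constantCoeff_expFun (k : ℕ) (X : Fn m →ₗ[ℝ] Fn m) (f : Fn m) :
    PowerSeries.constantCoeff (expFun k X f) = f := by
  rw [← PowerSeries.coeff_zero_eq_constantCoeff_apply, expFun, PowerSeries.coeff_mk,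
    if_pos (dvd_zero k), Nat.zero_div, divPow_zero]

theorem coeff_expFun_self {k : ℕ} (hk : k ≠ 0) (X : Fn m →ₗ[ℝ] Fn m) (f : Fn m) :
    PowerSeries.coeff k (expFun k X f) = X f := by
  rw [expFun, PowerSeries.coeff_mk, if_pos dvd_rfl, Nat.div_self (Nat.pos_of_ne_zero hk),
    divPow_one]

section Exp

variable {Ω : Matrix (Fin m) (Fin m) ℝ} (hskew : Ω.transpose = -Ω) (hdet : IsUnit Ω.det)
  {k : ℕ} (hk : k ≠ 0) (f : Fn m)

theorem coeff_expSymplectomorphism (F : FormalFn m) :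
    PowerSeries.coeff k ((expSymplectomorphism hskew hdet k hk f).extend F) =
      PowerSeries.coeff k F + hamiltonian Ω f (PowerSeries.constantCoeff F) := by
  rw [FormalSymplectomorphism.extend_apply, coeff_extendFun]
  obtain ⟨n, rfl⟩ := Nat.exists_eq_succ_of_ne_zero hk
  change ∑ j ∈ Finset.range (n + 1), PowerSeries.coeff (n + 1 - j) (expFun (n + 1) _ _) +
    PowerSeries.constantCoeff (expFun (n + 1) _ _) = _
  rw [Finset.sum_range_succ', Finset.sum_eq_zero, zero_add, constantCoeff_expFun, Nat.sub_zero,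
    coeff_expFun_self n.succ_ne_zero, add_comm]
  · simp
  · intro j hj
    have := Finset.mem_range.1 hj
    exact coeff_expFun_of_lt (by omega) (by omega) _ _

theorem closeToId_expSymplectomorphism :
    CloseToId k (expSymplectomorphism hskew hdet k hk f).extend := fun F => by
  rw [PowerSeries.X_pow_dvd_iff]
  intro j hj
  rw [map_sub, FormalSymplectomorphism.extend_apply, coeff_extendFun, Finset.sum_eq_zero, zero_add]
  · change PowerSeries.constantCoeff (expFun k _ _) - _ = 0
    rw [constantCoeff_expFun, sub_self]
  · intro i hi
    have := Finset.mem_range.1 hi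
    exact coeff_expFun_of_lt (by omega) (by omega) _ _

theorem coeff_expSymplectomorphism_symm (F : FormalFn m) :
    PowerSeries.coeff k ((expSymplectomorphism hskew hdet k hk f).extend.symm F) =
      PowerSeries.coeff k F - hamiltonian Ω f (PowerSeries.constantCoeff F) := by
  have h := coeff_expSymplectomorphism hskew hdet hk f
    ((expSymplectomorphism hskew hdet k hk f).extend.symm F)
  have h1 := (closeToId_expSymplectomorphism hskew hdet hk f).symm F
  have h2 := PowerSeries.X_pow_dvd_iff.1 h1 0 (Nat.pos_of_ne_zero hk)
  rw [map_sub, sub_eq_zero, PowerSeries.coeff_zero_eq_constantCoeff_apply,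
    PowerSeries.coeff_zero_eq_constantCoeff_apply] at h2
  rw [AlgEquiv.apply_symm_apply, h2] at h
  rw [h, add_sub_cancel_right]

/-- To first order the action on vector fields is the bracket with the Hamiltonian field, here of
that field with ∂_b. The second derivatives of g cancel. -/
theorem coeff_actVF_frame_expSymplectomorphism (b : Fin m) (g : Fn m) :
    PowerSeries.coeff k (actVF (expSymplectomorphism hskew hdet k hk f).extend (frame b)
        (PowerSeries.C g)) =
      -∑ e, partialFn b (∑ a, Ω⁻¹ a e • partialFn a f) * partialFn e g := by
  have h0 : PowerSeries.constantCoeff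
      ((expSymplectomorphism hskew hdet k hk f).extend.symm (PowerSeries.C g)) = g := by
    have h1 := (closeToId_expSymplectomorphism hskew hdet hk f).symm (PowerSeries.C g)
    have h2 := PowerSeries.X_pow_dvd_iff.1 h1 0 (Nat.pos_of_ne_zero hk)
    rw [map_sub, sub_eq_zero] at h2
    simpa using h2
  have h1 : PowerSeries.constantCoeff (frame b
      ((expSymplectomorphism hskew hdet k hk f).extend.symm (PowerSeries.C g))) =
        partialFn b g := by
    rw [← PowerSeries.coeff_zero_eq_constantCoeff_apply, coeff_frame,
      PowerSeries.coeff_zero_eq_constantCoeff_apply, h0]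
  rw [actVF_apply, coeff_expSymplectomorphism, coeff_frame, coeff_expSymplectomorphism_symm,
    h1, PowerSeries.coeff_C, if_neg hk, PowerSeries.constantCoeff_C, zero_sub,
    map_neg, hamiltonian_apply, hamiltonian_apply, map_sum, ← Finset.sum_neg_distrib,
    ← Finset.sum_neg_distrib, ← Finset.sum_add_distrib]
  refine Finset.sum_congr rfl fun e _ => ?_
  rw [Derivation.leibniz, partialFn_comm b e]
  simp only [smul_eq_mul]
  ring

theorem coeff_jacobian_expSymplectomorphism (b c : Fin m) :
    PowerSeries.coeff k (jacobian (expSymplectomorphism hskew hdet k hk f).extend b c) =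
      -partialFn b (∑ a, Ω⁻¹ a c • partialFn a f) := by
  rw [jacobian, Matrix.of_apply, coeff_dx, coeff_actVF_frame_expSymplectomorphism,
    coeff_actVF_frame_expSymplectomorphism]
  have h1 : ∀ x y u v : Fn m, (2 * Real.pi)⁻¹ • (x * -u - y * -v) =
      -((2 * Real.pi)⁻¹ • (x * u - y * v)) := fun x y u v => by
    rw [← smul_neg]
    congr 1
    ring
  -- The degree 0 part of the duality between `dx` and `frame`, which extracts the component c.
  have h2 : ∀ e, (2 * Real.pi)⁻¹ • (cosFn c * partialFn e (sinFn c) -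
      sinFn c * partialFn e (cosFn c)) = if c = e then 1 else 0 := fun e => by
    have h3 := congrArg (PowerSeries.coeff 0) (dx_frame c e)
    rw [coeff_dx, coeff_frame, coeff_frame] at h3
    simp only [PowerSeries.coeff_zero_eq_constantCoeff, PowerSeries.constantCoeff_C] at h3
    rw [h3]
    split_ifs <;> simp
  rw [h1, Finset.mul_sum, Finset.mul_sum, ← Finset.sum_sub_distrib, Finset.smul_sum]
  congr 1
  rw [Finset.sum_congr rfl fun e _ => show _ = partialFn b (∑ a, Ω⁻¹ a e • partialFn a f) *
    if c = e then (1 : Fn m) else 0 from ?_]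
  · simp
  · rw [← h2, mul_smul_comm]
    congr 1
    ring

/-- One step of the normalisation of the Christoffel symbols. -/
theorem IsRicciLike.exists_constBelow_succ {D : FormalVF m → FormalVF m → FormalVF m}
    (h : IsRicciLike Ω D) (hm : 3 ≤ m) (hskew : Ω.transpose = -Ω) (hdet : IsUnit Ω.det) {k : ℕ}
    (hk : k ≠ 0) (hc : ∀ a b c, ConstBelow k (dx c (D (frame a) (frame b)))) :
    ∃ ψ : FormalSymplectomorphism Ω, CloseToId k ψ.extend ∧
      IsRicciLike Ω (RicciTorus.actConn ψ.extend D) ∧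
      ∀ a b c, ConstBelow (k + 1) (dx c (RicciTorus.actConn ψ.extend D (frame a) (frame b))) := by
  obtain ⟨f, hf⟩ := h.exists_potential_coeff hm hskew hdet hc
  set ψ := expSymplectomorphism hskew hdet k hk f with hψdef
  have hψ : CloseToId k ψ.extend := closeToId_expSymplectomorphism hskew hdet hk f
  have h0 : ∀ a b c, PowerSeries.X ∣ dx c (D (frame a) (frame b)) := fun a b c =>
    PowerSeries.X_dvd_iff.2 (h.constantCoeff_dx a b c)
  have h1 := hψ.dvd_christoffel_sub h.toIsConnection hk h0
  have h2 := hψ.christoffel_sub h.toIsConnection hk h0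
  refine ⟨ψ, hψ, IsRicciLike.actConn ((exists_extend_eq_iff Ω _).1 ⟨ψ, rfl⟩) hdet h
    ((h.toIsConnection.actConn _).startsAtStandardFlat fun a b c => ?_), fun a b c j hj e => ?_⟩
  · have := dvd_add ((dvd_pow_self _ hk).trans (h1 a b c)) (h0 a b c)
    rwa [sub_add_cancel] at this
  -- Lower degrees are untouched; only degree k has to be examined.
  rcases (Nat.lt_succ_iff.1 hj).lt_or_eq with hj | rfl
  · have h3 := PowerSeries.X_pow_dvd_iff.1 (h1 a b c) j hj
    rw [map_sub, sub_eq_zero] at h3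
    rw [h3, hc a b c j hj e]
  · have h3 := PowerSeries.X_pow_dvd_iff.1 (h2 a b c) j j.lt_succ_self
    rw [map_add, map_sub, coeff_frame, coeff_jacobian_expSymplectomorphism] at h3
    -- The new symbol is the old one plus the second derivatives of the Hamiltonian field. With
    -- lowered index this adds the third derivative of f, which was chosen to leave a constant.
    have h4 : PowerSeries.coeff j (dx c (RicciTorus.actConn ψ.extend D (frame a) (frame b))) =
        ∑ d, Ω⁻¹ d c • (PowerSeries.coeff j (omega Ω (D (frame a) (frame b)) (frame d)) +
          partialFn a (partialFn b (partialFn d f))) := by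
      have h5 := congrArg (PowerSeries.coeff j) (dx_eq_of_omega hdet (D (frame a) (frame b)) c)
      simp only [map_sum, coeff_real_smul] at h5
      simp only [map_sum, Derivation.map_smul, map_neg] at h3
      simp only [smul_add, Finset.sum_add_distrib, ← h5]
      linear_combination h3
    rw [h4, map_sum]
    exact Finset.sum_eq_zero fun d _ => by rw [Derivation.map_smul, hf, smul_zero]

end Exp

/-! ### Infinite compositions -/

section Limit

variable {Ω : Matrix (Fin m) (Fin m) ℝ}

theorem FormalSymplectomorphism.extend_C (ψ : FormalSymplectomorphism Ω) (f : Fn m) :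
    ψ.extend (PowerSeries.C f) = ψ.toAlgHom f := by
  ext1 k
  rw [ψ.extend_apply, coeff_extendFun]
  cases k with
  | zero => simp
  | succ k =>
    rw [Finset.sum_range_succ']
    simp [PowerSeries.coeff_C]

theorem FormalSymplectomorphism.exists_extend_trans (ψ φ : FormalSymplectomorphism Ω) :
    ∃ χ : FormalSymplectomorphism Ω, χ.extend = ψ.extend.trans φ.extend :=
  (exists_extend_eq_iff Ω _).2 fun F G => by
    simp only [AlgEquiv.trans_apply, (exists_extend_eq_iff Ω ψ.extend).1 ⟨ψ, rfl⟩,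
      (exists_extend_eq_iff Ω φ.extend).1 ⟨φ, rfl⟩]

/-- Coefficient j is stationary from `ψ j` on, so the limit is the diagonal series. Each identity in
degree N involves only degrees at most N and can be checked on `ψ N`. -/
theorem FormalSymplectomorphism.exists_limit (ψ : ℕ → FormalSymplectomorphism Ω)
    (h : ∀ N F, (PowerSeries.X : FormalFn m) ^ (N + 1) ∣ (ψ (N + 1)).extend F - (ψ N).extend F) :
    ∃ φ : FormalSymplectomorphism Ω, ∀ N F,
      (PowerSeries.X : FormalFn m) ^ (N + 1) ∣ φ.extend F - (ψ N).extend F := by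
  have hs : ∀ N j f, j ≤ N → PowerSeries.coeff j ((ψ N).toAlgHom f) =
      PowerSeries.coeff j ((ψ j).toAlgHom f) := by
    intro N j f hj
    induction N, hj using Nat.le_induction with
    | base => rfl
    | succ N hN ih =>
      have h1 := PowerSeries.X_pow_dvd_iff.1 (h N (PowerSeries.C f)) j (Nat.lt_succ_of_le hN)
      rw [extend_C, extend_C, map_sub, sub_eq_zero] at h1
      rw [h1, ih]
  let u : Fn m → FormalFn m := fun f =>
    PowerSeries.mk fun j => PowerSeries.coeff j ((ψ j).toAlgHom f)
  have hu : ∀ N j f, j ≤ N → PowerSeries.coeff j (u f) =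
      PowerSeries.coeff j ((ψ N).toAlgHom f) := fun N j f hj => by
    rw [hs N j f hj]
    exact PowerSeries.coeff_mk _ _
  have hbil : ∀ (β : Fn m →ₗ[ℝ] Fn m →ₗ[ℝ] Fn m) (f g : Fn m) (N : ℕ),
      PowerSeries.coeff N (extendBilin β (u f) (u g)) =
        PowerSeries.coeff N (extendBilin β ((ψ N).toAlgHom f) ((ψ N).toAlgHom g)) := by
    intro β f g N
    simp only [extendBilin, PowerSeries.coeff_mk]
    refine Finset.sum_congr rfl fun p hp => ?_
    have h1 := Finset.HasAntidiagonal.mem_antidiagonal.1 hp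
    rw [hu N p.1 f (by omega), hu N p.2 g (by omega)]
  let φ : FormalSymplectomorphism Ω :=
    { toAlgHom :=
        { toFun := u
          map_one' := by ext1 N; rw [hu N N _ le_rfl, map_one]
          map_zero' := by ext1 N; rw [hu N N _ le_rfl, map_zero]
          map_add' := fun f g => by
            ext1 N
            rw [map_add, hu N N _ le_rfl, hu N N _ le_rfl, hu N N _ le_rfl, map_add, map_add]
          map_mul' := fun f g => by
            ext1 N
            rw [hu N N _ le_rfl, map_mul, ← extendBilin_mul, ← extendBilin_mul, hbil]
          commutes' := fun r => by
            ext1 N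
            rw [hu N N _ le_rfl, AlgHom.commutes] }
      map_bracket := fun f g => by
        ext1 N
        change PowerSeries.coeff N (u _) = PowerSeries.coeff N (extendBilin _ (u f) (u g))
        rw [hu N N _ le_rfl, hbil, (ψ N).map_bracket]
      bijective_leading := by
        have h0 : (fun f => PowerSeries.constantCoeff (u f)) =
            fun f => PowerSeries.constantCoeff ((ψ 0).toAlgHom f) := funext fun f => by
          simpa only [PowerSeries.coeff_zero_eq_constantCoeff] using hu 0 0 f le_rfl
        have h1 := (ψ 0).bijective_leading
        rw [← h0] at h1
        exact h1 }
  refine ⟨φ, fun N F => PowerSeries.X_pow_dvd_iff.2 fun j hj => ?_⟩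
  rw [map_sub, sub_eq_zero, extend_apply, extend_apply, extendFun, extendFun,
    PowerSeries.coeff_mk, PowerSeries.coeff_mk]
  refine Finset.sum_congr rfl fun p hp => ?_
  have h1 := Finset.HasAntidiagonal.mem_antidiagonal.1 hp
  exact hu N p.1 _ (by omega)

theorem exists_seq_of_forall_exists {α : Type*} {P : ℕ → α → Prop} {R : ℕ → α → α → Prop}
    (h0 : ∃ a, P 0 a) (h : ∀ n a, P n a → ∃ b, P (n + 1) b ∧ R n a b) :
    ∃ u : ℕ → α, ∀ n, P n (u n) ∧ R n (u n) (u (n + 1)) := by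
  choose f hf using h
  let v : ∀ n, {a // P n a} := fun n =>
    Nat.rec ⟨h0.choose, h0.choose_spec⟩ (fun n a => ⟨f n a.1 a.2, (hf n a.1 a.2).1⟩) n
  exact ⟨fun n => (v n).1, fun n => ⟨(v n).2, (hf n _ (v n).2).2⟩⟩

/-- Every formal curve is equivalent to one with constant Christoffel symbols. -/
theorem IsRicciLike.exists_const {D : FormalVF m → FormalVF m → FormalVF m}
    (h : IsRicciLike Ω D) (hm : 3 ≤ m) (hskew : Ω.transpose = -Ω) (hdet : IsUnit Ω.det) :
    ∃ ψ : FormalSymplectomorphism Ω, IsRicciLike Ω (RicciTorus.actConn ψ.extend D) ∧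
      ∀ a b c e, frame e (dx c (RicciTorus.actConn ψ.extend D (frame a) (frame b))) = 0 := by
  have h0 : ∀ {D : FormalVF m → FormalVF m → FormalVF m}, IsRicciLike Ω D →
      ∀ a b c, PowerSeries.X ∣ dx c (D (frame a) (frame b)) := fun h a b c =>
    PowerSeries.X_dvd_iff.2 (h.constantCoeff_dx a b c)
  -- The index is shifted by one: stage 0 is the identity, for which degree 0 is constant because it
  -- vanishes. Stage N is corrected by an automorphism that is trivial modulo t^(N+1).
  obtain ⟨u, hu⟩ := exists_seq_of_forall_exists
    (P := fun N (ψ : FormalSymplectomorphism Ω) =>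
      IsRicciLike Ω (RicciTorus.actConn ψ.extend D) ∧ ∀ a b c,
        ConstBelow (N + 1) (dx c (RicciTorus.actConn ψ.extend D (frame a) (frame b))))
    (R := fun N ψ φ => ∃ ε : FormalSymplectomorphism Ω, CloseToId (N + 1) ε.extend ∧
      φ.extend = ψ.extend.trans ε.extend)
    (by
      obtain ⟨ψ, hψ⟩ := (exists_extend_eq_iff Ω AlgEquiv.refl).2 fun F G => rfl
      refine ⟨ψ, ?_⟩
      rw [hψ, actConn_refl]
      refine ⟨h, fun a b c j hj e => ?_⟩
      obtain rfl : j = 0 := by omega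
      rw [PowerSeries.coeff_zero_eq_constantCoeff_apply, h.constantCoeff_dx, map_zero])
    (by
      rintro N ψ ⟨h1, h2⟩
      obtain ⟨ε, hε, h3, h4⟩ := h1.exists_constBelow_succ hm hskew hdet N.succ_ne_zero h2
      obtain ⟨φ, hφ⟩ := ψ.exists_extend_trans ε
      rw [actConn_trans, ← hφ] at h3 h4
      exact ⟨φ, ⟨h3, h4⟩, ε, hε, hφ⟩)
  obtain ⟨φ, hφ⟩ := FormalSymplectomorphism.exists_limit u fun N F => by
    obtain ⟨-, ε, hε, hε'⟩ := hu N
    rw [hε', AlgEquiv.trans_apply]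
    exact hε _
  have hN : ∀ N a b c, PowerSeries.X ^ (N + 1) ∣
      dx c (RicciTorus.actConn φ.extend D (frame a) (frame b)) -
        dx c (RicciTorus.actConn (u N).extend D (frame a) (frame b)) := by
    intro N a b c
    -- The limit differs from stage N by an automorphism close to the identity, so the symbols agree
    -- below degree N + 1.
    have hΘ : CloseToId (N + 1) ((u N).extend.symm.trans φ.extend) := fun F => by
      have := hφ N ((u N).extend.symm F)
      rwa [AlgEquiv.apply_symm_apply] at this
    have h1 := hΘ.dvd_christoffel_sub (hu N).1.1.toIsConnection N.succ_ne_zero (h0 (hu N).1.1) a b c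
    rwa [← actConn_trans (u N).extend.symm φ.extend, actConn_symm] at h1
  refine ⟨φ, IsRicciLike.actConn ((exists_extend_eq_iff Ω _).1 ⟨φ, rfl⟩) hdet h
    ((h.toIsConnection.actConn _).startsAtStandardFlat fun a b c => ?_), fun a b c e => ?_⟩
  · have := dvd_add (hN 0 a b c) (by simpa using h0 (hu 0).1.1 a b c)
    simpa using this
  · ext1 N
    have h1 := PowerSeries.X_pow_dvd_iff.1 (hN N a b c) N N.lt_succ_self
    rw [map_sub, sub_eq_zero] at h1
    rw [coeff_frame, h1, (hu N).1.2 a b c N N.lt_succ_self e, map_zero]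

end Limit

/-! ### Connections with constant Christoffel symbols -/

section PiBilinear

variable {K M : Type*} [CommRing K] [AddCommGroup M] [Module K M]

/-- The bilinear map with prescribed values on the standard basis. -/
def piBilin (B : Fin m → Fin m → M) : (Fin m → K) →ₗ[K] (Fin m → K) →ₗ[K] M :=
  LinearMap.mk₂ K (fun x y => ∑ a, ∑ b, (x a * y b) • B a b)
    (fun x x' y => by simp only [Pi.add_apply, add_mul, add_smul, Finset.sum_add_distrib])
    (fun c x y => by
      simp only [Pi.smul_apply, smul_eq_mul, mul_assoc, mul_smul, Finset.smul_sum])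
    (fun x y y' => by simp only [Pi.add_apply, mul_add, add_smul, Finset.sum_add_distrib])
    (fun c x y => by
      simp only [Pi.smul_apply, smul_eq_mul, mul_left_comm _ c, mul_smul, Finset.smul_sum])

theorem piBilin_apply (B : Fin m → Fin m → M) (x y : Fin m → K) :
    piBilin B x y = ∑ a, ∑ b, (x a * y b) • B a b := rfl

theorem piBilin_single_left (B : Fin m → Fin m → M) (a : Fin m) (y : Fin m → K) :
    piBilin B (Pi.single a 1) y = ∑ b, y b • B a b := by
  rw [piBilin_apply, Finset.sum_eq_single a]
  · simp
  · intro b _ hb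
    simp [hb]
  · simp

theorem piBilin_single_right (B : Fin m → Fin m → M) (x : Fin m → K) (b : Fin m) :
    piBilin B x (Pi.single b 1) = ∑ a, x a • B a b := by
  rw [piBilin_apply]
  refine Finset.sum_congr rfl fun a _ => ?_
  rw [Finset.sum_eq_single b]
  · simp
  · intro c _ hc
    simp [hc]
  · simp

theorem piBilin_single (B : Fin m → Fin m → M) (a b : Fin m) :
    piBilin B (Pi.single a (1 : K)) (Pi.single b 1) = B a b := by
  rw [piBilin_single_left, Finset.sum_eq_single b]
  · simp
  · intro c _ hc
    simp [hc]
  · simp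

theorem pi_single_induction {P : (Fin m → K) → Prop} (zero : P 0)
    (add : ∀ x y, P x → P y → P (x + y)) (smul : ∀ (c : K) x, P x → P (c • x))
    (single : ∀ a, P (Pi.single a 1)) (x : Fin m → K) : P x := by
  rw [pi_eq_sum_univ' x]
  exact Finset.sum_induction _ P add zero fun a _ => smul _ _ (by
    convert single a using 1)

end PiBilinear

/-- For constant Christoffel symbols the Ricci-type condition forces nilpotency. -/
theorem christoffel_mul_eq_zero {Ω : Matrix (Fin m) (Fin m) ℝ} (hm : 3 ≤ m)
    (hskew : Ω.transpose = -Ω) (hdet : IsUnit Ω.det) {Γ : Fin m → Fin m → Fin m → ℝ⟦X⟧}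
    {ρ : Fin m → Fin m → ℝ⟦X⟧} (hsymm : ∀ a b c, Γ a b c = Γ b a c)
    (hsp : ∀ a b c, ∑ d, PowerSeries.C (Ω d c) * Γ a b d +
      ∑ d, PowerSeries.C (Ω b d) * Γ a c d = 0)
    (hρ : ∀ a b, ρ a b = ρ b a)
    (h : ∀ a b c d, ∑ f, PowerSeries.C (Ω f d) * ∑ e, (Γ b c e * Γ a e f - Γ a c e * Γ b e f) =
      2 * PowerSeries.C (Ω a b) * ρ c d + PowerSeries.C (Ω a c) * ρ b d +
        PowerSeries.C (Ω a d) * ρ b c - PowerSeries.C (Ω b c) * ρ a d -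
          PowerSeries.C (Ω b d) * ρ a c) (a b c d : Fin m) :
    ∑ e, Γ b c e * Γ a e d = 0 := by
  set w : (Fin m → ℝ⟦X⟧) →ₗ[ℝ⟦X⟧] (Fin m → ℝ⟦X⟧) →ₗ[ℝ⟦X⟧] ℝ⟦X⟧ :=
    piBilin fun a b => PowerSeries.C (Ω a b) with hw
  set p : (Fin m → ℝ⟦X⟧) →ₗ[ℝ⟦X⟧] (Fin m → ℝ⟦X⟧) →ₗ[ℝ⟦X⟧] (Fin m → ℝ⟦X⟧) := piBilin Γ with hp
  set r : (Fin m → ℝ⟦X⟧) →ₗ[ℝ⟦X⟧] (Fin m → ℝ⟦X⟧) →ₗ[ℝ⟦X⟧] ℝ⟦X⟧ := piBilin ρ with hr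
  have hpp : ∀ a b c f, p (Pi.single a 1) (p (Pi.single b 1) (Pi.single c 1)) f =
      ∑ e, Γ b c e * Γ a e f := fun a b c f => by
    rw [hp, piBilin_single, piBilin_single_left]
    simp
  have hwd : ∀ v d, w v (Pi.single d 1) = ∑ f, PowerSeries.C (Ω f d) * v f := fun v d => by
    rw [hw, piBilin_single_right]
    exact Finset.sum_congr rfl fun f _ => by rw [smul_eq_mul, mul_comm]
  -- All identities are multilinear, hence reduce to basis vectors, where they are the hypotheses on
  -- Γ and ρ. The numerical factor of the Ricci-type tensor is already contained in ρ, so the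
  -- constant is 1.
  have hP : RicciProduct w p r 1 :=
    { skew := fun x y => by
        simp only [hw, piBilin_apply, ← Finset.sum_neg_distrib]
        rw [Finset.sum_comm]
        refine Finset.sum_congr rfl fun b _ => Finset.sum_congr rfl fun a _ => ?_
        rw [skew_apply hskew a b]
        simp only [smul_eq_mul, map_neg]
        ring
      comm := fun x y => by
        simp only [hp, piBilin_apply]
        rw [Finset.sum_comm]
        refine Finset.sum_congr rfl fun b _ => Finset.sum_congr rfl fun a _ => ?_
        rw [mul_comm, show Γ a b = Γ b a from funext fun c => hsymm a b c]
      symm := fun x y => by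
        simp only [hr, piBilin_apply]
        rw [Finset.sum_comm]
        refine Finset.sum_congr rfl fun b _ => Finset.sum_congr rfl fun a _ => ?_
        rw [mul_comm, hρ a b]
      sp := fun x y z => by
        induction x using pi_single_induction with
        | zero => simp
        | add x x' hx hx' =>
          simp only [map_add, LinearMap.add_apply]
          linear_combination hx + hx'
        | smul s x hx =>
          simp only [map_smul, LinearMap.smul_apply, smul_eq_mul]
          linear_combination s * hx
        | single a =>
        induction y using pi_single_induction with
        | zero => simp
        | add x x' hx hx' =>
          simp only [map_add, LinearMap.add_apply]
          linear_combination hx + hx'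
        | smul s x hx =>
          simp only [map_smul, LinearMap.smul_apply, smul_eq_mul]
          linear_combination s * hx
        | single b =>
        induction z using pi_single_induction with
        | zero => simp
        | add x x' hx hx' =>
          simp only [map_add]
          linear_combination hx + hx'
        | smul s x hx =>
          simp only [map_smul, smul_eq_mul]
          linear_combination s * hx
        | single c =>
        rw [hwd, hp, piBilin_single, piBilin_single, hw, piBilin_single_left]
        simp only [smul_eq_mul, mul_comm (Γ a c _)]
        linear_combination hsp a b c
      ricci := fun x y z t => by
        induction x using pi_single_induction with
        | zero => simp
        | add x x' hx hx' =>
          simp only [map_add, LinearMap.add_apply]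
          linear_combination hx + hx'
        | smul s x hx =>
          simp only [map_smul, LinearMap.smul_apply, smul_eq_mul]
          linear_combination s * hx
        | single a =>
        induction y using pi_single_induction with
        | zero => simp
        | add x x' hx hx' =>
          simp only [map_add, LinearMap.add_apply]
          linear_combination hx + hx'
        | smul s x hx =>
          simp only [map_smul, LinearMap.smul_apply, smul_eq_mul]
          linear_combination s * hx
        | single b =>
        induction z using pi_single_induction with
        | zero => simp
        | add x x' hx hx' =>
          simp only [map_add, LinearMap.add_apply]
          linear_combination hx + hx'
        | smul s x hx =>
          simp only [map_smul, LinearMap.smul_apply, smul_eq_mul]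
          linear_combination s * hx
        | single c =>
        induction t using pi_single_induction with
        | zero => simp
        | add x x' hx hx' =>
          simp only [map_add]
          linear_combination hx + hx'
        | smul s x hx =>
          simp only [map_smul, smul_eq_mul]
          linear_combination s * hx
        | single d =>
        have h1 := h a b c d
        rw [hwd, hwd]
        simp only [hpp, hw, hr, piBilin_single]
        simp only [Finset.sum_sub_distrib, mul_sub] at h1
        rw [h1]
        ring }
  have hC : ∀ (P Q : Matrix (Fin m) (Fin m) ℝ),
      (∀ b c, ∑ a, P b a * Q a c = if b = c then 1 else 0) → ∀ (v : Fin m → ℝ⟦X⟧) (c : Fin m),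
        ∑ a, PowerSeries.C (Q a c) * ∑ b, PowerSeries.C (P b a) * v b = v c := by
    intro P Q hPQ v c
    simp only [Finset.mul_sum]
    rw [Finset.sum_comm]
    have h2 : ∀ b, ∑ a, PowerSeries.C (Q a c) * (PowerSeries.C (P b a) * v b) =
        PowerSeries.C (if b = c then (1 : ℝ) else 0) * v b := fun b => by
      rw [← hPQ, map_sum, Finset.sum_mul]
      exact Finset.sum_congr rfl fun a _ => by rw [map_mul]; ring
    rw [Finset.sum_congr rfl fun b _ => h2 b, Finset.sum_eq_single c]
    · simp
    · intro b _ hb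
      simp [hb]
    · simp
  have : CharZero ℝ⟦X⟧ := charZero_of_injective_ringHom (PowerSeries.C_injective (R := ℝ))
  -- The argument runs over the domain ℝ⟦t⟧ directly, with no recursion on degrees. Nondegeneracy
  -- over ℝ⟦t⟧ comes from the real inverse of Ω.
  have h0 := hP.mul_mul_eq_zero (by simpa using hm) (fun φ => by
      refine ⟨fun a => ∑ b, PowerSeries.C (Ω⁻¹ b a) * φ (Pi.single b 1), fun y => ?_⟩
      induction y using pi_single_induction with
      | zero => simp
      | add x x' hx hx' => rw [map_add, map_add, hx, hx']
      | smul s x hx => rw [map_smul, map_smul, hx]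
      | single c =>
        rw [hwd]
        exact hC _ _ (sum_inv_mul hdet) (fun b => φ (Pi.single b 1)) c)
    (fun v hv => funext fun c => by
      rw [← hC _ _ (sum_mul_inv hdet) v c]
      simp only [← hwd, hv, mul_zero, Finset.sum_const_zero, Pi.zero_apply])
    (Pi.single a 1) (Pi.single b 1) (Pi.single c 1)
  rw [← hpp, h0, Pi.zero_apply]

/-- The curvature of constant symbols is constant, hence so is r, a multiple of its contraction. All
identities then descend along the injection of ℝ⟦t⟧ into formal functions and
`christoffel_mul_eq_zero` applies. -/
theorem IsRicciLike.exists_linearCurve {Ω : Matrix (Fin m) (Fin m) ℝ}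
    {D : FormalVF m → FormalVF m → FormalVF m} (h : IsRicciLike Ω D) (hm : 3 ≤ m)
    (hskew : Ω.transpose = -Ω) (hdet : IsUnit Ω.det)
    (hc : ∀ a b c e, frame e (dx c (D (frame a) (frame b))) = 0) :
    ∃ A : LinearCurve Ω, A.connection = D := by
  have hinj := algebraMap_formalFn_injective (m := m)
  choose Γ hΓ using fun a b c => exists_eq_algebraMap_of_frame (hc a b c)
  obtain ⟨r, hr, hE⟩ := h.exists_ricci_frame (by omega) hskew hdet
  have hcurv : ∀ a b c d, omega Ω (curvature D (frame a) (frame b) (frame c)) (frame d) =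
      algebraMap ℝ⟦X⟧ (FormalFn m) (∑ f, PowerSeries.C (Ω f d) *
        ∑ e, (Γ b c e * Γ a e f - Γ a c e * Γ b e f)) := fun a b c d => by
    rw [omega_frame_right]
    simp only [dx_curvature_frame h.toIsConnection, hΓ, Derivation.map_algebraMap, sub_zero,
      zero_add, real_smul_eq, map_sum, map_mul, map_sub]
  have hr0 : ∀ c d, ∃ ρ, r c d = algebraMap ℝ⟦X⟧ (FormalFn m) ρ := fun c d => by
    refine exists_eq_algebraMap_of_frame fun e => ?_
    have h1 := contract_ricciTensor hskew hdet hr c d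
    simp only [← hE, hcurv, contract] at h1
    have h2 := congrArg (frame e) h1
    simp only [formalVF_real_smul, map_sum, Derivation.map_algebraMap, smul_zero,
      Finset.sum_const_zero] at h2
    have h3 : (2 * (m : ℝ) + 4) ≠ 0 := by positivity
    exact (smul_eq_zero.1 h2.symm).resolve_left h3
  choose ρ hρ using hr0
  have hΓsymm : ∀ a b c, Γ a b c = Γ b a c := fun a b c => hinj (by
    rw [← hΓ, ← hΓ, h.frame_symm])
  have hsp : ∀ a b c, ∑ d, PowerSeries.C (Ω d c) * Γ a b d +
      ∑ d, PowerSeries.C (Ω b d) * Γ a c d = 0 := fun a b c => hinj (by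
    have h1 := h.parallel (frame a) (frame b) (frame c)
    rw [omega_frame, Derivation.map_algebraMap, omega_frame_right] at h1
    rw [map_zero, h1]
    simp [omega, hΓ, real_smul_eq])
  obtain ⟨A, hA⟩ := LinearCurve.exists_christoffel_eq (Ω := Ω) Γ
    (fun a b c => by
      have h1 := h.constantCoeff_dx a b c
      rw [hΓ, ← PowerSeries.coeff_zero_eq_constantCoeff_apply, coeff_algebraMap] at h1
      exact algebraMap_fn_injective (m := m) (by
        rw [map_zero, ← h1, PowerSeries.coeff_zero_eq_constantCoeff_apply]))
    hΓsymm
    (fun a b c => by simpa only [PowerSeries.smul_eq_C_mul] using hsp a b c)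
    (christoffel_mul_eq_zero hm hskew hdet hΓsymm hsp (ρ := ρ)
      (fun a b => hinj (by rw [← hρ, ← hρ, hr]))
      fun a b c d => hinj (by
        rw [← hcurv, hE, ricciTensor]
        simp only [hρ, real_smul_eq, map_add, map_sub, map_mul, map_ofNat]
        ring))
  refine ⟨A, ?_⟩
  rw [A.connection_eq]
  refine (constConnection_isConnection _).ext_frame h.toIsConnection fun a b =>
    formalVF_ext_dx fun c => ?_
  rw [dx_constConnection_frame, hA, hΓ]

/-! ### The action of the integral symplectic group -/

theorem toReal_apply (C : GL (Fin m) ℤ) (i j : Fin m) : (toReal C).1 i j = (C.1 i j : ℝ) := rfl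

theorem mulVec_add_intCast (C : GL (Fin m) ℤ) (x : Fin m → ℝ) (k : Fin m → ℤ) :
    (toReal C).1.mulVec (fun i => x i + k i) =
      fun i => (toReal C).1.mulVec x i + (C.1.mulVec k i : ℤ) := by
  funext i
  simp only [Matrix.mulVec, dotProduct, mul_add, Finset.sum_add_distrib, toReal_apply,
    Int.cast_sum, Int.cast_mul]

/-- Pullback of functions by the automorphism of the torus given by an integral matrix. -/
def pullback (C : GL (Fin m) ℤ) : Fn m →ₐ[ℝ] Fn m where
  toFun f := ⟨fun x => f.1 ((toReal C).1.mulVec x),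
    f.2.1.comp (Matrix.mulVecLin (toReal C).1).toContinuousLinearMap.contDiff, fun k x => by
      change f.1 ((toReal C).1.mulVec fun i => x i + k i) = f.1 ((toReal C).1.mulVec x)
      rw [mulVec_add_intCast, f.2.2]⟩
  map_one' := rfl
  map_zero' := rfl
  map_add' _ _ := rfl
  map_mul' _ _ := rfl
  commutes' _ := rfl

theorem pullback_pullback_inv (C : GL (Fin m) ℤ) (f : Fn m) :
    pullback C (pullback C⁻¹ f) = f := by
  apply Subtype.ext
  funext x
  change f.1 ((toReal C⁻¹).1.mulVec ((toReal C).1.mulVec x)) = f.1 x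
  rw [Matrix.mulVec_mulVec, toReal_inv_mul, Matrix.one_mulVec]

theorem partialFn_pullback (C : GL (Fin m) ℤ) (a : Fin m) (f : Fn m) :
    partialFn a (pullback C f) = ∑ c, (toReal C).1 c a • pullback C (partialFn c f) := by
  apply Subtype.ext
  funext x
  have h1 : HasFDerivAt (fun x => f.1 ((toReal C).1.mulVec x))
      ((fderiv ℝ f.1 ((toReal C).1.mulVec x)).comp
        (Matrix.mulVecLin (toReal C).1).toContinuousLinearMap) x :=
    HasFDerivAt.comp x (f.2.1.differentiable (by simp) _).hasFDerivAt
      (Matrix.mulVecLin (toReal C).1).toContinuousLinearMap.hasFDerivAt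
  have h2 : (partialFn a (pullback C f)).1 x =
      fderiv ℝ f.1 ((toReal C).1.mulVec x) ((toReal C).1.mulVec (Pi.single a 1)) := by
    change fderiv ℝ (fun x => f.1 ((toReal C).1.mulVec x)) x (Pi.single a 1) = _
    rw [h1.fderiv]
    rfl
  rw [h2, fderiv_apply_eq_sum]
  simp only [Matrix.mulVec_single_one, AddSubmonoidClass.coe_finsetSum, Finset.sum_apply]
  rfl

section Integral

variable {Ω : Matrix (Fin m) (Fin m) ℝ}

theorem toReal_mul_inv_mul_transpose (hdet : IsUnit Ω.det) {C : GL (Fin m) ℤ}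
    (hC : C ∈ spInt Ω) :
    (toReal C).1 * Ω⁻¹ * (toReal C).1.transpose = Ω⁻¹ := by
  have h1 := transpose_mul_of_mem hC
  calc (toReal C).1 * Ω⁻¹ * (toReal C).1.transpose
      = (toReal C).1 * Ω⁻¹ * ((toReal C).1.transpose * Ω) * Ω⁻¹ := by
        simp only [Matrix.mul_assoc, Matrix.mul_nonsing_inv _ hdet, Matrix.mul_one]
    _ = (toReal C).1 * (Ω⁻¹ * Ω) * (toReal C⁻¹).1 * Ω⁻¹ := by
        rw [h1]
        simp only [Matrix.mul_assoc]
    _ = Ω⁻¹ := by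
        rw [Matrix.nonsing_inv_mul _ hdet, Matrix.mul_one, toReal_mul_inv, Matrix.one_mul]

theorem bracket_pullback (hdet : IsUnit Ω.det) {C : GL (Fin m) ℤ} (hC : C ∈ spInt Ω)
    (f g : Fn m) : pullback C (bracket Ω f g) = bracket Ω (pullback C f) (pullback C g) := by
  rw [bracket_apply, bracket_apply]
  simp only [partialFn_pullback, Finset.sum_mul_sum, Finset.smul_sum, map_sum, map_smul, map_mul]
  rw [sum_exchange]
  refine Finset.sum_congr rfl fun c _ => Finset.sum_congr rfl fun d _ => ?_
  rw [← toReal_mul_inv_mul_transpose hdet hC, Matrix.mul_apply, Finset.sum_smul, Finset.sum_comm]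
  refine Finset.sum_congr rfl fun b _ => ?_
  rw [Matrix.mul_apply, Finset.sum_mul, Finset.sum_smul]
  refine Finset.sum_congr rfl fun a _ => ?_
  simp only [smul_mul_assoc, mul_smul_comm, smul_smul, Matrix.transpose_apply,
    toReal_mul_inv_mul_transpose hdet hC]
  congr 1
  ring

/-- The symplectomorphism of the torus given by an integral symplectic matrix. -/
def integralSymplectomorphism (hdet : IsUnit Ω.det) (C : spInt Ω) : FormalSymplectomorphism Ω where
  toAlgHom :=
    -- Functions are pulled back along the inverse of C, so that vector fields are pushed forward by
    -- C.
    { (PowerSeries.C : Fn m →+* FormalFn m).comp (pullback (C⁻¹).1 : Fn m →+* Fn m) with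
      commutes' := fun r => by
        change PowerSeries.C (pullback _ (algebraMap ℝ (Fn m) r)) = _
        rw [AlgHom.commutes, PowerSeries.algebraMap_apply] }
  map_bracket f g := by
    change PowerSeries.C (pullback _ _) = extendBilin _ (PowerSeries.C (pullback _ _))
      (PowerSeries.C (pullback _ _))
    rw [extendBilin_C, bracket_pullback hdet (C⁻¹).2]
  bijective_leading := by
    have h : (fun f => PowerSeries.constantCoeff (PowerSeries.C (pullback (C⁻¹).1 f))) =
        pullback (C⁻¹).1 := funext fun f => PowerSeries.constantCoeff_C _
    change Function.Bijective fun f => PowerSeries.constantCoeff (PowerSeries.C (pullback _ f))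
    rw [h]
    refine ⟨Function.LeftInverse.injective (g := pullback C.1) fun f => ?_,
      Function.RightInverse.surjective (g := pullback C.1) fun f => ?_⟩
    · rw [Subgroup.coe_inv, pullback_pullback_inv]
    · have := pullback_pullback_inv C.1⁻¹ f
      rwa [inv_inv] at this

theorem coeff_integralSymplectomorphism (hdet : IsUnit Ω.det) (C : spInt Ω) (F : FormalFn m)
    (k : ℕ) : PowerSeries.coeff k ((integralSymplectomorphism hdet C).extend F) =
      pullback (C⁻¹).1 (PowerSeries.coeff k F) := by
  rw [FormalSymplectomorphism.extend_apply, coeff_extendFun, Finset.sum_eq_zero, zero_add]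
  · change PowerSeries.constantCoeff (PowerSeries.C (pullback _ _)) = _
    rw [PowerSeries.constantCoeff_C]
  · intro j hj
    have := Finset.mem_range.1 hj
    change PowerSeries.coeff (k - j) (PowerSeries.C (pullback _ _)) = 0
    rw [PowerSeries.coeff_C, if_neg (by omega)]

/-- The chain rule `partialFn_pullback` displays the coefficients of ∂_a in the transported frame;
independence of that frame identifies them. -/
theorem coJacobian_integralSymplectomorphism (hdet : IsUnit Ω.det) (C : spInt Ω) :
    coJacobian (integralSymplectomorphism hdet C).extend =
      formalMatrix (toReal (C⁻¹).1).1.transpose := by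
  ext1 a c
  refine sub_eq_zero.1 (eq_zero_of_sum_mul_map_frame (integralSymplectomorphism hdet C).extend
    (M := fun c => coJacobian (integralSymplectomorphism hdet C).extend a c -
      formalMatrix (toReal (C⁻¹).1).1.transpose a c) (fun F => ?_) c)
  simp only [sub_mul, Finset.sum_sub_distrib]
  rw [← frame_apply_map, sub_eq_zero]
  ext1 k
  simp only [coeff_frame, coeff_integralSymplectomorphism, partialFn_pullback, map_sum,
    formalMatrix_apply, ← real_smul_eq, coeff_real_smul, Matrix.transpose_apply]

theorem jacobian_integralSymplectomorphism (hdet : IsUnit Ω.det) (C : spInt Ω) :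
    jacobian (integralSymplectomorphism hdet C).extend =
      formalMatrix (toReal C.1).1.transpose := by
  have h1 := jacobian_mul_coJacobian (integralSymplectomorphism hdet C).extend
  have h2 : formalMatrix (toReal (C⁻¹).1).1.transpose * formalMatrix (toReal C.1).1.transpose =
      1 := by
    rw [← formalMatrix_mul, ← Matrix.transpose_mul, Subgroup.coe_inv, toReal_mul_inv,
      Matrix.transpose_one, formalMatrix_one]
  rw [coJacobian_integralSymplectomorphism] at h1
  rw [← Matrix.mul_one (jacobian _), ← h2, ← Matrix.mul_assoc, h1, Matrix.one_mul]

namespace LinearCurve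

theorem toLin_smul (C : spInt Ω) (A : LinearCurve Ω) (X : Fin m → ℝ) :
    (C • A).toLin X = PowerSeries.C (toReal C.1).1 * A.toLin ((toReal C.1⁻¹).1.mulVec X) *
      PowerSeries.C (toReal C.1⁻¹).1 := rfl

/-- Equivariance evaluated on C∂_a and C∂_b, so that no inverse of C remains. This is the form met
when two connections are compared on the transported frame. -/
theorem sum_christoffel_smul (C : spInt Ω) (A : LinearCurve Ω) (a b c : Fin m) :
    ∑ d, ∑ e, PowerSeries.C ((toReal C.1).1 d a) * PowerSeries.C ((toReal C.1).1 e b) *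
        (C • A).christoffel d e c =
      ∑ f, PowerSeries.C ((toReal C.1).1 c f) * A.christoffel a b f := by
  ext k
  have h1 : ∑ d, (toReal C.1).1 d a • (C • A).toLin (Pi.single d 1) =
      PowerSeries.C (toReal C.1).1 * A.toLin (Pi.single a 1) * PowerSeries.C (toReal C.1⁻¹).1 := by
    have h2 : ∑ d, (toReal C.1).1 d a • (Pi.single d 1 : Fin m → ℝ) =
        (toReal C.1).1.mulVec (Pi.single a 1) := by
      funext j
      simp [Finset.sum_apply, Pi.single_apply]
    simp only [← map_smul, ← map_sum, h2]
    rw [toLin_smul, Matrix.mulVec_mulVec, toReal_inv_mul, Matrix.one_mulVec]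
  have h3 := congrArg (PowerSeries.coeff k) h1
  rw [PowerSeries.coeff_mul_C, PowerSeries.coeff_C_mul] at h3
  have h4 := congrArg (· * (toReal C.1).1) h3
  simp only [Matrix.mul_assoc, toReal_inv_mul, Matrix.mul_one] at h4
  have h5 := congrFun (congrFun h4 c) b
  simp only [Matrix.mul_apply, map_sum, PowerSeries.coeff_smul, Matrix.sum_apply,
    Matrix.smul_apply, smul_eq_mul, Finset.sum_mul] at h5
  simp only [map_sum, mul_assoc, PowerSeries.coeff_C_mul, coeff_christoffel]
  rw [← h5, Finset.sum_comm]
  exact Finset.sum_congr rfl fun e _ => Finset.sum_congr rfl fun d _ => by ring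

theorem actConn_connection (hdet : IsUnit Ω.det) (C : spInt Ω) (A : LinearCurve Ω) :
    actConn (integralSymplectomorphism hdet C).extend A.connection = (C • A).connection := by
  have hJ : ∀ a, actVF (integralSymplectomorphism hdet C).extend (frame a) =
      ∑ c, algebraMap ℝ⟦X⟧ (FormalFn m) (PowerSeries.C ((toReal C.1).1 c a)) • frame c :=
    fun a => by
      rw [actVF_frame, jacobian_integralSymplectomorphism]
      rfl
  have hA := constConnection_isConnection A.christoffel
  have hCA := constConnection_isConnection (C • A).christoffel
  rw [connection_eq, connection_eq]
  refine actConn_eq_of_frame _ hA hCA fun a b => formalVF_ext_dx fun c => ?_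
  have h1 := congrArg (algebraMap ℝ⟦X⟧ (FormalFn m)) (sum_christoffel_smul C A a b c)
  have h2 : dx c (actVF (integralSymplectomorphism hdet C).extend
      (constConnection A.christoffel (frame a) (frame b))) =
      ∑ f, algebraMap ℝ⟦X⟧ (FormalFn m) (PowerSeries.C ((toReal C.1).1 c f)) *
        algebraMap ℝ⟦X⟧ (FormalFn m) (A.christoffel a b f) := by
    conv_lhs => rw [eq_sum_dx_frame (constConnection A.christoffel (frame a) (frame b)), actVF_sum]
    simp only [actVF_smul, hJ, dx_constConnection_frame, AlgEquiv.commutes, dx_sum, dx_smul,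
      dx_frame]
    refine Finset.sum_congr rfl fun f _ => ?_
    simp [mul_comm]
  rw [h2, dx_constConnection]
  simp only [hJ, dx_sum, dx_smul, dx_frame, mul_ite, mul_one, mul_zero, Finset.sum_ite_eq,
    Finset.mem_univ, if_true, Derivation.map_algebraMap, zero_add]
  simpa only [map_sum, map_mul] using h1

end LinearCurve

end Integral

/-! ### Rigidity of constant connections -/

section Rigidity

variable {Φ : FormalFn m ≃ₐ[ℝ⟦X⟧] FormalFn m}

/-- Differentiate the identity between a matrix and its inverse: with K the coJacobian and J the
Jacobian, (∂K)J = -K∂J. -/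
theorem dvd_frame_coJacobian {k : ℕ}
    (h : ∀ a b c, (PowerSeries.X : FormalFn m) ^ k ∣ frame a (jacobian Φ b c)) (a b c : Fin m) :
    (PowerSeries.X : FormalFn m) ^ k ∣ frame a (coJacobian Φ b c) := by
  have h1 : ∀ d, (PowerSeries.X : FormalFn m) ^ k ∣
      ∑ e, frame a (coJacobian Φ b e) * jacobian Φ e d := fun d => by
    have h2 := congrArg (frame a) (congrFun (congrFun (coJacobian_mul_jacobian Φ) b) d)
    have h3 : frame a ((1 : Matrix (Fin m) (Fin m) (FormalFn m)) b d) = 0 := by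
      rw [Matrix.one_apply]
      split_ifs <;> simp
    rw [h3, Matrix.mul_apply, map_sum] at h2
    simp only [Derivation.leibniz, smul_eq_mul, Finset.sum_add_distrib] at h2
    have h4 : ∑ e, frame a (coJacobian Φ b e) * jacobian Φ e d =
        -∑ e, coJacobian Φ b e * frame a (jacobian Φ e d) := by
      simp only [mul_comm (frame a (coJacobian Φ b _))]
      linear_combination h2
    rw [h4]
    exact (Finset.dvd_sum fun e _ => (h a e d).mul_left _).neg_right
  have h2 : frame a (coJacobian Φ b c) = ∑ d,
      (∑ e, frame a (coJacobian Φ b e) * jacobian Φ e d) * coJacobian Φ d c := by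
    simp only [Finset.sum_mul, mul_assoc]
    rw [Finset.sum_comm]
    simp only [← Finset.mul_sum, ← Matrix.mul_apply, jacobian_mul_coJacobian]
    simp [Matrix.one_apply]
  rw [h2]
  exact Finset.dvd_sum fun d _ => (h1 d).mul_right _

theorem eq_zero_of_forall_X_pow_dvd {F : FormalFn m}
    (h : ∀ k, (PowerSeries.X : FormalFn m) ^ k ∣ F) : F = 0 := by
  ext1 k
  rw [PowerSeries.X_pow_dvd_iff.1 (h (k + 1)) k k.lt_succ_self, map_zero]

/-- An automorphism relating two constant connections has constant Jacobian. -/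
theorem frame_jacobian_eq_zero {Γ Γ' : Fin m → Fin m → Fin m → ℝ⟦X⟧}
    (h0 : ∀ a b c, PowerSeries.constantCoeff (Γ a b c) = 0)
    (h0' : ∀ a b c, PowerSeries.constantCoeff (Γ' a b c) = 0)
    (h : actConn Φ (constConnection Γ) = constConnection Γ') (a b c : Fin m) :
    frame a (jacobian Φ b c) = 0 := by
  have hX : ∀ {r : ℝ⟦X⟧}, PowerSeries.constantCoeff r = 0 →
      (PowerSeries.X : FormalFn m) ∣ algebraMap ℝ⟦X⟧ (FormalFn m) r := fun {r} hr => by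
    rw [PowerSeries.X_dvd_iff, ← PowerSeries.coeff_zero_eq_constantCoeff_apply, coeff_algebraMap,
      PowerSeries.coeff_zero_eq_constantCoeff_apply, hr, map_zero]
  have heq : ∀ a b c, frame a (jacobian Φ b c) =
      ∑ e, ∑ f, coJacobian Φ a e * algebraMap ℝ⟦X⟧ (FormalFn m) (Γ e b f) * jacobian Φ f c -
        ∑ d, jacobian Φ b d * algebraMap ℝ⟦X⟧ (FormalFn m) (Γ' a d c) := fun a b c => by
    have h1 := christoffel_actConn (constConnection_isConnection Γ) Φ a b c
    simp only [h, dx_constConnection_frame, AlgEquiv.commutes] at h1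
    rw [← h1, add_sub_cancel_right]
  have main : ∀ k, ∀ a b c, (PowerSeries.X : FormalFn m) ^ k ∣ frame a (jacobian Φ b c) := by
    intro k
    induction k with
    | zero => simp
    | succ k ih =>
      intro a b c
      have hK := dvd_frame_coJacobian ih
      -- By `heq`, ∂J is linear in the constant symbols, which have order 1. A further derivative
      -- falls on J or K and has order k by induction, so second derivatives of J gain one order.
      have h2 : ∀ x, (PowerSeries.X : FormalFn m) ^ (k + 1) ∣
          frame x (frame a (jacobian Φ b c)) := fun x => by
        rw [heq, map_sub, map_sum, map_sum]
        simp only [map_sum, Derivation.leibniz, Derivation.map_algebraMap, smul_eq_mul, mul_zero,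
          zero_add, pow_succ']
        refine dvd_sub (Finset.dvd_sum fun e _ => Finset.dvd_sum fun f _ => dvd_add ?_ ?_)
          (Finset.dvd_sum fun d _ => mul_dvd_mul (hX (h0' _ _ _)) (ih _ _ _))
        · exact mul_dvd_mul ((hX (h0 _ _ _)).mul_left _) (ih _ _ _)
        · exact (mul_dvd_mul (hX (h0 _ _ _)) (hK _ _ _)).mul_left _
      rw [PowerSeries.X_pow_dvd_iff]
      intro j hj
      rcases (Nat.lt_succ_iff.1 hj).lt_or_eq with hj | rfl
      · exact PowerSeries.X_pow_dvd_iff.1 (ih a b c) j hj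
      · rw [coeff_frame]
        -- Periodicity carries the gain from second derivatives back to first ones.
        refine partialFn_eq_zero_of_partialFn_partialFn fun x => ?_
        have h3 := PowerSeries.X_pow_dvd_iff.1 (h2 x) j j.lt_succ_self
        rwa [coeff_frame, coeff_frame] at h3
  exact eq_zero_of_forall_X_pow_dvd fun k => main k a b c

/-- A nonzero periodic solution of a rotation equation has integral frequency. -/
theorem exists_int_eq_of_rotation {u v : Fn m} {κ : ℝ} (d : Fin m)
    (hu : partialFn d u = -((2 * Real.pi * κ) • v)) (hv : partialFn d v = (2 * Real.pi * κ) • u)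
    (huv : u ^ 2 + v ^ 2 = 1) : ∃ n : ℤ, κ = n := by
  set α := 2 * Real.pi * κ with hα
  have hline : ∀ (f : Fn m) (s : ℝ), HasDerivAt (fun s : ℝ => f.1 (s • Pi.single d 1))
      ((partialFn d f).1 (s • Pi.single d 1)) s := fun f s => by
    have h1 := (f.2.1.differentiable (by simp) (s • Pi.single d 1)).hasFDerivAt
    have h2 : HasDerivAt (fun s : ℝ => s • (Pi.single d 1 : Fin m → ℝ)) (Pi.single d 1) s := by
      simpa using (hasDerivAt_id s).smul_const (Pi.single d 1 : Fin m → ℝ)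
    exact h1.comp_hasDerivAt s h2
  have hper : ∀ f : Fn m, f.1 ((1 : ℝ) • Pi.single d 1) = f.1 ((0 : ℝ) • Pi.single d 1) := fun f => by
    have h : (1 : ℝ) • (Pi.single d 1 : Fin m → ℝ) =
        fun i => ((0 : ℝ) • (Pi.single d 1 : Fin m → ℝ)) i + ((Pi.single d 1 : Fin m → ℤ) i : ℝ) := by
      funext i
      by_cases hi : i = d
      · subst hi
        simp
      · simp [hi]
    rw [h, f.2.2]
  have hu' : ∀ x, (partialFn d u).1 x = -(α * v.1 x) := fun x => by rw [hu]; rfl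
  have hv' : ∀ x, (partialFn d v).1 x = α * u.1 x := fun x => by rw [hv]; rfl
  have hcos : ∀ s : ℝ, HasDerivAt (fun s => Real.cos (α * s)) (-Real.sin (α * s) * α) s :=
    fun s => by simpa using ((hasDerivAt_id s).const_mul α).cos
  have hsin : ∀ s : ℝ, HasDerivAt (fun s => Real.sin (α * s)) (Real.cos (α * s) * α) s :=
    fun s => by simpa using ((hasDerivAt_id s).const_mul α).sin
  have hconst : ∀ p : ℝ → ℝ, (∀ s, HasDerivAt p 0 s) → p 1 = p 0 := fun p hp =>
    is_const_of_deriv_eq_zero (fun s => (hp s).differentiableAt) (fun s => (hp s).deriv) 1 0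
  -- Along the closed loop in direction d, the vector (u, v) turned back by the angle αs does not
  -- change. Periodicity then makes rotation by α fix a unit vector, so cos α = 1.
  have h1 := hconst (fun s => u.1 (s • Pi.single d 1) * Real.cos (α * s) +
    v.1 (s • Pi.single d 1) * Real.sin (α * s)) fun s => by
      refine (((hline u s).mul (hcos s)).add ((hline v s).mul (hsin s))).congr_deriv ?_
      rw [hu', hv']
      ring
  have h2 := hconst (fun s => v.1 (s • Pi.single d 1) * Real.cos (α * s) -
    u.1 (s • Pi.single d 1) * Real.sin (α * s)) fun s => by
      refine (((hline v s).mul (hcos s)).sub ((hline u s).mul (hsin s))).congr_deriv ?_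
      rw [hu', hv']
      ring
  have h3 : u.1 ((0 : ℝ) • Pi.single d 1) ^ 2 + v.1 ((0 : ℝ) • Pi.single d 1) ^ 2 = 1 :=
    congrFun (congrArg Subtype.val huv) _
  simp only [hper, mul_one, mul_zero, Real.cos_zero, Real.sin_zero, add_zero, sub_zero] at h1 h2
  have h4 : Real.cos α = 1 := by
    linear_combination u.1 ((0 : ℝ) • Pi.single d 1) * h1 + v.1 ((0 : ℝ) • Pi.single d 1) * h2 +
      (1 - Real.cos α) * h3
  obtain ⟨n, hn⟩ := (Real.cos_eq_one_iff α).1 h4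
  refine ⟨n, ?_⟩
  have hpi := Real.pi_pos.ne'
  have h5 : (2 * Real.pi) * (κ - n) = 0 := by
    rw [mul_sub, ← hα, ← hn]
    ring
  have h6 := (mul_eq_zero.1 h5).resolve_left (by positivity)
  linear_combination h6

/-- The formal version of `exists_int_eq_of_rotation`. -/
theorem exists_int_eq_of_formal_rotation {u v : FormalFn m} {κ : ℝ⟦X⟧} (d : Fin m)
    (hu : frame d u = -((2 * Real.pi) • (algebraMap ℝ⟦X⟧ (FormalFn m) κ * v)))
    (hv : frame d v = (2 * Real.pi) • (algebraMap ℝ⟦X⟧ (FormalFn m) κ * u))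
    (huv : u ^ 2 + v ^ 2 = 1) : ∃ n : ℤ, κ = PowerSeries.C (n : ℝ) := by
  have huv0 : PowerSeries.constantCoeff u ^ 2 + PowerSeries.constantCoeff v ^ 2 = 1 := by
    rw [← map_pow, ← map_pow, ← map_add, huv, map_one]
  have hcu : ∀ k, partialFn d (PowerSeries.coeff k u) = -((2 * Real.pi) •
      ∑ p ∈ Finset.HasAntidiagonal.antidiagonal k, PowerSeries.coeff p.1 κ •
        PowerSeries.coeff p.2 v) := fun k => by
    rw [← coeff_frame, hu, map_neg, coeff_real_smul, PowerSeries.coeff_mul]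
    simp only [coeff_algebraMap, ← Algebra.smul_def]
  have hcv : ∀ k, partialFn d (PowerSeries.coeff k v) = (2 * Real.pi) •
      ∑ p ∈ Finset.HasAntidiagonal.antidiagonal k, PowerSeries.coeff p.1 κ •
        PowerSeries.coeff p.2 u := fun k => by
    rw [← coeff_frame, hv, coeff_real_smul, PowerSeries.coeff_mul]
    simp only [coeff_algebraMap, ← Algebra.smul_def]
  have hu0 := hcu 0
  have hv0 := hcv 0
  simp only [Finset.Nat.antidiagonal_zero, Finset.sum_singleton, smul_smul,
    PowerSeries.coeff_zero_eq_constantCoeff_apply] at hu0 hv0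
  obtain ⟨n, hn⟩ := exists_int_eq_of_rotation d hu0 hv0 huv0
  refine ⟨n, ?_⟩
  -- Degree 0 is the rotation equation for functions. In higher degree, all coefficients of κ
  -- strictly between 0 and k vanish by induction.
  ext k
  induction k using Nat.strong_induction_on with
  | _ k ih =>
    obtain rfl | hk := eq_or_ne k 0
    · simpa using hn
    rw [PowerSeries.coeff_C, if_neg hk]
    obtain ⟨k, rfl⟩ := Nat.exists_eq_succ_of_ne_zero hk
    have hsum : ∀ w : FormalFn m, ∑ p ∈ Finset.HasAntidiagonal.antidiagonal (k + 1),
        PowerSeries.coeff p.1 κ • PowerSeries.coeff p.2 w =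
        PowerSeries.constantCoeff κ • PowerSeries.coeff (k + 1) w +
          PowerSeries.coeff (k + 1) κ • PowerSeries.constantCoeff w := fun w => by
      rw [Finset.Nat.sum_antidiagonal_eq_sum_range_succ
        (fun i j => PowerSeries.coeff i κ • PowerSeries.coeff j w), Finset.sum_range_succ,
        Finset.sum_range_succ', Finset.sum_eq_zero]
      · simp
      · intro j hj
        have := Finset.mem_range.1 hj
        rw [ih (j + 1) (by omega), PowerSeries.coeff_C, if_neg (by omega), zero_smul]
    have h1 := hcu (k + 1)
    have h2 := hcv (k + 1)
    rw [hsum] at h1 h2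
    -- This is the first variation of the angle: the terms with the leading frequency cancel, and
    -- the derivative is the constant 2π times the coefficient of κ. A constant that is a derivative
    -- is zero.
    have h3 : partialFn d (PowerSeries.constantCoeff u * PowerSeries.coeff (k + 1) v -
        PowerSeries.constantCoeff v * PowerSeries.coeff (k + 1) u) =
        algebraMap ℝ (Fn m) (2 * Real.pi * PowerSeries.coeff (k + 1) κ) := by
      rw [map_sub, Derivation.leibniz, Derivation.leibniz, h1, h2, hu0, hv0]
      simp only [Algebra.smul_def, map_mul, Algebra.algebraMap_self, RingHom.id_apply]
      linear_combination algebraMap ℝ (Fn m) 2 * algebraMap ℝ (Fn m) Real.pi *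
        algebraMap ℝ (Fn m) (PowerSeries.coeff (k + 1) κ) * huv0
    have h4 := eq_zero_of_partialFn_eq_algebraMap h3
    exact (mul_eq_zero.1 h4).resolve_left (by positivity)

/-- A constant Jacobian is integral. -/
theorem exists_int_coJacobian (h : ∀ a b c, frame a (coJacobian Φ b c) = 0) (b c : Fin m) :
    ∃ n : ℤ, coJacobian Φ b c = algebraMap ℝ⟦X⟧ (FormalFn m) (PowerSeries.C (n : ℝ)) := by
  obtain ⟨κ, hκ⟩ := exists_eq_algebraMap_of_frame fun a => h a b c
  have hΦ : ∀ (r : ℝ) (f : Fn m), Φ (PowerSeries.C (r • f)) = r • Φ (PowerSeries.C f) :=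
    fun r f => by rw [C_real_smul, real_smul_eq, map_mul, AlgEquiv.commutes, real_smul_eq]
  -- The images of cos 2πx_c and sin 2πx_c rotate along ∂_b with frequency the entry κ of the
  -- coJacobian.
  obtain ⟨n, hn⟩ := exists_int_eq_of_formal_rotation (κ := κ) b
    (u := Φ (PowerSeries.C (cosFn c))) (v := Φ (PowerSeries.C (sinFn c)))
    (by
      simp only [frame_apply_map, frame_C, partialFn_cosFn, hΦ]
      rw [Finset.sum_eq_single c, if_pos rfl, hκ, mul_smul_comm, neg_smul]
      · intro e _ he
        rw [if_neg he, neg_zero, zero_smul, mul_zero]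
      · exact fun hc => absurd (Finset.mem_univ c) hc)
    (by
      simp only [frame_apply_map, frame_C, partialFn_sinFn, hΦ]
      rw [Finset.sum_eq_single c, if_pos rfl, hκ, mul_smul_comm]
      · intro e _ he
        rw [if_neg he, zero_smul, mul_zero]
      · exact fun hc => absurd (Finset.mem_univ c) hc)
    (by
      rw [pow_two, pow_two, ← map_mul Φ, ← map_mul Φ, ← map_mul PowerSeries.C,
        ← map_mul PowerSeries.C, ← map_add Φ, ← map_add PowerSeries.C, cosFn_sq_add_sinFn_sq,
        map_one, map_one])
  exact ⟨n, hκ.trans (by rw [hn])⟩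

/-- The image of a constant connection depends only on the Jacobian. -/
theorem actConn_constConnection_eq_of_jacobian {Φ Φ' : FormalFn m ≃ₐ[ℝ⟦X⟧] FormalFn m}
    (h : jacobian Φ = jacobian Φ') (Γ : Fin m → Fin m → Fin m → ℝ⟦X⟧) :
    actConn Φ (constConnection Γ) = actConn Φ' (constConnection Γ) := by
  have hD := constConnection_isConnection Γ
  have hK : coJacobian Φ = coJacobian Φ' := by
    rw [← Matrix.mul_one (coJacobian Φ), ← jacobian_mul_coJacobian Φ', ← Matrix.mul_assoc, ← h,
      coJacobian_mul_jacobian, Matrix.one_mul]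
  refine (hD.actConn Φ).ext_frame (hD.actConn Φ') fun a b => formalVF_ext_dx fun c => ?_
  have h1 : ∀ b, ∑ d, jacobian Φ b d * dx c (actConn Φ (constConnection Γ) (frame a) (frame d)) =
      ∑ d, jacobian Φ b d * dx c (actConn Φ' (constConnection Γ) (frame a) (frame d)) := fun b => by
    have h2 := christoffel_actConn hD Φ a b c
    have h3 := christoffel_actConn hD Φ' a b c
    -- Automorphisms fix constants, so in the transformation law Φ enters only through its Jacobian
    -- and the inverse.
    simp only [dx_constConnection_frame, AlgEquiv.commutes, ← h, ← hK] at h2 h3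
    exact add_left_cancel (h2.trans h3.symm)
  have h4 := congrArg ((coJacobian Φ).mulVec) (funext h1 :
    (jacobian Φ).mulVec (fun d => dx c (actConn Φ (constConnection Γ) (frame a) (frame d))) =
    (jacobian Φ).mulVec (fun d => dx c (actConn Φ' (constConnection Γ) (frame a) (frame d))))
  rw [Matrix.mulVec_mulVec, Matrix.mulVec_mulVec, coJacobian_mul_jacobian, Matrix.one_mulVec,
    Matrix.one_mulVec] at h4
  exact congrFun h4 b

end Rigidity

/-! ### From an equivalence to an integral symplectic matrix -/

theorem LinearCurve.connection_injective {Ω : Matrix (Fin m) (Fin m) ℝ} {A B : LinearCurve Ω}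
    (h : A.connection = B.connection) : A = B := by
  refine LinearCurve.ext_christoffel (funext fun a => funext fun b => funext fun c =>
    algebraMap_formalFn_injective (m := m) ?_)
  rw [← dx_constConnection_frame, ← dx_constConnection_frame, ← A.connection_eq, h,
    B.connection_eq]

/-- The Jacobian of ψ and its inverse are both integral, so its transpose is an element C of the
integral symplectic group. The symplectomorphism attached to C has the same Jacobian, hence the same
effect on a constant connection. -/
theorem LinearCurve.exists_smul_eq {Ω : Matrix (Fin m) (Fin m) ℝ} (hdet : IsUnit Ω.det)
    {A B : LinearCurve Ω} (ψ : FormalSymplectomorphism Ω)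
    (h : actConn ψ.extend A.connection = B.connection) : ∃ C : spInt Ω, C • A = B := by
  have hJ0 : ∀ a b c, frame a (jacobian ψ.extend b c) = 0 :=
    frame_jacobian_eq_zero A.christoffel_zero B.christoffel_zero h
  have hK0 : ∀ a b c, frame a (coJacobian ψ.extend b c) = 0 := fun a b c =>
    eq_zero_of_forall_X_pow_dvd fun k => dvd_frame_coJacobian (fun a b c => by
      rw [hJ0]
      exact dvd_zero _) a b c
  -- The coJacobian of the inverse automorphism is the preimage of the Jacobian, which is fixed
  -- because it is constant. Integrality of the Jacobian thus follows from the same lemma as that of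
  -- the coJacobian.
  have hJs : ∀ b c, coJacobian ψ.extend.symm b c = jacobian ψ.extend b c := fun b c => by
    obtain ⟨r, hr⟩ := exists_eq_algebraMap_of_frame fun a => hJ0 a b c
    change ψ.extend.symm (jacobian ψ.extend b c) = _
    rw [hr, AlgEquiv.commutes]
  choose N hN using exists_int_coJacobian hK0
  choose M hM using exists_int_coJacobian (Φ := ψ.extend.symm) fun a b c => by rw [hJs, hJ0]
  simp only [hJs] at hM
  let ι : ℤ →+* FormalFn m := (algebraMap ℝ⟦X⟧ (FormalFn m)).comp
    ((PowerSeries.C : ℝ →+* ℝ⟦X⟧).comp (Int.castRingHom ℝ))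
  have hι : Function.Injective ι := algebraMap_formalFn_injective.comp
    (PowerSeries.C_injective.comp Int.cast_injective)
  have hM' : jacobian ψ.extend = (Matrix.of M).map ι := Matrix.ext hM
  have hN' : coJacobian ψ.extend = (Matrix.of N).map ι := Matrix.ext hN
  have hMN : Matrix.of M * Matrix.of N = 1 := by
    refine Matrix.map_injective hι ?_
    beta_reduce
    rw [Matrix.map_mul, ← hM', ← hN', jacobian_mul_coJacobian,
      Matrix.map_one _ (map_zero _) (map_one _)]
  have hNM : Matrix.of N * Matrix.of M = 1 := mul_eq_one_comm.1 hMN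
  let C : GL (Fin m) ℤ := ⟨(Matrix.of M).transpose, (Matrix.of N).transpose,
    by rw [← Matrix.transpose_mul, hNM, Matrix.transpose_one],
    by rw [← Matrix.transpose_mul, hMN, Matrix.transpose_one]⟩
  have hJC : jacobian ψ.extend = formalMatrix (toReal C).1.transpose := Matrix.ext hM
  have hinj : Function.Injective
      (formalMatrix : Matrix (Fin m) (Fin m) ℝ → Matrix (Fin m) (Fin m) (FormalFn m)) :=
    Matrix.map_injective (algebraMap_formalFn_injective.comp PowerSeries.C_injective)
  have hC : C ∈ spInt Ω := by
    change (toReal C).1.transpose * Ω * (toReal C).1 = Ω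
    apply hinj
    have h1 := jacobian_symplectic ((exists_extend_eq_iff Ω ψ.extend).1 ⟨ψ, rfl⟩) hdet
    rw [hJC] at h1
    rw [formalMatrix_mul, formalMatrix_mul]
    exact h1
  refine ⟨⟨C, hC⟩, connection_injective ?_⟩
  rw [← actConn_connection hdet, ← h, connection_eq]
  exact actConn_constConnection_eq_of_jacobian
    ((jacobian_integralSymplectomorphism hdet ⟨C, hC⟩).trans hJC.symm) _

end RicciTorus

end

/-! ### The bijection -/

theorem mainTheorem3 (n : ℕ) (hn : 2 ≤ n) (Ω : Matrix (Fin (2 * n)) (Fin (2 * n)) ℝ)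
    (hskew : Ω.transpose = -Ω) (hdet : IsUnit Ω.det) :
    ∃ e : MulAction.orbitRel.Quotient (RicciTorus.spInt Ω) (RicciTorus.LinearCurve Ω) ≃
        RicciTorus.ModuliSpace Ω,
      ∀ A : RicciTorus.LinearCurve Ω,
        ∃ h : A.connection ∈ RicciTorus.ricciCurves Ω,
          e (Quotient.mk _ A) = Quotient.mk _ ⟨A.connection, h⟩ := by
  let F : RicciTorus.LinearCurve Ω → RicciTorus.ModuliSpace Ω :=
    fun A => Quotient.mk _ ⟨A.connection, A.connection_mem⟩
  have hF : ∀ A B : RicciTorus.LinearCurve Ω,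
      MulAction.orbitRel (RicciTorus.spInt Ω) (RicciTorus.LinearCurve Ω) A B → F A = F B := by
    rintro _ B ⟨C, rfl⟩
    have h : RicciTorus.ricciSetoid Ω ⟨B.connection, B.connection_mem⟩
        ⟨(C • B).connection, (C • B).connection_mem⟩ :=
      ⟨RicciTorus.integralSymplectomorphism hdet C, B.actConn_connection hdet C⟩
    exact (Quotient.sound h).symm
  refine ⟨Equiv.ofBijective (Quotient.lift F hF) ⟨?_, ?_⟩, fun A => ⟨A.connection_mem, rfl⟩⟩
  -- Injectivity is rigidity: an equivalence of constant connections comes from an integral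
  -- symplectic matrix.
  · rintro ⟨A⟩ ⟨B⟩ hAB
    obtain ⟨ψ, hψ⟩ := Quotient.exact (hAB : F A = F B)
    obtain ⟨C, hC⟩ := RicciTorus.LinearCurve.exists_smul_eq hdet ψ hψ
    have h : MulAction.orbitRel (RicciTorus.spInt Ω) (RicciTorus.LinearCurve Ω) B A := ⟨C, hC⟩
    exact Quotient.sound (Setoid.symm' _ h)
  -- Surjectivity is the normal form; n ≥ 2 provides the dimension at least 3 that both the Bianchi
  -- argument and the trace argument need.
  · rintro ⟨⟨D, hD⟩⟩
    obtain ⟨ψ, hψ, hc⟩ :=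
      (RicciTorus.isRicciLike_of_mem hD).exists_const (by omega) hskew hdet
    obtain ⟨A, hA⟩ := hψ.exists_linearCurve (by omega) hskew hdet hc
    have h : RicciTorus.ricciSetoid Ω ⟨D, hD⟩ ⟨A.connection, A.connection_mem⟩ := ⟨ψ, hA.symm⟩
    exact ⟨Quotient.mk _ A, Quotient.sound (Setoid.symm h)⟩
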